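/- **Definitions.** An $m$-digraph $H$ has a finite vertex set $V(H)$ and an edge set $E(H)\subseteq V(H)^m$ (entries may be repeated); $\mathrm{multi}(v,e)$ is the multiplicity of $v$ in the tuple $e$, and $e$ is one-to-one if it has no repeated entry. $H[S]$ consists of the vertices in $S$ and the edges with all entries in $S$, and $H-A=H[V(H)\setminus A]$. A perfect matching of $H$ is a set of one-to-one edges such that every vertex is covered by exactly one of them. Let $\mathcal B=\{B_1,\dots,B_\ell\}$ be a family of pairwise disjoint subsets of $V(H)$ with $\sum_i|B_i|=m$. A tuple $B\in\mathcal B^m$ is *suitable* if each $B_i$ occurs exactly $|B_i|$ times in $B$ and $E(H)$ contains every $e\in B(1)\times\dots\times B(m)$ such that $e(i)=e(j)$ whenever $B(i)=B(j)$. $H$ is *fissile* if for every suitable $B$ it has a one-to-one edge whose vertices cover the sets of $B$. For $0\le\rho\le1$, let $\mathrm{Spa}_\rho$ be the set of $m$-digraphs $H$ that have a $\rho$-perfect fractional matching, that is, a function $\omega:E(H)\to[0,1]$ with $\sum_{e}\omega(e)\,\mathrm{multi}(v,e)\le1$ for every vertex $v$ and $\sum_e\omega(e)\ge(1-\rho)|V(H)|/m$.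 Let $\mathrm{Div}$ be the set of $m$-digraphs $H$ such that the subgroup of $\mathbb Z^{V(H)}$ generated by the vectors $(\mathrm{multi}(v,e))_{v}$, $e\in E(H)$, contains $\mathbf 1_v-\mathbf 1_u$ for all $u,v\in V(H)$. Let $\mathrm{Cov}$ be the set of $m$-digraphs in which every vertex has multiplicity one in some edge. The property graph $P^{(s)}(H;\mathcal P)$ is the $s$-uniform hypergraph on $V(H)$ whose edges are the $s$-sets $S$ with $H[S]\in\mathcal P$. For an $s$-uniform hypergraph $P$, $\delta_1(P)$ is its minimum vertex degree, and $\mathrm{th}_1(\mathrm{Mat}_s)$ is the infimum of all $\delta\in[0,1]$ such that for every $\mu>0$ and all large enough $n$ divisible by $s$, every $n$-vertex $s$-uniform hypergraph $P$ with $\delta_1(P)\ge(\delta+\mu)\binom{n-1}{s-1}$ has a perfect matching. **Theorem.** For all integers $2\le m\le r$ and reals $\mu,\alpha>0$ there is $\rho\in(0,1]$ such that both of the following hold. (i) There is $n_0>0$ such that for every $s\ge m$ the following holds. Let $H$ be a fissile $m$-digraph on $n\ge n_0$ vertices, where $m\mid n$ and $s\le n$. Suppose that for every set $A\subseteq V(H)$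 of at most $\alpha n$ vertices $$\delta_1\big(P^{(s)}(H-A;\mathrm{Spa}_\rho)\big)\ \ge\ (\mathrm{th}_1(\mathrm{Mat}_s)+\mu)\tbinom{n-1}{s-1},$$ and that $$\delta_1\big(P^{(r)}(H;\mathrm{Div}\cap\mathrm{Cov})\big)\ \ge\ (\mathrm{th}_1(\mathrm{Mat}_r)+\mu)\tbinom{n-1}{r-1}.$$ Then $H$ has a perfect matching. (ii) For every $s\ge m$ there is $n_0>0$ such that every fissile $m$-digraph $H$ on $n\ge n_0$ vertices with $m\mid n$ has a perfect matching, if it satisfies the two degree conditions of (i) with $\binom{n-1}{s-1}$ replaced by $\binom{n-|A|-1}{s-1}$ in the first one. -/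

import Mathlib

universe u

noncomputable section

/-! ### Uniform hypergraphs -/

/-- An `s`-graph with finite vertex set `verts ⊆ V`; every edge is a set of `s` vertices. -/
structure UniformHypergraph (V : Type*) (s : ℕ) where
  verts : Finset V
  edges : Finset (Finset V)
  edge_subset : ∀ S ∈ edges, S ⊆ verts
  edge_card : ∀ S ∈ edges, S.card = s

namespace UniformHypergraph

variable {V : Type*} {s : ℕ}

open Classical in
/-- The number of edges of `P` that contain the set `D`. -/
def degree (P : UniformHypergraph V s) (D : Finset V) : ℕ :=
  (P.edges.filter (fun S => D ⊆ S)).card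

/-- The minimum `d`-degree of `P`: the largest `l` such that every `d`-set of vertices is contained
in at least `l` edges. -/
def minDegree (d : ℕ) (P : UniformHypergraph V s) : ℕ :=
  sSup {l : ℕ | ∀ D : Finset V, D ⊆ P.verts → D.card = d → l ≤ P.degree D}

/-- `P` has a set of pairwise disjoint edges that covers all its vertices. -/
def HasPerfectMatching (P : UniformHypergraph V s) : Prop :=
  ∃ M : Finset (Finset V), M ⊆ P.edges ∧
    (∀ S ∈ M, ∀ T ∈ M, S ≠ T → Disjoint S T) ∧ ∀ v ∈ P.verts, ∃ S ∈ M, v ∈ S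

end UniformHypergraph

/-- The minimum vertex degree threshold `th₁(Mat_s)` for perfect matchings in `s`-graphs. -/
def matchingThreshold (s : ℕ) : ℝ :=
  sInf {δ : ℝ | 0 ≤ δ ∧ δ ≤ 1 ∧ ∀ μ : ℝ, 0 < μ → ∃ n₀ : ℕ, ∀ n : ℕ, n₀ ≤ n → s ∣ n →
    ∀ (V : Type) (P : UniformHypergraph V s), P.verts.card = n →
      (δ + μ) * ((n - 1).choose (s - 1) : ℝ) ≤ (P.minDegree 1 : ℝ) → P.HasPerfectMatching}

/-! ### Directed hypergraphs -/

/-- An `m`-uniform directed hypergraph with finite vertex set `verts ⊆ V`; its edges are `m`-tuples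
of vertices, in which vertices may be repeated. -/
structure MDigraph (V : Type*) (m : ℕ) where
  verts : Finset V
  edges : Finset (Fin m → V)
  edge_mem : ∀ e ∈ edges, ∀ i, e i ∈ verts

namespace MDigraph

variable {V : Type*} {m : ℕ}

open Classical in
/-- The multiplicity of `v` in the tuple `e`. -/
def multi {W : Type*} (v : W) (e : Fin m → W) : ℕ :=
  (Finset.univ.filter (fun i => e i = v)).card

open Classical in
/-- The induced `m`-digraph `H[S]`: it keeps the edges of `H` with all entries in `S`. -/
def induce (H : MDigraph V m) (S : Finset V) : MDigraph V m where
  verts := H.verts ∩ S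
  edges := H.edges.filter (fun e => ∀ i, e i ∈ S)
  edge_mem := fun e he i => by
    rw [Finset.mem_filter] at he
    exact Finset.mem_inter.2 ⟨H.edge_mem e he.1 i, he.2 i⟩

open Classical in
/-- `H - A`, the `m`-digraph obtained by deleting the vertices of `A`. -/
def deleteVerts (H : MDigraph V m) (A : Finset V) : MDigraph V m :=
  H.induce (H.verts \ A)

/-- `H` has a perfect matching: a set of one-to-one edges such that no vertex is covered twice and
every vertex is covered. -/
def HasPerfectMatching (H : MDigraph V m) : Prop :=
  ∃ M : Finset (Fin m → V), M ⊆ H.edges ∧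
    (∀ e ∈ M, Function.Injective e) ∧
    (∀ e ∈ M, ∀ f ∈ M, e ≠ f → ∀ i j, e i ≠ f j) ∧
    ∀ v ∈ H.verts, ∃ e ∈ M, ∃ i, e i = v

/-- The tuple `B` of vertex sets is suitable: it is formed from a family `F` of pairwise disjoint
sets of vertices of total size `m`, each set of `F` occurs in `B` as often as it has elements, and
`H` has every edge that takes its `i`-th entry from `B i` and is constant on equal sets. -/
def Suitable (H : MDigraph V m) (B : Fin m → Finset V) : Prop :=
  ∃ F : Finset (Finset V),
    (∀ C ∈ F, C ⊆ H.verts) ∧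
    (∀ C ∈ F, ∀ D ∈ F, C ≠ D → Disjoint C D) ∧
    ∑ C ∈ F, C.card = m ∧
    (∀ i, B i ∈ F) ∧
    (∀ C ∈ F, C.card = multi C B) ∧
    ∀ e : Fin m → V, (∀ i, e i ∈ B i) → (∀ i j, B i = B j → e i = e j) → e ∈ H.edges

/-- `H` is fissile: for every suitable tuple `B` there is a one-to-one edge of `H` whose vertices
cover the sets of `B`. -/
def Fissile (H : MDigraph V m) : Prop :=
  ∀ B : Fin m → Finset V, H.Suitable B →
    ∃ e ∈ H.edges, Function.Injective e ∧ ∀ i, ∀ v ∈ B i, ∃ j, e j = v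

/-- `w`, of which only the values on the edges matter, is a fractional matching of `H`. -/
def IsFractionalMatching (H : MDigraph V m) (w : (Fin m → V) → ℝ) : Prop :=
  (∀ e ∈ H.edges, 0 ≤ w e ∧ w e ≤ 1) ∧
    ∀ v ∈ H.verts, ∑ e ∈ H.edges, w e * (multi v e : ℝ) ≤ 1

/-- The `m`-digraphs with a `ρ`-perfect fractional matching. -/
def Spa (ρ : ℝ) : Set (MDigraph V m) :=
  {H | ∃ w : (Fin m → V) → ℝ, H.IsFractionalMatching w ∧
    (1 - ρ) * (H.verts.card : ℝ) / (m : ℝ) ≤ ∑ e ∈ H.edges, w e}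

/-- The lattice of `H`, generated by the indicator vectors of its edges. -/
def lattice (H : MDigraph V m) : AddSubgroup (V → ℤ) :=
  AddSubgroup.closure {x | ∃ e ∈ H.edges, x = fun v => (multi v e : ℤ)}

open Classical in
/-- The `m`-digraphs with complete lattice: the lattice contains all transferrals. -/
def Div : Set (MDigraph V m) :=
  {H | ∀ u ∈ H.verts, ∀ v ∈ H.verts, (Pi.single v 1 - Pi.single u 1 : V → ℤ) ∈ H.lattice}

/-- The `m`-digraphs in which every vertex has multiplicity one in some edge. -/
def Cov : Set (MDigraph V m) :=
  {H | ∀ v ∈ H.verts, ∃ e ∈ H.edges, multi v e = 1}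

open Classical in
/-- The property graph of `H`: the `s`-graph on the vertices of `H` whose edges are the `s`-sets `S`
such that `H[S]` is in the family `Q`. -/
def propertyGraph (H : MDigraph V m) (Q : Set (MDigraph V m)) (s : ℕ) :
    UniformHypergraph V s where
  verts := H.verts
  edges := (H.verts.powersetCard s).filter (fun S => H.induce S ∈ Q)
  edge_subset := fun S hS => by
    rw [Finset.mem_filter, Finset.mem_powersetCard] at hS
    exact hS.1.1
  edge_card := fun S hS => by
    rw [Finset.mem_filter, Finset.mem_powersetCard] at hS
    exact hS.1.2

end MDigraph

end

/-! ### Perfect matching thresholds and the space barrier. -/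

section Thresholds

open Finset

/-! The method is absorption: set aside a small vertex set that can swallow any much smaller
remainder, find an almost perfect matching outside it, and let it swallow what is left. Two facts
drive both halves. Supersaturation (`card_blowups_ge`): a positive density of tuples forces a
positive density of complete blow-ups. Fissility (`Fissile.exists_edge`, `Fissile.tiles_of_list`):
in a blow-up, an edge with repeated entries can be traded for a one-to-one edge that takes from each
cell a prescribed set, as large as the multiplicity. In this way edges with repetitions, which carry
fractional matchings and lattices, become genuine matchings.

Absorbers. Because the matching threshold is at least 1/2 (`half_le_matchingThreshold`), any two
vertices have many common links, that is, (r-1)-tuples that together with either vertex induce a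
digraph in Div and Cov. For m given vertices choose a link of each, and a common link for each pair
of the chosen link vertices. All transferrals on this bounded system lie in its edge lattice, so
there are two lists of edges with equal loads on the system, one avoiding the m vertices and one
covering each of them once (`Absorbable.exists_lists`). In a blow-up of the system both lists become
matchings (`tiles_of_blowup`); this is an absorber. Absorbers have positive density, and a greedy
choice guided by an exponential potential (`exists_disjoint_family`) gives a disjoint family with
linearly many absorbers for every m-tuple (`exists_absorbing_set`).

Almost perfect matchings. Weak regularity and linear programming duality
(`exists_weighting_and_matching`) give a matching `M` together with an integer weighting of total at
most `L |M| + 4n` in which all but few one-to-one edges weigh at least `L - 1`. By supersaturation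
and fissility, few s-sets contain any light edge, repeated entries included
(`card_light_patterns_le`). After deleting a few vertices, the property graph of Spa stays above the
threshold even without the s-sets that contain light edges. So these sets tile what is left, and by
weak duality each of them is heavy (`le_total_weight`). Comparing the two bounds on the total weight
shows that `M` is large (`exists_almost_perfect`). The deletion of vertices that depend on the
weighting is why the space condition is needed for all small sets `A`.

Quantifiers. The number ρ is at most half the absorbing capacity, which does not depend on s. In (i)
the degrees in `H - A` are compared with a binomial coefficient in n although fewer vertices remain;
this bounds s (`exists_uniformity_bound`), so finitely many instances of (ii) suffice. -/

theorem Nat.descFactorial_mul_pow_le {a b : ℕ} (h : a ≤ b) (j : ℕ) :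
    a.descFactorial j * b ^ j ≤ b.descFactorial j * a ^ j := by
  induction j with
  | zero => simp
  | succ j ih =>
    rw [Nat.descFactorial_succ, Nat.descFactorial_succ, pow_succ, pow_succ]
    have h1 : (a - j) * b ≤ (b - j) * a := by
      rcases le_total a j with haj | haj
      · simp [Nat.sub_eq_zero_of_le haj]
      · obtain ⟨c, rfl⟩ := Nat.exists_eq_add_of_le haj
        obtain ⟨d, rfl⟩ := Nat.exists_eq_add_of_le h
        have : j + c + d - j = c + d := by omega
        rw [this, Nat.add_sub_cancel_left]
        nlinarith
    calc (a - j) * a.descFactorial j * (b ^ j * b)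
        = ((a - j) * b) * (a.descFactorial j * b ^ j) := by ring
      _ ≤ ((b - j) * a) * (b.descFactorial j * a ^ j) := Nat.mul_le_mul h1 ih
      _ = _ := by ring

/-- Each factor satisfies (a-i)/(b-i) ≤ a/b, so the ratio of the binomial coefficients is at most
(a/b)^j. This evaluates the degree of the space barrier and later bounds the uniformity s. -/
theorem Nat.choose_mul_pow_le {a b : ℕ} (h : a ≤ b) (j : ℕ) :
    a.choose j * b ^ j ≤ b.choose j * a ^ j := by
  have h1 := Nat.descFactorial_mul_pow_le h j
  rw [Nat.descFactorial_eq_factorial_mul_choose, Nat.descFactorial_eq_factorial_mul_choose,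
    mul_assoc, mul_assoc] at h1
  exact Nat.le_of_mul_le_mul_left h1 (Nat.factorial_pos j)

theorem Finset.card_powersetCard_filter_mem {V : Type*} {Y : Finset V} {v : V}
    [DecidablePred fun S : Finset V => v ∈ S] (hv : v ∈ Y) {s : ℕ} (hs : 0 < s) :
    ((Y.powersetCard s).filter fun S => v ∈ S).card = (Y.card - 1).choose (s - 1) := by
  classical
  rw [← card_erase_of_mem hv, ← card_powersetCard]
  refine card_bij' (fun S _ => S.erase v) (fun S _ => insert v S) ?_ ?_ ?_ ?_
  · intro S hS
    rw [mem_filter, mem_powersetCard] at hS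
    rw [mem_powersetCard, card_erase_of_mem hS.2, hS.1.2]
    exact ⟨erase_subset_erase _ hS.1.1, rfl⟩
  · intro S hS
    rw [mem_powersetCard] at hS
    have hvS : v ∉ S := fun h => (notMem_erase v Y) (hS.1 h)
    rw [mem_filter, mem_powersetCard, card_insert_of_notMem hvS, hS.2]
    refine ⟨⟨insert_subset hv (hS.1.trans (erase_subset _ _)), by omega⟩, mem_insert_self _ _⟩
  · intro S hS
    exact insert_erase (mem_filter.1 hS).2
  · intro S hS
    rw [mem_powersetCard] at hS
    exact erase_insert fun h => (notMem_erase v Y) (hS.1 h)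

namespace UniformHypergraph

variable {V : Type*} {s : ℕ}

theorem degree_singleton (P : UniformHypergraph V s) (v : V)
    [DecidablePred fun S : Finset V => v ∈ S] :
    P.degree {v} = (P.edges.filter fun S => v ∈ S).card := by
  unfold degree
  congr 1
  ext S
  simp

theorem degree_le (P : UniformHypergraph V s) {v : V} (hv : v ∈ P.verts) (hs : 0 < s) :
    P.degree {v} ≤ (P.verts.card - 1).choose (s - 1) := by
  classical
  rw [← card_powersetCard_filter_mem hv hs]
  refine card_le_card fun S hS => ?_
  rw [mem_filter] at hS ⊢
  exact ⟨mem_powersetCard.2 ⟨P.edge_subset S hS.1, P.edge_card S hS.1⟩,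
    singleton_subset_iff.1 hS.2⟩

theorem minDegree_le (P : UniformHypergraph V s) {v : V} (hv : v ∈ P.verts) :
    P.minDegree 1 ≤ P.degree {v} := by
  refine csSup_le ⟨0, fun _ _ _ => Nat.zero_le _⟩ fun l hl => ?_
  exact hl {v} (singleton_subset_iff.2 hv) (card_singleton v)

theorem le_minDegree (P : UniformHypergraph V s) (hne : P.verts.Nonempty) {l : ℕ}
    (h : ∀ v ∈ P.verts, l ≤ P.degree {v}) : l ≤ P.minDegree 1 := by
  obtain ⟨v, hv⟩ := hne
  refine le_csSup ⟨P.degree {v}, fun l hl => hl {v} (singleton_subset_iff.2 hv)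
    (card_singleton v)⟩ fun D hD hD1 => ?_
  obtain ⟨w, rfl⟩ := card_eq_one.1 hD1
  exact h w (singleton_subset_iff.1 hD)

theorem le_minDegree_real (P : UniformHypergraph V s) (hne : P.verts.Nonempty) {c : ℝ}
    (h : ∀ v ∈ P.verts, c ≤ (P.degree {v} : ℝ)) : c ≤ (P.minDegree 1 : ℝ) :=
  Nat.ceil_le.1 (P.le_minDegree hne fun v hv => Nat.ceil_le.2 (h v hv))

open Classical in
/-- The pull-back of a hypergraph along an injection onto its vertices. -/
noncomputable def comap {W : Type*} (P : UniformHypergraph V s) [Fintype W] (f : W ↪ V)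
    (_hf : ∀ w, f w ∈ P.verts) : UniformHypergraph W s where
  verts := univ
  edges := univ.filter fun S => S.map f ∈ P.edges
  edge_subset := fun _ _ => subset_univ _
  edge_card := fun S hS => by rw [← P.edge_card _ (mem_filter.1 hS).2, card_map]

end UniformHypergraph

open UniformHypergraph

/-- No degree exceeds the full binomial coefficient, so the condition for δ = 1 is vacuous; the
infimum that defines the threshold is therefore over a nonempty set. -/
theorem one_mem_threshold_set {s : ℕ} (hs : 0 < s) :
    (1 : ℝ) ∈ {δ : ℝ | 0 ≤ δ ∧ δ ≤ 1 ∧ ∀ μ : ℝ, 0 < μ → ∃ n₀ : ℕ, ∀ n : ℕ, n₀ ≤ n → s ∣ n →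
      ∀ (V : Type) (P : UniformHypergraph V s), P.verts.card = n →
      (δ + μ) * ((n - 1).choose (s - 1) : ℝ) ≤ (P.minDegree 1 : ℝ) → P.HasPerfectMatching} := by
  refine ⟨zero_le_one, le_rfl, fun μ hμ => ⟨1, fun n hn hsn V P hP hdeg => ?_⟩⟩
  exfalso
  obtain ⟨v, hv⟩ : P.verts.Nonempty := card_pos.1 (by omega)
  have h1 : (P.minDegree 1 : ℝ) ≤ ((n - 1).choose (s - 1) : ℝ) := by
    rw [← hP]; exact_mod_cast (P.minDegree_le hv).trans (P.degree_le hv hs)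
  have h2 : (0 : ℝ) < ((n - 1).choose (s - 1) : ℝ) := by
    have := Nat.le_of_dvd (by omega) hsn
    exact_mod_cast Nat.choose_pos (by omega)
  nlinarith

/-- The defining property of the matching threshold, for hypergraphs in any universe. -/
theorem hasPerfectMatching_of_degree {s : ℕ} (hs : 0 < s) {μ : ℝ} (hμ : 0 < μ) :
    ∃ n₀ : ℕ, ∀ (V : Type*) (P : UniformHypergraph V s), n₀ ≤ P.verts.card → s ∣ P.verts.card →
      (∀ v ∈ P.verts, (matchingThreshold s + μ) * ((P.verts.card - 1).choose (s - 1) : ℝ) ≤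
        (P.degree {v} : ℝ)) → P.HasPerfectMatching := by
  classical
  -- The infimum need not be attained. Half of μ is spent on an admissible δ near it, the other half
  -- is the slack for that δ.
  obtain ⟨δ, ⟨hδ0, hδ1, hδ⟩, hδlt⟩ := exists_lt_of_csInf_lt ⟨1, one_mem_threshold_set hs⟩
    (show matchingThreshold s < matchingThreshold s + μ / 2 by linarith)
  obtain ⟨n₀, hn₀⟩ := hδ (μ / 2) (by linarith)
  refine ⟨n₀ + 1, fun V P hn hsn hdeg => ?_⟩
  set n := P.verts.card with hnP
  set e : P.verts ≃ Fin n := P.verts.equivFin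
  -- The threshold only speaks of hypergraphs in `Type`, so `P` is copied onto `Fin n` and the
  -- matching is carried back.
  set f : Fin n ↪ V := e.symm.toEmbedding.trans (Function.Embedding.subtype _) with hf
  have hfv : ∀ i, f i ∈ P.verts := fun i => (e.symm i).2
  have hfs : ∀ v ∈ P.verts, ∃ i, f i = v := fun v hv => ⟨e ⟨v, hv⟩, by simp [hf]⟩
  have hfS : ∀ S ⊆ P.verts, ∃ T : Finset (Fin n), T.map f = S := by
    intro S hS
    refine ⟨univ.filter fun i => f i ∈ S, ?_⟩
    ext v
    simp only [mem_map, mem_filter, mem_univ, true_and]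
    constructor
    · rintro ⟨i, hi, rfl⟩; exact hi
    · intro hv
      obtain ⟨i, rfl⟩ := hfs v (hS hv)
      exact ⟨i, hv, rfl⟩
  have hne : (P.comap f hfv).verts.Nonempty := by
    refine card_pos.1 ?_
    simp only [comap, card_univ, Fintype.card_fin]; omega
  have hPM := hn₀ n (by omega) hsn (Fin n) (P.comap f hfv) (by simp [comap]) (by
    refine le_minDegree_real _ hne fun i _ => ?_
    have h1 : P.degree {f i} ≤ (P.comap f hfv).degree {i} := by
      rw [degree_singleton, degree_singleton]
      refine card_le_card_of_surjOn (fun T => T.map f) ?_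
      intro S hS
      rw [mem_coe, mem_filter] at hS
      obtain ⟨T, rfl⟩ := hfS S (P.edge_subset _ hS.1)
      refine ⟨T, ?_, rfl⟩
      rw [mem_coe, mem_filter]
      refine ⟨mem_filter.2 ⟨mem_univ _, hS.1⟩, ?_⟩
      exact (mem_map' f).1 hS.2
    have h2 := hdeg (f i) (hfv i)
    have h3 : (P.degree {f i} : ℝ) ≤ (P.comap f hfv).degree {i} := by exact_mod_cast h1
    refine le_trans ?_ (h2.trans h3)
    exact mul_le_mul_of_nonneg_right (by linarith) (Nat.cast_nonneg _))
  obtain ⟨M, hME, hMd, hMc⟩ := hPM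
  refine ⟨M.image fun T => T.map f, ?_, ?_, ?_⟩
  · intro S hS
    obtain ⟨T, hT, rfl⟩ := mem_image.1 hS
    exact (mem_filter.1 (hME hT)).2
  · intro S hS S' hS' hne'
    obtain ⟨T, hT, rfl⟩ := mem_image.1 hS
    obtain ⟨T', hT', rfl⟩ := mem_image.1 hS'
    exact (disjoint_map f).2 (hMd T hT T' hT' fun h => hne' (by rw [h]))
  · intro v hv
    obtain ⟨i, rfl⟩ := hfs v hv
    obtain ⟨T, hT, hiT⟩ := hMc i (mem_univ _)
    exact ⟨T.map f, mem_image_of_mem _ hT, mem_map_of_mem f hiT⟩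

open Classical in
/-- The space barrier: all `s`-sets that meet a given set of vertices. -/
def spaceBarrier (n s : ℕ) (X : Finset (Fin n)) : UniformHypergraph (Fin n) s where
  verts := univ
  edges := (univ.powersetCard s).filter fun S => ¬ Disjoint S X
  edge_subset := fun _ _ => subset_univ _
  edge_card := fun _ hS => (mem_powersetCard.1 (mem_filter.1 hS).1).2

/-- Disjoint edges meet `X` in different vertices, so a matching has at most |X| edges and covers at
most s|X| < n vertices. -/
theorem spaceBarrier_not_hasPerfectMatching {n s : ℕ} (X : Finset (Fin n))
    (hX : X.card * s < n) : ¬ (spaceBarrier n s X).HasPerfectMatching := by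
  classical
  rintro ⟨M, hME, hMd, hMc⟩
  have h1 : M.card ≤ X.card := by
    have h2 : ∀ S : Finset (Fin n), ∃ x, S ∈ M → x ∈ S ∧ x ∈ X := by
      intro S
      by_cases hS : S ∈ M
      · obtain ⟨x, hx, hxX⟩ := not_disjoint_iff.1 (mem_filter.1 (hME hS)).2
        exact ⟨x, fun _ => ⟨hx, hxX⟩⟩
      · obtain ⟨x⟩ : Nonempty (Fin n) := ⟨⟨0, by omega⟩⟩
        exact ⟨x, fun h => absurd h hS⟩
    choose g hg using h2
    refine card_le_card_of_injOn g (fun _ hS => (hg _ (mem_coe.1 hS)).2) ?_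
    intro S hS T hT hST
    by_contra hne
    have h3 := hMd S hS T hT hne
    exact disjoint_left.1 h3 (hg S hS).1 (hST ▸ (hg T hT).1)
  have h2 : n ≤ M.card * s := by
    have h3 : (univ : Finset (Fin n)) ⊆ M.biUnion id := by
      intro v _
      obtain ⟨S, hS, hvS⟩ := hMc v (mem_univ _)
      exact mem_biUnion.2 ⟨S, hS, hvS⟩
    have h4 := card_le_card h3
    rw [card_univ, Fintype.card_fin] at h4
    refine h4.trans (card_biUnion_le_card_mul _ _ _ fun S hS => ?_)
    exact ((spaceBarrier n s X).edge_card S (hME hS)).le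
  have := Nat.mul_le_mul_right s h1
  omega

theorem spaceBarrier_degree {n s : ℕ} (hs : 0 < s) (X : Finset (Fin n)) (v : Fin n) :
    (n - 1).choose (s - 1) ≤
      (spaceBarrier n s X).degree {v} + (n - X.card - 1).choose (s - 1) := by
  classical
  have h1 := card_powersetCard_filter_mem (mem_univ v) hs
  rw [card_univ, Fintype.card_fin] at h1
  rw [← h1, degree_singleton]
  have h2 : ((univ.powersetCard s).filter fun S => v ∈ S) ⊆
      ((spaceBarrier n s X).edges.filter fun S => v ∈ S) ∪
        (((univ \ X).powersetCard s).filter fun S => v ∈ S) := by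
    intro S hS
    rw [mem_filter] at hS
    rw [mem_union, mem_filter, mem_filter, mem_powersetCard]
    by_cases h : Disjoint S X
    · exact Or.inr ⟨⟨fun x hx => mem_sdiff.2 ⟨mem_univ _, disjoint_left.1 h hx⟩,
        (mem_powersetCard.1 hS.1).2⟩, hS.2⟩
    · exact Or.inl ⟨mem_filter.2 ⟨hS.1, h⟩, hS.2⟩
  refine (card_le_card h2).trans ((card_union_le _ _).trans ?_)
  refine Nat.add_le_add_left ?_ _
  by_cases hv : v ∈ X
  · refine le_trans (le_of_eq (card_eq_zero.2 (eq_empty_of_forall_notMem fun S hS => ?_)))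
      (Nat.zero_le _)
    rw [mem_filter, mem_powersetCard] at hS
    exact (mem_sdiff.1 (hS.1.1 hS.2)).2 hv
  · rw [card_powersetCard_filter_mem (mem_sdiff.2 ⟨mem_univ _, hv⟩) hs,
      card_sdiff_of_subset (subset_univ _), card_univ, Fintype.card_fin]

/-- In the space barrier with n = sk and |X| = k - 1, a vertex misses at most a proportion tending
to (1 - 1/s)^(s-1) ≤ 1/2 of the possible edges. The bound 1/2 is exactly what makes any two link
families intersect in the absorbing part. -/
theorem half_le_matchingThreshold {s : ℕ} (hs : 2 ≤ s) : 1 / 2 ≤ matchingThreshold s := by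
  refine le_csInf ⟨1, one_mem_threshold_set (by omega)⟩ ?_
  rintro δ ⟨hδ0, hδ1, hδ⟩
  by_contra hlt
  have hlt := not_le.1 hlt
  set μ := (1 / 2 - δ) / 2 with hμ
  have hμ0 : 0 < μ := by rw [hμ]; linarith
  obtain ⟨n₀, hn₀⟩ := hδ μ hμ0
  have hlim : Filter.Tendsto (fun k : ℕ => (1 + 1 / ((s : ℝ) * k - 1)) ^ (s - 1)) Filter.atTop
      (nhds ((1 + 0) ^ (s - 1))) := by
    refine Filter.Tendsto.pow (Filter.Tendsto.const_add _ ?_) _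
    simp only [one_div]
    refine Filter.Tendsto.inv_tendsto_atTop ?_
    refine Filter.tendsto_atTop_add_const_right _ _ ?_
    refine Filter.Tendsto.const_mul_atTop (by positivity) tendsto_natCast_atTop_atTop
  rw [add_zero, one_pow] at hlim
  have hev := (hlim.eventually (gt_mem_nhds (show (1 : ℝ) < 1 + 2 * μ by linarith))).and
    (Filter.eventually_ge_atTop (n₀ + 1))
  obtain ⟨k, hk1, hk2⟩ := hev.exists
  set n := s * k with hn
  have hkn : 2 * k ≤ n := Nat.mul_le_mul_right k hs
  -- The size k - 1 is the largest that still excludes a perfect matching, and it makes n - |X| - 1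
  -- equal to (s-1)k exactly.
  obtain ⟨X, -, hX⟩ := exists_subset_card_eq
    (show k - 1 ≤ (univ : Finset (Fin n)).card by rw [card_univ, Fintype.card_fin]; omega)
  have hXs : X.card * s < n := by
    rw [hX, hn, mul_comm]
    exact Nat.mul_lt_mul_of_pos_left (by omega) (by omega)
  refine spaceBarrier_not_hasPerfectMatching X hXs (hn₀ n (by omega) ⟨k, rfl⟩ _ _ ?_ ?_)
  · simp [spaceBarrier]
  refine le_minDegree_real _ ⟨⟨0, by omega⟩, mem_univ _⟩ fun v _ => ?_
  have h1 := spaceBarrier_degree (s := s) (by omega) X v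
  have h2 := Nat.choose_mul_pow_le (show n - X.card - 1 ≤ n - 1 by omega) (s - 1)
  have h3 : n - X.card - 1 = (s - 1) * k := by
    rw [hX, Nat.sub_mul, ← hn]; omega
  rw [h3] at h1 h2
  have h1' : ((n - 1).choose (s - 1) : ℝ) ≤ (spaceBarrier n s X).degree {v} +
      (((s - 1) * k).choose (s - 1) : ℝ) := by exact_mod_cast h1
  have h2' : (((s - 1) * k).choose (s - 1) : ℝ) * ((n : ℝ) - 1) ^ (s - 1) ≤
      ((n - 1).choose (s - 1) : ℝ) * (((s : ℝ) - 1) * k) ^ (s - 1) := by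
    have h4 : ((n - 1 : ℕ) : ℝ) = (n : ℝ) - 1 := by
      rw [Nat.cast_sub (by omega)]; simp
    have h5 : ((s - 1 : ℕ) : ℝ) = (s : ℝ) - 1 := by
      rw [Nat.cast_sub (by omega)]; simp
    rw [← h4, ← h5]
    exact_mod_cast h2
  have hnR : (n : ℝ) = s * k := by rw [hn]; push_cast; ring
  have hs2 : (2 : ℝ) ≤ s := by exact_mod_cast hs
  have hk0 : (1 : ℝ) ≤ k := by exact_mod_cast (show 1 ≤ k by omega)
  have hn1 : (0 : ℝ) < (n : ℝ) - 1 := by rw [hnR]; nlinarith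
  have hratio : (((s : ℝ) - 1) * k / ((n : ℝ) - 1)) ^ (s - 1) ≤ 1 / 2 + μ := by
    have h4 : ((s : ℝ) - 1) * k / ((n : ℝ) - 1) = (1 + 1 / (s * k - 1)) / (1 + 1 / (s - 1)) := by
      rw [hnR] at hn1 ⊢
      have : (0 : ℝ) < (s : ℝ) - 1 := by linarith
      field_simp
      ring
    rw [h4, div_pow]
    -- Bernoulli's inequality: (1 + 1/(s-1))^(s-1) ≥ 2.
    have h5 : (2 : ℝ) ≤ (1 + 1 / ((s : ℝ) - 1)) ^ (s - 1) := by
      have h6 : (0 : ℝ) < (s : ℝ) - 1 := by linarith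
      have h7 := one_add_mul_le_pow (a := 1 / ((s : ℝ) - 1)) (by
        have : 0 < 1 / ((s : ℝ) - 1) := by positivity
        linarith) (s - 1)
      rw [Nat.cast_sub (by omega), Nat.cast_one, mul_one_div_cancel h6.ne'] at h7
      linarith
    rw [div_le_iff₀ (by linarith)]
    nlinarith
  have h6 : (((s - 1) * k).choose (s - 1) : ℝ) ≤ ((n - 1).choose (s - 1) : ℝ) * (1 / 2 + μ) := by
    rw [div_pow, div_le_iff₀ (by positivity)] at hratio
    have h7 : (0 : ℝ) < ((n : ℝ) - 1) ^ (s - 1) := by positivity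
    refine le_of_mul_le_mul_right (h2'.trans ?_) h7
    rw [mul_assoc]
    exact mul_le_mul_of_nonneg_left hratio (Nat.cast_nonneg _)
  have h8 : δ = 1 / 2 - 2 * μ := by rw [hμ]; ring
  rw [h8]
  linarith

end Thresholds

/-! ### Supersaturation by repeated use of Jensen's inequality. -/

section Supersaturation

open Finset

theorem Fin.sum_fun_succ {k : ℕ} {X M : Type*} [Fintype X] [AddCommMonoid M]
    (g : (Fin (k + 1) → X) → M) :
    ∑ z, g z = ∑ a : X, ∑ z : Fin k → X, g (Fin.cons a z : Fin (k + 1) → X) := by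
  rw [← Fintype.sum_prod_type', ← (Fin.consEquiv (fun _ : Fin (k + 1) => X)).sum_comp]
  rfl

theorem Fin.prod_fun_succ {k : ℕ} {X M : Type*} [Fintype X] [CommMonoid M]
    (g : (Fin (k + 1) → X) → M) :
    ∏ z, g z = ∏ a : X, ∏ z : Fin k → X, g (Fin.cons a z : Fin (k + 1) → X) := by
  rw [← Fintype.prod_prod_type', ← (Fin.consEquiv (fun _ : Fin (k + 1) => X)).prod_comp]
  rfl

/-- Jensen's inequality for powers. -/
theorem card_mul_sum_div_pow_le {X : Type*} [Fintype X] [Nonempty X] (b : ℕ) (hb : b ≠ 0)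
    (f : X → ℝ) (hf : ∀ x, 0 ≤ f x) :
    (Fintype.card X : ℝ) * ((∑ x, f x) / Fintype.card X) ^ b ≤ ∑ x, f x ^ b := by
  obtain ⟨b, rfl⟩ := Nat.exists_eq_succ_of_ne_zero hb
  have h := pow_sum_div_card_le_sum_pow (s := univ) (f := f) (fun i _ => hf i) b
  have hc : (0 : ℝ) < Fintype.card X := by exact_mod_cast Fintype.card_pos
  refine le_trans (le_of_eq ?_) h
  rw [Finset.card_univ, div_pow, pow_succ (Fintype.card X : ℝ)]
  field_simp

/-- A function on `k`-tuples has, in the mean, many complete `k`-partite blow-ups. -/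
theorem sum_prod_transversal_ge {X : Type*} [Fintype X] [Nonempty X] (b : ℕ) (hb : b ≠ 0)
    (k : ℕ) (f : (Fin k → X) → ℝ) (hf : ∀ z, 0 ≤ f z) :
    (Fintype.card X : ℝ) ^ (b * k) * ((∑ z, f z) / (Fintype.card X : ℝ) ^ k) ^ (b ^ k) ≤
      ∑ x : Fin k → Fin b → X, ∏ σ : Fin k → Fin b, f (fun i => x i (σ i)) := by
  induction k with
  | zero =>
    simp only [Nat.mul_zero, pow_zero, div_one, pow_one, one_mul]
    rw [Fintype.sum_unique, Fintype.sum_unique, Fintype.prod_unique]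
    exact le_of_eq (congrArg f (Subsingleton.elim _ _))
  | succ k ih =>
    set n : ℝ := (Fintype.card X : ℝ) with hn
    have hn0 : 0 < n := by rw [hn]; exact_mod_cast Fintype.card_pos
    -- With the `b` copies `x0` of the first coordinate fixed, what remains is a blow-up count in k
    -- coordinates for the product of `f` over these copies, to which the induction hypothesis
    -- applies.
    have key : ∀ x0 : Fin b → X, ∀ x' : Fin k → Fin b → X,
        ∏ σ : Fin (k + 1) → Fin b,
          f (fun i => (Fin.cons x0 x' : Fin (k + 1) → Fin b → X) i (σ i)) =
        ∏ σ : Fin k → Fin b, (fun z : Fin k → X => ∏ j, f (Fin.cons (x0 j) z : Fin (k + 1) → X))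
          (fun i => x' i (σ i)) := by
      intro x0 x'
      rw [Fin.prod_fun_succ, prod_comm]
      refine prod_congr rfl fun σ _ => prod_congr rfl fun j _ => congrArg f ?_
      funext i
      refine Fin.cases ?_ (fun i => ?_) i <;> simp
    rw [Fin.sum_fun_succ (fun x : Fin (k + 1) → Fin b → X => ∏ σ : Fin (k + 1) → Fin b, _),
      sum_congr rfl fun x0 _ => sum_congr rfl fun x' _ => key x0 x']
    have h1 : ∀ x0 : Fin b → X, _ := fun x0 =>
      ih (fun z : Fin k → X => ∏ j, f (Fin.cons (x0 j) z : Fin (k + 1) → X))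
        (fun z => prod_nonneg fun j _ => hf _)
    refine le_trans ?_ (sum_le_sum fun x0 _ => h1 x0)
    rw [← mul_sum]
    -- Jensen is used twice: here with exponent `b ^ k` over the choices of `x0`, and in `h4` with
    -- exponent `b` over the remaining coordinates, where the power of a row sum expands into the
    -- sum over `x0`.
    have h2 := card_mul_sum_div_pow_le (X := Fin b → X) (b ^ k) (pow_ne_zero _ hb)
      (fun x0 => (∑ z : Fin k → X, ∏ j, f (Fin.cons (x0 j) z : Fin (k + 1) → X)) / n ^ k)
      (fun x0 => div_nonneg (sum_nonneg fun z _ => prod_nonneg fun j _ => hf _) (by positivity))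
    refine le_trans ?_ (mul_le_mul_of_nonneg_left h2 (by positivity))
    have h3 : ∑ x0 : Fin b → X, (∑ z : Fin k → X, ∏ j, f (Fin.cons (x0 j) z : Fin (k + 1) → X))
        / n ^ k = (∑ z : Fin k → X, (∑ a, f (Fin.cons a z : Fin (k + 1) → X)) ^ b) / n ^ k := by
      rw [← sum_div, sum_comm]
      congr 1
      refine sum_congr rfl fun z _ => ?_
      rw [Fintype.sum_pow]
    have h4 := card_mul_sum_div_pow_le (X := Fin k → X) b hb
      (fun z => ∑ a, f (Fin.cons a z : Fin (k + 1) → X)) (fun z => sum_nonneg fun a _ => hf _)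
    have h5 : ∑ z : Fin k → X, ∑ a, f (Fin.cons a z : Fin (k + 1) → X) = ∑ z, f z := by
      rw [Fin.sum_fun_succ, sum_comm]
    rw [h3]
    rw [h5] at h4
    simp only [Fintype.card_fun, Fintype.card_fin, Nat.cast_pow, ← hn] at h4 ⊢
    have h6 : (0 : ℝ) ≤ ∑ z, f z := sum_nonneg fun z _ => hf z
    calc n ^ (b * (k + 1)) * ((∑ z, f z) / n ^ (k + 1)) ^ b ^ (k + 1)
        = n ^ (b * k) * (n ^ b * ((n ^ k * ((∑ z, f z) / n ^ k) ^ b) / n ^ k / n ^ b) ^ b ^ k) := by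
          have : (n ^ k * ((∑ z, f z) / n ^ k) ^ b) / n ^ k / n ^ b
              = ((∑ z, f z) / n ^ (k + 1)) ^ b := by
            rw [pow_succ, div_pow, div_pow, mul_pow]; field_simp
          rw [this, ← pow_mul, ← mul_assoc, ← pow_add, pow_succ b k, mul_comm (b ^ k) b]
          ring_nf
      _ ≤ _ := by gcongr

open Classical in
/-- Supersaturation: a dense set of tuples contains a positive proportion of all blow-ups. -/
theorem card_blowups_ge {X ι : Type*} [Fintype X] [Nonempty X] [Fintype ι]
    [DecidableEq ι] (b : ℕ) (hb : b ≠ 0) (G : Finset (ι → X)) (γ : ℝ) (hγ : 0 ≤ γ)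
    (hG : γ * (Fintype.card X : ℝ) ^ Fintype.card ι ≤ G.card) :
    γ ^ (b ^ Fintype.card ι) * (Fintype.card X : ℝ) ^ (Fintype.card ι * b) ≤
      ((univ.filter fun x : ι → Fin b → X =>
        ∀ σ : ι → Fin b, (fun i => x i (σ i)) ∈ G).card : ℝ) := by
  set k := Fintype.card ι
  set e : ι ≃ Fin k := Fintype.equivFin ι
  have hn0 : (0 : ℝ) < Fintype.card X := by exact_mod_cast Fintype.card_pos
  have h := sum_prod_transversal_ge (X := X) b hb k
    (fun z => if (fun i => z (e i)) ∈ G then 1 else 0) (fun z => by split_ifs <;> norm_num)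
  have h1 : ∑ z : Fin k → X, (if (fun i => z (e i)) ∈ G then (1 : ℝ) else 0) = G.card := by
    refine ((Equiv.arrowCongr e.symm (Equiv.refl X)).sum_comp
      (fun z : ι → X => if z ∈ G then (1 : ℝ) else 0)).trans ?_
    simp
  have h2 : ∑ x : Fin k → Fin b → X, ∏ σ : Fin k → Fin b,
      (if (fun i => x (e i) (σ (e i))) ∈ G then (1 : ℝ) else 0) =
      ((univ.filter fun x : ι → Fin b → X =>
        ∀ σ : ι → Fin b, (fun i => x i (σ i)) ∈ G).card : ℝ) := by
    have h3 : ∀ x : Fin k → Fin b → X, ∏ σ : Fin k → Fin b,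
        (if (fun i => x (e i) (σ (e i))) ∈ G then (1 : ℝ) else 0) =
        if ∀ σ : ι → Fin b, (fun i => x (e i) (σ i)) ∈ G then 1 else 0 := by
      intro x
      rw [prod_ite_zero]
      simp only [prod_const_one, mem_univ, true_imp_iff]
      refine if_congr ⟨fun h σ => ?_, fun h σ => h _⟩ rfl rfl
      simpa using h (fun i => σ (e.symm i))
    rw [sum_congr rfl fun x _ => h3 x]
    refine ((Equiv.arrowCongr e.symm (Equiv.refl (Fin b → X))).sum_comp
      (fun x : ι → Fin b → X =>
        if ∀ σ : ι → Fin b, (fun i => x i (σ i)) ∈ G then (1 : ℝ) else 0)).trans ?_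
    simp
  rw [h1, h2] at h
  refine le_trans ?_ h
  rw [mul_comm, mul_comm k b]
  have : γ ≤ (G.card : ℝ) / (Fintype.card X : ℝ) ^ k := by
    rw [le_div_iff₀ (by positivity)]; exact hG
  gcongr

end Supersaturation

/-! ### Counting functions with prescribed, repeated or forbidden values. -/

section Counting

open Finset

open Classical in
-- The coordinates outside the range of `τ` are free. The identity is multiplied out to avoid
-- subtraction in the exponent.
theorem card_filter_comp_mem {X ι κ : Type*} [Fintype X] [Fintype ι] [Fintype κ]
    [DecidableEq ι] [DecidableEq κ] (τ : κ → ι)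
    (hτ : Function.Injective τ) (B : Finset (κ → X)) :
    (univ.filter fun x : ι → X => x ∘ τ ∈ B).card * Fintype.card X ^ Fintype.card κ =
      B.card * Fintype.card X ^ Fintype.card ι := by
  set p : ι → Prop := fun i => i ∈ Set.range τ
  set e : κ ≃ {i // p i} := Equiv.ofInjective τ hτ
  have h1 : (univ.filter fun x : ι → X => x ∘ τ ∈ B).card =
      (B ×ˢ (univ : Finset ({i // ¬ p i} → X))).card := by
    refine card_bij' (fun x _ => (x ∘ τ, fun i => x i))
      (fun y _ => (Equiv.piEquivPiSubtypeProd p (fun _ => X)).symm (y.1 ∘ e.symm, y.2)) ?_ ?_ ?_ ?_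
    · intro x hx; simpa using hx
    · intro y hy
      have : ((Equiv.piEquivPiSubtypeProd p (fun _ => X)).symm (y.1 ∘ e.symm, y.2)) ∘ τ = y.1 := by
        funext k
        have hp : p (τ k) := ⟨k, rfl⟩
        have : (⟨τ k, hp⟩ : {i // p i}) = e k := rfl
        simp [Equiv.piEquivPiSubtypeProd, hp, this]
      simp only [mem_product, mem_univ, and_true] at hy
      simpa only [mem_filter, mem_univ, true_and, this] using hy
    · intro x hx
      funext i
      by_cases hp : p i
      · obtain ⟨k, rfl⟩ := hp
        have hp : p (τ k) := ⟨k, rfl⟩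
        have : (⟨τ k, hp⟩ : {i // p i}) = e k := rfl
        simp [Equiv.piEquivPiSubtypeProd, hp, this]
      · simp [Equiv.piEquivPiSubtypeProd, hp]
    · intro y hy
      refine Prod.ext ?_ ?_
      · funext k
        have hp : p (τ k) := ⟨k, rfl⟩
        have : (⟨τ k, hp⟩ : {i // p i}) = e k := rfl
        simp [Equiv.piEquivPiSubtypeProd, hp, this]
      · funext i
        simp [Equiv.piEquivPiSubtypeProd, i.2]
  have h2 : Fintype.card ι = Fintype.card κ + Fintype.card {i // ¬ p i} := by
    have h3 := Fintype.card_subtype_compl p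
    have h4 := Fintype.card_subtype_le p
    rw [Fintype.card_congr e]
    omega
  rw [h1, card_product, card_univ, Fintype.card_fun, h2, pow_add]
  ring

open Classical in
theorem card_filter_eq_mul {X ι : Type*} [Fintype X] [Nonempty X] [Fintype ι]
    [DecidableEq ι] {i j : ι}
    (hij : i ≠ j) :
    (univ.filter fun x : ι → X => x i = x j).card * Fintype.card X =
      Fintype.card X ^ Fintype.card ι := by
  have hn : 0 < Fintype.card X := Fintype.card_pos
  have h := card_filter_comp_mem (X := X) (ι := ι) (κ := Bool) (fun c => if c then i else j)
    (by intro a b; cases a <;> cases b <;> simp [hij, hij.symm])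
    (univ.image fun v : X => fun _ : Bool => v)
  rw [card_image_of_injective _ (fun a b h => congrFun h true)] at h
  have h1 : (univ.filter fun x : ι → X => x i = x j) =
      univ.filter fun x : ι → X => (x ∘ fun c : Bool => if c then i else j) ∈
        (univ.image fun v : X => fun _ : Bool => v) := by
    refine filter_congr fun x _ => ?_
    simp only [mem_image, mem_univ, true_and]
    constructor
    · intro h
      exact ⟨x i, by funext c; cases c <;> simp [h]⟩
    · rintro ⟨v, hv⟩
      have h1 := congrFun hv true
      have h2 := congrFun hv false
      simp at h1 h2
      rw [← h1, ← h2]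
  rw [← h1, card_univ, Fintype.card_bool, pow_two, ← mul_assoc, mul_comm (Fintype.card X)] at h
  exact Nat.eq_of_mul_eq_mul_right hn h

open Classical in
theorem card_not_injective_mul_le {X ι : Type*} [Fintype X] [Nonempty X] [Fintype ι]
    [DecidableEq ι] :
    (univ.filter fun x : ι → X => ¬ Function.Injective x).card * Fintype.card X ≤
      Fintype.card ι ^ 2 * Fintype.card X ^ Fintype.card ι := by
  have h1 : (univ.filter fun x : ι → X => ¬ Function.Injective x) ⊆
      (univ.filter fun p : ι × ι => p.1 ≠ p.2).biUnion
        fun p => univ.filter fun x : ι → X => x p.1 = x p.2 := by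
    intro x hx
    simp only [mem_filter, mem_univ, true_and, Function.Injective, not_forall] at hx
    obtain ⟨i, j, hx, hij⟩ := hx
    simp only [mem_biUnion, mem_filter, mem_univ, true_and]
    exact ⟨(i, j), hij, hx⟩
  refine (Nat.mul_le_mul_right _ ((card_le_card h1).trans card_biUnion_le)).trans ?_
  rw [sum_mul]
  rw [sum_congr rfl fun p hp => card_filter_eq_mul (X := X) (mem_filter.1 hp).2]
  rw [sum_const, smul_eq_mul]
  refine Nat.mul_le_mul_right _ ((card_filter_le _ _).trans ?_)
  simp [sq]

open Classical in
theorem card_filter_apply_mem {X ι : Type*} [Fintype X] [Fintype ι] [DecidableEq ι] (i : ι)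
    (U : Finset X) :
    (univ.filter fun x : ι → X => x i ∈ U).card * Fintype.card X =
      U.card * Fintype.card X ^ Fintype.card ι := by
  have h := card_filter_comp_mem (X := X) (ι := ι) (κ := Unit) (fun _ => i)
    (fun _ _ _ => rfl) (univ.filter fun z : Unit → X => z () ∈ U)
  have h1 : (univ.filter fun z : Unit → X => z () ∈ U).card = U.card := by
    refine card_bij' (fun z _ => z ()) (fun v _ _ => v) ?_ ?_ ?_ ?_ <;> simp
  rw [h1, Fintype.card_unit, pow_one] at h
  convert h using 4
  simp

open Classical in
theorem card_meet_mul_le {X ι : Type*} [Fintype X] [Fintype ι] [DecidableEq ι] (U : Finset X) :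
    (univ.filter fun x : ι → X => ∃ i, x i ∈ U).card * Fintype.card X ≤
      Fintype.card ι * U.card * Fintype.card X ^ Fintype.card ι := by
  have h1 : (univ.filter fun x : ι → X => ∃ i, x i ∈ U) ⊆
      univ.biUnion fun i => univ.filter fun x : ι → X => x i ∈ U := by
    intro x hx
    simpa using hx
  refine (Nat.mul_le_mul_right _ ((card_le_card h1).trans card_biUnion_le)).trans ?_
  rw [sum_mul, sum_congr rfl fun i _ => card_filter_apply_mem (X := X) i U]
  simp [mul_assoc]

end Counting

/-! ### A weak regularity lemma by energy increment. -/

section Regularity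

open Finset

open Classical in
/-- The average of `f` over the fibre of `l` through `y`. -/
noncomputable def fiberAvg {Y L : Type*} [Fintype Y] (l : Y → L) (f : Y → ℝ) (y : Y) : ℝ :=
  (∑ y' with l y' = l y, f y') / ((univ.filter fun y' => l y' = l y).card : ℝ)

theorem fiberAvg_congr {Y L : Type*} [Fintype Y] (l : Y → L) (f : Y → ℝ) {y z : Y}
    (h : l y = l z) : fiberAvg l f y = fiberAvg l f z := by
  unfold fiberAvg
  rw [h]

/-- Averaging over fibres is the orthogonal projection onto the functions that are constant on
fibres. -/
theorem sum_fiberAvg_mul {Y L : Type*} [Fintype Y] (l : Y → L) (f g : Y → ℝ)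
    (hg : ∀ y z, l y = l z → g y = g z) :
    ∑ y, fiberAvg l f y * g y = ∑ y, f y * g y := by
  classical
  have h1 : ∀ y, fiberAvg l f y * g y = ∑ z, if l z = l y then
      f z * g z / ((univ.filter fun y' => l y' = l z).card : ℝ) else 0 := by
    intro y
    rw [fiberAvg, div_mul_eq_mul_div, sum_mul, sum_div, sum_filter]
    refine sum_congr rfl fun z _ => ?_
    split_ifs with h
    · rw [hg z y h]; simp only [h]
    · rfl
  simp_rw [h1]
  rw [sum_comm]
  refine sum_congr rfl fun z _ => ?_
  rw [← sum_filter, sum_const, nsmul_eq_mul]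
  have h2 : (univ.filter fun y => l z = l y) = univ.filter fun y => l y = l z :=
    filter_congr fun y _ => eq_comm
  have h3 : ((univ.filter fun y => l y = l z).card : ℝ) ≠ 0 := by
    exact_mod_cast (card_pos.2 ⟨z, by simp⟩).ne'
  rw [h2]
  field_simp

/-- Pythagoras for two nested projections: refining the partition raises the energy by the squared
distance of the averages. -/
theorem sum_fiberAvg_sq_refine {Y L L' : Type*} [Fintype Y] (l : Y → L) (l' : Y → L') (f : Y → ℝ)
    (h : ∀ y z, l' y = l' z → l y = l z) :
    ∑ y, fiberAvg l' f y ^ 2 =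
      ∑ y, fiberAvg l f y ^ 2 + ∑ y, (fiberAvg l' f y - fiberAvg l f y) ^ 2 := by
  have h1 := sum_fiberAvg_mul l' f (fiberAvg l f) fun y z hyz => fiberAvg_congr l f (h y z hyz)
  have h2 := sum_fiberAvg_mul l f (fiberAvg l f) fun y z hyz => fiberAvg_congr l f hyz
  have h3 : ∑ y, (fiberAvg l' f y - fiberAvg l f y) ^ 2 =
      ∑ y, fiberAvg l' f y ^ 2 - 2 * ∑ y, fiberAvg l' f y * fiberAvg l f y
        + ∑ y, fiberAvg l f y * fiberAvg l f y := by
    rw [mul_sum, ← sum_sub_distrib, ← sum_add_distrib]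
    exact sum_congr rfl fun y _ => by ring
  have h4 : ∑ y, fiberAvg l f y ^ 2 = ∑ y, fiberAvg l f y * fiberAvg l f y :=
    sum_congr rfl fun y _ => by ring
  linarith

theorem fiberAvg_le_one {Y L : Type*} [Fintype Y] (l : Y → L) (f : Y → ℝ) (hf : ∀ y, f y ≤ 1)
    (y : Y) : fiberAvg l f y ≤ 1 := by
  unfold fiberAvg
  refine div_le_one_of_le₀ ?_ (Nat.cast_nonneg _)
  refine (sum_le_sum fun y _ => hf y).trans ?_
  simp

theorem fiberAvg_nonneg {Y L : Type*} [Fintype Y] (l : Y → L) (f : Y → ℝ) (hf : ∀ y, 0 ≤ f y)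
    (y : Y) : 0 ≤ fiberAvg l f y :=
  div_nonneg (sum_nonneg fun y _ => hf y) (Nat.cast_nonneg _)

/-- Large sub-boxes of the box of the tuple `e` with respect to the colouring `c` contain an
element of `E`. -/
def BoxRegular {X K : Type*} {m : ℕ} (E : Finset (Fin m → X)) (ε : ℝ) (c : X → K)
    (I : Fin m → K) : Prop :=
  ∀ A : Fin m → Finset X, (∀ j, ∀ a ∈ A j, c a = I j) →
    (∀ j, ∀ C : Finset X, (∀ a ∈ C, c a = I j) → ε * (C.card : ℝ) ≤ ((A j).card : ℝ)) →
    ∃ f ∈ E, ∀ j, f j ∈ A j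

open Classical in
theorem card_filter_box {X K : Type*} [Fintype X] {m : ℕ} (c : X → K) (I : Fin m → K) :
    (univ.filter fun e : Fin m → X => c ∘ e = I).card =
      ∏ j, (univ.filter fun x => c x = I j).card := by
  rw [← Fintype.card_piFinset]
  congr 1
  ext e
  simp [funext_iff]

open Classical in
-- An irregular box contains a large sub-box without elements of `E`. If the box itself has density
-- at least η/2, separating this sub-box changes the average there from at least η/2 to 0. Boxes of
-- smaller density hold too few elements of `E` to account for all irregular ones.
theorem energy_increment {X K : Type*} [Fintype X] [Fintype K] {m : ℕ} (E : Finset (Fin m → X))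
    (ε η : ℝ) (hε : 0 < ε) (hη : 0 < η) (c : X → K)
    (hbad : η * (Fintype.card X : ℝ) ^ m <
      ((E.filter fun e => ¬ BoxRegular E ε c (c ∘ e)).card : ℝ)) :
    ∃ c' : X → K × ((Fin m → K) × Fin m → Bool),
      ∑ e : Fin m → X, fiberAvg (fun e => c ∘ e) (fun e => if e ∈ E then 1 else 0) e ^ 2 +
          ε ^ m * (η / 2) ^ 3 * (Fintype.card X : ℝ) ^ m ≤
        ∑ e : Fin m → X, fiberAvg (fun e => c' ∘ e) (fun e => if e ∈ E then 1 else 0) e ^ 2 := by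
  set n : ℝ := (Fintype.card X : ℝ) with hn
  set f : (Fin m → X) → ℝ := fun e => if e ∈ E then 1 else 0 with hf
  set d := fiberAvg (fun e : Fin m → X => c ∘ e) f with hd
  have hex : ∀ I : Fin m → K, ∃ A : Fin m → Finset X, ¬ BoxRegular E ε c I →
      (∀ j, ∀ a ∈ A j, c a = I j) ∧
      (∀ j, ε * ((univ.filter fun x => c x = I j).card : ℝ) ≤ ((A j).card : ℝ)) ∧
      ∀ g ∈ E, ¬ ∀ j, g j ∈ A j := by
    intro I
    by_cases h : BoxRegular E ε c I
    · exact ⟨fun _ => ∅, fun h' => absurd h h'⟩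
    · have h' := h
      unfold BoxRegular at h'
      push Not at h'
      obtain ⟨A, h1, h2, h3⟩ := h'
      refine ⟨A, fun _ => ⟨h1, fun j => h2 j _ (by simp), fun g hg hj => ?_⟩⟩
      obtain ⟨j, hj'⟩ := h3 g hg
      exact hj' (hj j)
  choose A hA using hex
  -- The new colour records the old one and membership in every witness `A I j`, so the number of
  -- colours grows by an amount independent of `X`.
  set c' : X → K × ((Fin m → K) × Fin m → Bool) :=
    fun x => (c x, fun p => decide (x ∈ A p.1 p.2)) with hc'
  refine ⟨c', ?_⟩
  set d' := fiberAvg (fun e : Fin m → X => c' ∘ e) f with hd'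
  have href : ∀ y z : Fin m → X, c' ∘ y = c' ∘ z → c ∘ y = c ∘ z := by
    intro y z h
    funext j
    exact congrArg Prod.fst (congrFun h j)
  rw [sum_fiberAvg_sq_refine (fun e : Fin m → X => c ∘ e) (fun e => c' ∘ e) f href]
  refine add_le_add_right ?_ _
  -- the dense irregular tuples
  set D := univ.filter fun e : Fin m → X => ¬ BoxRegular E ε c (c ∘ e) ∧ η / 2 ≤ d e with hD
  set D' := D.filter fun e => ∀ j, e j ∈ A (c ∘ e) j with hD'
  have hcardD : η / 2 * n ^ m ≤ (D.card : ℝ) := by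
    have h1 : E.filter (fun e => ¬ BoxRegular E ε c (c ∘ e)) ⊆
        D ∪ E.filter fun e => d e < η / 2 := by
      intro e he
      rw [mem_filter] at he
      rw [mem_union]
      by_cases h : d e < η / 2
      · exact Or.inr (mem_filter.2 ⟨he.1, h⟩)
      · exact Or.inl (mem_filter.2 ⟨mem_univ _, he.2, not_lt.1 h⟩)
    -- The elements of `E` in boxes of density below η/2 are counted by integrating the density over
    -- these boxes.
    have h2 : ((E.filter fun e => d e < η / 2).card : ℝ) ≤ η / 2 * n ^ m := by
      have h3 := sum_fiberAvg_mul (fun e : Fin m → X => c ∘ e) f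
        (fun e => if d e < η / 2 then 1 else 0)
        (fun y z hyz => by simp only [hd, fiberAvg_congr _ f hyz])
      have h4 : ∑ e, f e * (if d e < η / 2 then (1 : ℝ) else 0) =
          ((E.filter fun e => d e < η / 2).card : ℝ) := by
        simp only [hf, ite_mul, one_mul, zero_mul]
        rw [← sum_filter, ← sum_filter, sum_const, nsmul_one, filter_filter, ← filter_filter,
          filter_mem_eq_inter, univ_inter]
      rw [← h4, ← h3]
      have h5 : ∀ e, d e * (if d e < η / 2 then (1 : ℝ) else 0) ≤ η / 2 := by
        intro e
        split_ifs with h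
        · linarith
        · simp; positivity
      refine (sum_le_sum fun e _ => h5 e).trans ?_
      simp [hn, mul_comm]
    have h3 : ((E.filter fun e => ¬ BoxRegular E ε c (c ∘ e)).card : ℝ) ≤
        D.card + (E.filter fun e => d e < η / 2).card := by
      exact_mod_cast (card_le_card h1).trans (card_union_le _ _)
    linarith
  -- `D` is a union of whole boxes, so the comparison is made box by box: every side of the empty
  -- sub-box is at least an ε-fraction of the side of its box.
  have hcardD' : ε ^ m * (D.card : ℝ) ≤ (D'.card : ℝ) := by
    rw [card_eq_sum_card_fiberwise (f := fun e => c ∘ e) (t := univ) (fun _ _ => mem_univ _),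
      card_eq_sum_card_fiberwise (s := D') (f := fun e => c ∘ e) (t := univ)
        (fun _ _ => mem_univ _), Nat.cast_sum, Nat.cast_sum, mul_sum]
    refine sum_le_sum fun I _ => ?_
    rcases (D.filter fun e => c ∘ e = I).eq_empty_or_nonempty with h0 | ⟨e0, he0⟩
    · rw [h0]; simp
    · simp only [hD, mem_filter, mem_univ, true_and] at he0
      obtain ⟨⟨he1, he2⟩, rfl⟩ := he0
      obtain ⟨hA1, hA2, -⟩ := hA _ he1
      have h1 : (D.filter fun e => c ∘ e = c ∘ e0).card ≤
          ∏ j, (univ.filter fun x => c x = (c ∘ e0) j).card := by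
        rw [← card_filter_box]
        exact card_le_card fun e he => by
          simp only [mem_filter, mem_univ, true_and] at he ⊢
          exact he.2
      have h2 : ∏ j, (A (c ∘ e0) j).card ≤ (D'.filter fun e => c ∘ e = c ∘ e0).card := by
        rw [← Fintype.card_piFinset]
        refine card_le_card fun e he => ?_
        rw [Fintype.mem_piFinset] at he
        have h3 : c ∘ e = c ∘ e0 := funext fun j => hA1 j _ (he j)
        simp only [hD', hD, mem_filter, mem_univ, true_and]
        refine ⟨⟨⟨h3 ▸ he1, ?_⟩, h3 ▸ he⟩, h3⟩
        rw [show d e = d e0 from fiberAvg_congr _ f h3]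
        exact he2
      calc ε ^ m * ((D.filter fun e => c ∘ e = c ∘ e0).card : ℝ)
          ≤ ε ^ m * ∏ j, ((univ.filter fun x => c x = (c ∘ e0) j).card : ℝ) := by
            gcongr; exact_mod_cast h1
        _ = ∏ j, (ε * ((univ.filter fun x => c x = (c ∘ e0) j).card : ℝ)) := by
            rw [prod_mul_distrib]; simp
        _ ≤ ∏ j, ((A (c ∘ e0) j).card : ℝ) := by
            refine prod_le_prod (fun j _ => by positivity) fun j _ => hA2 j
        _ ≤ _ := by exact_mod_cast h2
  have hzero : ∀ e ∈ D', d' e = 0 := by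
    intro e he
    simp only [hD', hD, mem_filter, mem_univ, true_and] at he
    obtain ⟨⟨he1, he2⟩, he3⟩ := he
    have hsum : ∑ y with c' ∘ y = c' ∘ e, f y = 0 := by
      refine sum_eq_zero fun y hy => ?_
      have hy := (mem_filter.1 hy).2
      refine if_neg fun hyE => (hA _ he1).2.2 y hyE fun j => ?_
      have h1 := congrFun (congrArg Prod.snd (congrFun hy j)) (c ∘ e, j)
      simp only [hc', Function.comp_apply, decide_eq_decide] at h1
      exact h1.2 (he3 j)
    simp only [hd', fiberAvg]
    refine div_eq_zero_iff.2 (Or.inl ?_)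
    convert hsum
  calc ε ^ m * (η / 2) ^ 3 * n ^ m = ε ^ m * (η / 2 * n ^ m) * (η / 2) ^ 2 := by ring
    _ ≤ (D'.card : ℝ) * (η / 2) ^ 2 := by
        gcongr
        exact (mul_le_mul_of_nonneg_left hcardD (by positivity)).trans hcardD'
    _ = ∑ e ∈ D', (η / 2) ^ 2 := by simp
    _ ≤ ∑ e ∈ D', (d' e - d e) ^ 2 := by
        refine sum_le_sum fun e he => ?_
        rw [hzero e he, zero_sub, neg_sq]
        have := (mem_filter.1 (mem_filter.1 he).1).2.2
        gcongr
    _ ≤ ∑ e, (d' e - d e) ^ 2 :=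
        sum_le_sum_of_subset_of_nonneg (subset_univ _) fun _ _ _ => sq_nonneg _

open Classical in
/-- A one-sided weak regularity lemma for sets of tuples. -/
theorem weak_regularity (m : ℕ) (ε η : ℝ) (hε : 0 < ε) (hη : 0 < η) :
    ∃ T : ℕ, ∀ (X : Type*) [Fintype X] [Nonempty X] (E : Finset (Fin m → X)),
      ∃ t ≤ T, ∃ c : X → Fin t,
        ((E.filter fun e => ¬ BoxRegular E ε c (c ∘ e)).card : ℝ) ≤
          η * (Fintype.card X : ℝ) ^ m := by
  set δ : ℝ := ε ^ m * (η / 2) ^ 3 with hδ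
  have hδ0 : 0 < δ := by positivity
  have main : ∀ k : ℕ, ∃ T : ℕ, ∀ (X : Type _) [Fintype X] [Nonempty X] (E : Finset (Fin m → X)),
      ∃ t ≤ T, ∃ c : X → Fin t,
        ((E.filter fun e => ¬ BoxRegular E ε c (c ∘ e)).card : ℝ) ≤
          η * (Fintype.card X : ℝ) ^ m ∨
        k * δ * (Fintype.card X : ℝ) ^ m ≤
          ∑ e : Fin m → X, fiberAvg (fun e => c ∘ e) (fun e => if e ∈ E then 1 else 0) e ^ 2 := by
    intro k
    induction k with
    | zero =>
      refine ⟨1, fun X _ _ E => ⟨1, le_rfl, fun _ => 0, Or.inr ?_⟩⟩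
      simp only [Nat.cast_zero, zero_mul]
      exact sum_nonneg fun _ _ => sq_nonneg _
    | succ k ih =>
      obtain ⟨T, hT⟩ := ih
      refine ⟨∑ t ∈ range (T + 1), (t + Fintype.card (Fin t × ((Fin m → Fin t) × Fin m → Bool))),
        fun X _ _ E => ?_⟩
      obtain ⟨t, ht, c, hc⟩ := hT X E
      have hle : t + Fintype.card (Fin t × ((Fin m → Fin t) × Fin m → Bool)) ≤ _ :=
        single_le_sum (f := fun t => t + Fintype.card (Fin t × ((Fin m → Fin t) × Fin m → Bool)))
          (fun _ _ => Nat.zero_le _) (mem_range.2 (Nat.lt_succ_of_le ht))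
      by_cases hreg : ((E.filter fun e => ¬ BoxRegular E ε c (c ∘ e)).card : ℝ) ≤
          η * (Fintype.card X : ℝ) ^ m
      · exact ⟨t, le_trans (Nat.le_add_right _ _) hle, c, Or.inl hreg⟩
      · have hc := hc.resolve_left hreg
        obtain ⟨c', hc'⟩ := energy_increment E ε η hε hη c (not_le.1 hreg)
        set φ := Fintype.equivFin (Fin t × ((Fin m → Fin t) × Fin m → Bool))
        refine ⟨_, le_trans (Nat.le_add_left _ _) hle, φ ∘ c', Or.inr ?_⟩
        have h1 : ∀ e : Fin m → X, fiberAvg (fun e : Fin m → X => (φ ∘ c') ∘ e)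
            (fun e => if e ∈ E then (1 : ℝ) else 0) e = fiberAvg (fun e : Fin m → X => c' ∘ e)
            (fun e => if e ∈ E then 1 else 0) e := by
          intro e
          have h2 : ∀ y : Fin m → X, (φ ∘ c') ∘ y = (φ ∘ c') ∘ e ↔ c' ∘ y = c' ∘ e := by
            intro y
            simp [funext_iff]
          unfold fiberAvg
          simp only [h2]
        simp only [h1]
        push_cast
        rw [← hδ] at hc'
        linarith
  -- The energy never exceeds `|X| ^ m`, so the energy alternative fails once kδ > 1 and the
  -- partition is regular.
  obtain ⟨k, hk⟩ := exists_nat_gt (1 / δ)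
  obtain ⟨T, hT⟩ := main k
  refine ⟨T, fun X _ _ E => ?_⟩
  obtain ⟨t, ht, c, hc⟩ := hT X E
  refine ⟨t, ht, c, hc.resolve_right fun h => ?_⟩
  have hn : (0 : ℝ) < (Fintype.card X : ℝ) ^ m := by
    have : (0 : ℝ) < Fintype.card X := by exact_mod_cast Fintype.card_pos
    positivity
  have h1 : ∑ e : Fin m → X, fiberAvg (fun e => c ∘ e) (fun e => if e ∈ E then 1 else 0) e ^ 2 ≤
      (Fintype.card X : ℝ) ^ m := by
    refine (sum_le_sum (g := fun _ => (1 : ℝ)) fun e _ => ?_).trans (by simp)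
    exact pow_le_one₀ (fiberAvg_nonneg _ _ (fun y => by split_ifs <;> norm_num) _)
      (fiberAvg_le_one _ _ (fun y => by split_ifs <;> norm_num) _)
  rw [div_lt_iff₀ hδ0] at hk
  have : (k : ℝ) * δ * (Fintype.card X : ℝ) ^ m ≤ 1 * (Fintype.card X : ℝ) ^ m := by
    rw [one_mul]; exact h.trans h1
  exact absurd (le_of_mul_le_mul_right this hn) (not_le.2 hk)

end Regularity

/-! ### Linear programming duality, and matchings from regular boxes. -/

section Duality

open Finset

/-- Approximate duality for packing linear programs. -/
theorem packing_duality {I J : Type*} [Fintype I] [Fintype J] (a : I → J → ℝ)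
    (N : J → ℝ) (hN : ∀ j, 0 ≤ N j) (θ R : ℝ) (hR : 0 < R) :
    (∃ w : I → ℝ, (∀ i, 0 ≤ w i) ∧ (∀ j, ∑ i, w i * a i j ≤ N j) ∧ θ ≤ ∑ i, w i) ∨
    ∃ y : J → ℝ, (∀ j, 0 ≤ y j) ∧ (∀ i, 1 - θ / R ≤ ∑ j, y j * a i j) ∧ ∑ j, y j * N j < θ := by
  classical
  -- A packing of value θ is a point of the image of the box [0, R]^I in the nonpositive orthant. If
  -- there is none, Hahn-Banach separates the two sets. The bound R makes the image compact and
  -- costs the error θ/R in the dual.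
  set φ : (I → ℝ) → (J → ℝ) × ℝ := fun w => (fun j => ∑ i, w i * a i j - N j, θ - ∑ i, w i)
    with hφ
  set S : Set ((J → ℝ) × ℝ) := φ '' Set.Icc 0 (fun _ => R) with hS
  set t : Set ((J → ℝ) × ℝ) := Set.Iic 0 with ht
  by_cases hd : Disjoint S t
  swap
  · left
    obtain ⟨_, ⟨w, hw, rfl⟩, h2⟩ := Set.not_disjoint_iff.1 hd
    refine ⟨w, hw.1, fun j => ?_, ?_⟩
    · have := h2.1 j
      simp only [hφ, Prod.fst_zero, Pi.zero_apply] at this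
      linarith
    · have := h2.2
      simp only [hφ, Prod.snd_zero] at this
      linarith
  right
  have hconv : Convex ℝ S := by
    rintro _ ⟨w, hw, rfl⟩ _ ⟨w', hw', rfl⟩ p q hp hq hpq
    refine ⟨p • w + q • w', convex_Icc _ _ hw hw' hp hq hpq, ?_⟩
    refine Prod.ext (funext fun j => ?_) ?_
    · simp only [hφ, Pi.add_apply, Pi.smul_apply, smul_eq_mul, Prod.fst_add, Prod.smul_fst,
        add_mul, sum_add_distrib, mul_assoc, ← mul_sum]
      linear_combination N j * hpq
    · simp only [hφ, Pi.add_apply, Pi.smul_apply, smul_eq_mul, Prod.snd_add, Prod.smul_snd,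
        sum_add_distrib, ← mul_sum]
      linear_combination (-θ) * hpq
  have hcomp : IsCompact S := by
    refine isCompact_Icc.image ?_
    simp only [hφ]
    fun_prop
  obtain ⟨f, u, v, hfS, huv, hft⟩ := geometric_hahn_banach_compact_closed hconv hcomp
    (convex_Iic _) (isClosed_Iic (a := (0 : (J → ℝ) × ℝ))) hd
  have hv : v < 0 := by simpa using hft 0 (Set.mem_Iic.2 le_rfl)
  have hcone : ∀ b : (J → ℝ) × ℝ, b ≤ 0 → 0 ≤ f b := by
    intro b hb
    by_contra hneg
    have hneg := not_le.1 hneg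
    have h1 := hft ((v / f b) • b) (smul_nonpos_of_nonneg_of_nonpos
      (div_nonneg_of_nonpos hv.le hneg.le) hb)
    rw [map_smul, smul_eq_mul, div_mul_cancel₀ _ hneg.ne] at h1
    exact lt_irrefl _ h1
  set y' : J → ℝ := fun j => - f (Pi.single j 1, 0) with hy'
  set lam : ℝ := - f (0, 1) with hlam
  have hy0 : ∀ j, 0 ≤ y' j := by
    intro j
    have := hcone (-(Pi.single j 1, 0)) (by
      rw [Left.neg_nonpos_iff]
      exact ⟨Pi.single_nonneg.2 zero_le_one, le_rfl⟩)
    rwa [map_neg] at this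
  have hl0 : 0 ≤ lam := by
    have := hcone (-(0, 1)) (by
      rw [Left.neg_nonpos_iff]
      exact ⟨le_rfl, zero_le_one⟩)
    rwa [map_neg] at this
  have hf : ∀ p z, f (p, z) = - ∑ j, y' j * p j - lam * z := by
    intro p z
    have h1 : ((p, z) : (J → ℝ) × ℝ) =
        ∑ j, p j • ((Pi.single j 1, 0) : (J → ℝ) × ℝ) + z • ((0, 1) : (J → ℝ) × ℝ) := by
      refine Prod.ext ?_ ?_
      · funext k
        simp [Prod.fst_sum, Finset.sum_apply, Pi.single_apply]
      · simp [Prod.snd_sum]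
    rw [h1, map_add, map_sum, map_smul]
    simp only [map_smul, smul_eq_mul, hy', hlam, ← sum_neg_distrib]
    rw [sub_eq_add_neg]
    congr 1
    · exact sum_congr rfl fun j _ => by ring
    · ring
  have hmain : ∀ w ∈ Set.Icc (0 : I → ℝ) (fun _ => R),
      0 < ∑ j, y' j * (∑ i, w i * a i j - N j) + lam * (θ - ∑ i, w i) := by
    intro w hw
    have h1 := hfS (φ w) ⟨w, hw, rfl⟩
    rw [hφ, hf] at h1
    linarith
  -- The zero packing bounds the value of the dual and shows that the multiplier of the objective is
  -- positive, so one may divide by it.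
  have hw0 := hmain 0 ⟨le_rfl, fun _ => hR.le⟩
  simp only [Pi.zero_apply, zero_mul, sum_const_zero, zero_sub, sub_zero, mul_neg,
    sum_neg_distrib] at hw0
  have hyN : 0 ≤ ∑ j, y' j * N j := sum_nonneg fun j _ => mul_nonneg (hy0 j) (hN j)
  have hlpos : 0 < lam := by
    rcases hl0.lt_or_eq with h | h
    · exact h
    · rw [← h] at hw0; linarith
  refine ⟨fun j => y' j / lam, fun j => div_nonneg (hy0 j) hl0, fun i => ?_, ?_⟩
  -- The packing that puts all of R on the single index `i` gives the covering constraint at `i`.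
  · have h1 := hmain (Pi.single i R) ⟨Pi.single_nonneg.2 hR.le, fun k => by
      rw [Pi.single_apply]; split_ifs; exacts [le_rfl, hR.le]⟩
    simp only [Pi.single_apply, ite_mul, zero_mul, sum_ite_eq', mem_univ, if_true, mul_sub,
      sum_sub_distrib] at h1
    have h2 : ∑ j, y' j * (R * a i j) = R * ∑ j, y' j * a i j := by
      rw [mul_sum]; exact sum_congr rfl fun j _ => by ring
    rw [h2] at h1
    have h3 : ∑ j, y' j / lam * a i j = (∑ j, y' j * a i j) / lam := by
      rw [sum_div]; exact sum_congr rfl fun j _ => by ring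
    rw [h3, le_div_iff₀ hlpos]
    have h4 : (1 - θ / R) * lam * R ≤ (∑ j, y' j * a i j) * R := by
      have : (1 - θ / R) * lam * R = lam * R - lam * θ := by field_simp
      rw [this]; linarith
    exact le_of_mul_le_mul_right h4 hR
  · have h3 : ∑ j, y' j / lam * N j = (∑ j, y' j * N j) / lam := by
      rw [sum_div]; exact sum_congr rfl fun j _ => by ring
    rw [h3, div_lt_iff₀ hlpos]
    linarith

/-- A set of one-to-one tuples no two of which share an entry. -/
def IsTupleMatching {X : Type*} {m : ℕ} (M : Finset (Fin m → X)) : Prop :=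
  (∀ e ∈ M, Function.Injective e) ∧ ∀ e ∈ M, ∀ f ∈ M, e ≠ f → ∀ i j, e i ≠ f j

theorem IsTupleMatching.mul_card_le {X : Type*} [Fintype X] {m : ℕ} {M : Finset (Fin m → X)}
    (hM : IsTupleMatching M) : M.card * m ≤ Fintype.card X := by
  classical
  have h : (M.biUnion fun e => univ.image e).card = ∑ e ∈ M, (univ.image e).card := by
    refine card_biUnion fun e he f hf hef => disjoint_left.2 ?_
    simp only [mem_image, mem_univ, true_and]
    rintro _ ⟨i, rfl⟩ ⟨j, hj⟩
    exact hM.2 e he f hf hef i j hj.symm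
  rw [sum_congr rfl fun e he => card_image_of_injective univ (hM.1 e he)] at h
  simp only [card_univ, Fintype.card_fin, sum_const, smul_eq_mul] at h
  rw [← h]
  exact card_le_univ _

open Classical in
/-- Greedy matching inside the regular boxes of a fractional matching. -/
theorem exists_tupleMatching_of_regular {X K : Type*} [Fintype X] [Fintype K] {m : ℕ}
    (E : Finset (Fin m → X)) (hE : ∀ e ∈ E, Function.Injective e) (hm : 0 < m) (ε : ℝ)
    (hε0 : 0 ≤ ε) (hε : ε ≤ 1) (c : X → K) (w : {I : Fin m → K // BoxRegular E ε c I} → ℝ) (hw : ∀ I, 0 ≤ w I)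
    (hload : ∀ k, ∑ I, w I * (∑ j, if I.1 j = k then 1 else 0) ≤
      ((univ.filter fun x => c x = k).card : ℝ)) :
    ∃ M ⊆ E, IsTupleMatching M ∧
      (1 - ε) * ∑ I, w I - (Fintype.card K : ℝ) ^ m ≤ (M.card : ℝ) := by
  -- Each box `I` receives at most (1-ε) w(I) edges. A maximum family falls short of each quota by
  -- at most 1, whence the loss of one edge per box.
  set Adm : Finset (Finset (Fin m → X)) := univ.filter fun M => M ⊆ E ∧ IsTupleMatching M ∧
    (∀ e ∈ M, BoxRegular E ε c (c ∘ e)) ∧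
    ∀ I, ((M.filter fun e => c ∘ e = I.1).card : ℝ) ≤ (1 - ε) * w I with hAdm
  have hne : Adm.Nonempty := ⟨∅, by
    simp only [hAdm, mem_filter, mem_univ, true_and, empty_subset, filter_empty, card_empty,
      Nat.cast_zero]
    refine ⟨⟨by simp, by simp⟩, by simp, fun I => mul_nonneg (by linarith) (hw I)⟩⟩
  obtain ⟨M, hM, hmax⟩ := exists_max_image Adm card hne
  simp only [hAdm, mem_filter, mem_univ, true_and] at hM hmax
  obtain ⟨hME, hMm, hMr, hMw⟩ := hM
  refine ⟨M, hME, hMm, ?_⟩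
  have hcard : (M.card : ℝ) =
      ∑ I : {I : Fin m → K // BoxRegular E ε c I}, ((M.filter fun e => c ∘ e = I.1).card : ℝ) := by
    have h1 : M.card = ∑ I : {I : Fin m → K // BoxRegular E ε c I},
        (M.filter fun e => c ∘ e = I.1).card := by
      rw [← sum_subtype (univ.filter fun I => BoxRegular E ε c I) (by simp)
        (fun I => (M.filter fun e => c ∘ e = I).card)]
      exact card_eq_sum_card_fiberwise fun e he => by simpa using hMr e he
    exact_mod_cast h1
  have hfull : ∀ I : {I : Fin m → K // BoxRegular E ε c I},
      (1 - ε) * w I - 1 ≤ ((M.filter fun e => c ∘ e = I.1).card : ℝ) := by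
    intro I
    by_contra hcon
    have hcon := not_le.1 hcon
    set A : K → Finset X := fun k => univ.filter fun x => c x = k ∧ ∀ e ∈ M, ∀ i, e i ≠ x with hA
    -- The quotas use at most a (1-ε)-fraction of each class, so the unused vertices form sub-boxes
    -- to which regularity applies.
    have hAlarge : ∀ k, ε * ((univ.filter fun x => c x = k).card : ℝ) ≤ ((A k).card : ℝ) := by
      intro k
      have h1 : (univ.filter fun x => c x = k) ⊆
          A k ∪ M.biUnion fun e => (univ.filter fun i => c (e i) = k).image e := by
        intro x hx
        simp only [mem_filter, mem_univ, true_and] at hx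
        rw [mem_union]
        by_cases h : ∀ e ∈ M, ∀ i, e i ≠ x
        · left; simp only [hA, mem_filter, mem_univ, true_and]; exact ⟨hx, h⟩
        · right
          push Not at h
          obtain ⟨e, he, i, rfl⟩ := h
          exact mem_biUnion.2 ⟨e, he, mem_image.2 ⟨i, by simpa using hx, rfl⟩⟩
      have h2 : ((univ.filter fun x => c x = k).card : ℝ) ≤
          (A k).card + ∑ e ∈ M, ((univ.filter fun i => c (e i) = k).card : ℝ) := by
        have h3 := (card_le_card h1).trans (card_union_le _ _)
        have h4 : (M.biUnion fun e => (univ.filter fun i => c (e i) = k).image e).card ≤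
            ∑ e ∈ M, (univ.filter fun i => c (e i) = k).card :=
          card_biUnion_le.trans (sum_le_sum fun e _ => card_image_le)
        exact_mod_cast h3.trans (Nat.add_le_add_left h4 _)
      have h5 : ∑ e ∈ M, ((univ.filter fun i => c (e i) = k).card : ℝ) =
          ∑ I : {I : Fin m → K // BoxRegular E ε c I},
            ((M.filter fun e => c ∘ e = I.1).card : ℝ) * (∑ j, if I.1 j = k then 1 else 0) := by
        rw [← sum_subtype (univ.filter fun I => BoxRegular E ε c I) (by simp)
          (fun I => ((M.filter fun e => c ∘ e = I).card : ℝ) * (∑ j, if I j = k then 1 else 0))]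
        rw [← sum_fiberwise_of_maps_to (s := M)
          (t := univ.filter fun I => BoxRegular E ε c I) (g := fun e => c ∘ e)
          (fun e he => by simpa using hMr e he)]
        refine sum_congr rfl fun J _ => ?_
        rw [← nsmul_eq_mul, ← sum_const]
        refine sum_congr rfl fun e he => ?_
        rw [← (mem_filter.1 he).2]
        simp
      have h6 : ∑ I : {I : Fin m → K // BoxRegular E ε c I},
            ((M.filter fun e => c ∘ e = I.1).card : ℝ) * (∑ j, if I.1 j = k then 1 else 0) ≤
          (1 - ε) * ((univ.filter fun x => c x = k).card : ℝ) := by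
        refine le_trans ?_ (mul_le_mul_of_nonneg_left (hload k) (by linarith))
        rw [mul_sum]
        refine sum_le_sum fun I _ => ?_
        rw [← mul_assoc]
        exact mul_le_mul_of_nonneg_right (hMw I)
          (sum_nonneg fun j _ => by split_ifs <;> norm_num)
      rw [h5] at h2
      linarith
    have hI := I.2
    obtain ⟨f, hfE, hf⟩ := hI (fun j => A (I.1 j)) (fun j a ha => (mem_filter.1 ha).2.1)
      (fun j C hC => by
        refine le_trans ?_ (hAlarge (I.1 j))
        gcongr
        intro a ha
        simpa using hC a ha)
    have hfI : c ∘ f = I.1 := funext fun j => (mem_filter.1 (hf j)).2.1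
    have hfM : ∀ e ∈ M, ∀ i j, e i ≠ f j := fun e he i j => (mem_filter.1 (hf j)).2.2 e he i
    have hfnot : f ∉ M := fun h' => hfM f h' ⟨0, hm⟩ ⟨0, hm⟩ rfl
    have hins := hmax (insert f M) ⟨insert_subset hfE hME, ⟨?_, ?_⟩, ?_, ?_⟩
    · rw [card_insert_of_notMem hfnot] at hins
      omega
    · intro e he
      rcases mem_insert.1 he with rfl | he
      exacts [hE _ hfE, hMm.1 e he]
    · intro e he g hg hne i j
      rcases mem_insert.1 he with h1 | he <;> rcases mem_insert.1 hg with h2 | hg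
      · exact absurd (h1.trans h2.symm) hne
      · rw [h1]; exact fun h => hfM g hg j i h.symm
      · rw [h2]; exact hfM e he i j
      · exact hMm.2 e he g hg hne i j
    · intro e he
      rcases mem_insert.1 he with rfl | he
      · rw [hfI]; exact hI
      · exact hMr e he
    · intro J
      rw [filter_insert]
      split_ifs with h
      · have hJ : J = I := Subtype.ext (h.symm.trans hfI)
        subst hJ
        have h7 := card_insert_le f (M.filter fun e => c ∘ e = J.1)
        have h8 : ((insert f (M.filter fun e => c ∘ e = J.1)).card : ℝ) ≤
          ((M.filter fun e => c ∘ e = J.1).card : ℝ) + 1 := by exact_mod_cast h7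
        linarith
      · exact hMw J
  rw [hcard, mul_sum]
  refine le_trans ?_ (sum_le_sum fun I _ => hfull I)
  rw [sum_sub_distrib]
  refine sub_le_sub_left ?_ _
  simp only [sum_const, nsmul_one, card_univ]
  have : Fintype.card {I : Fin m → K // BoxRegular E ε c I} ≤ Fintype.card K ^ m := by
    refine (Fintype.card_subtype_le _).trans (by simp)
  exact_mod_cast this

open Classical in
/-- Either a set of one-to-one tuples has a large matching, or there is a small discrete weighting
of the vertices under which almost all its tuples are heavy. -/
theorem exists_weighting_and_matching (m : ℕ) (hm : 0 < m) (L : ℕ) (hL : 2 ≤ L) (η : ℝ)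
    (hη : 0 < η) :
    ∃ n₀ : ℕ, ∀ (X : Type*) [Fintype X] [Nonempty X] (E : Finset (Fin m → X)),
      (∀ e ∈ E, Function.Injective e) → n₀ ≤ Fintype.card X →
      ∃ l : X → ℕ, (∀ x, l x ≤ L) ∧
        ((E.filter fun e => ∑ j, l (e j) + 1 < L).card : ℝ) ≤ η * (Fintype.card X : ℝ) ^ m ∧
        ∃ M ⊆ E, IsTupleMatching M ∧
          (∑ x, (l x : ℝ)) ≤ L * (M.card : ℝ) + 4 * (Fintype.card X : ℝ) := by
  have hL2 : (2 : ℝ) ≤ L := by exact_mod_cast hL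
  have hL0 : (0 : ℝ) < L := by linarith
  obtain ⟨T, hT⟩ := weak_regularity m (1 / L) η (by positivity) hη
  refine ⟨(L + 2) * (1 + T ^ m), fun X _ _ E hE hn => ?_⟩
  obtain ⟨t, ht, c, hc⟩ := hT X E
  obtain ⟨M, hM, hmax⟩ := exists_max_image (univ.filter fun M : Finset (Fin m → X) =>
    M ⊆ E ∧ IsTupleMatching M) card
    ⟨∅, mem_filter.2 ⟨mem_univ _, empty_subset _, by simp [IsTupleMatching]⟩⟩
  simp only [mem_filter, mem_univ, true_and] at hM hmax
  -- A packing of value θ on the regular boxes would round to a matching with at least |M| + 1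
  -- edges, against maximality; so the dual alternative holds.
  set θ : ℝ := (M.card + 1 + (T : ℝ) ^ m) / (1 - 1 / L) with hθ
  have h1L : (0 : ℝ) < 1 - 1 / L := by
    rw [sub_pos, div_lt_one hL0]; linarith
  have hθ0 : 0 < θ := by positivity
  have hdual := packing_duality
    (fun (I : {I : Fin m → Fin t // BoxRegular E (1 / L) c I}) (k : Fin t) =>
      ∑ j, if I.1 j = k then (1 : ℝ) else 0)
    (fun k => ((univ.filter fun x => c x = k).card : ℝ)) (fun _ => Nat.cast_nonneg _)
    θ (θ * L) (by positivity)
  rcases hdual with ⟨w, hw0, hw, hwθ⟩ | ⟨y, hy0, hy, hyθ⟩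
  · exfalso
    obtain ⟨M', hM'E, hM', hcard⟩ := exists_tupleMatching_of_regular E hE hm (1 / L)
      (by positivity) (by linarith) c w hw0
      (fun k => by convert hw k)
    have h2 : (M'.card : ℝ) ≤ M.card := by exact_mod_cast hmax M' ⟨hM'E, hM'⟩
    have h3 : (Fintype.card (Fin t) : ℝ) ^ m ≤ (T : ℝ) ^ m := by
      rw [Fintype.card_fin]; gcongr
    have h4 : (1 - 1 / (L : ℝ)) * θ = M.card + 1 + (T : ℝ) ^ m := by
      rw [hθ, mul_div_cancel₀ _ h1L.ne']
    have h5 := mul_le_mul_of_nonneg_left hwθ h1L.le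
    linarith
  · have hLθ : θ * L / (θ * L) = 1 := by field_simp
    -- Rounding up preserves the covering inequality, at a cost of at most 1 per vertex. The cap at
    -- L is harmless, since an edge with an entry of weight L is already heavy.
    refine ⟨fun x => min (⌊L * y (c x)⌋₊ + 1) L, fun x => min_le_right _ _, ?_, M, hM.1, hM.2, ?_⟩
    · refine le_trans ?_ hc
      norm_cast
      refine card_le_card fun e he => ?_
      rw [mem_filter] at he ⊢
      refine ⟨he.1, fun hreg => ?_⟩
      have h2 := hy ⟨_, hreg⟩
      have h3 : ∑ k, y k * (∑ j, if (c ∘ e) j = k then (1 : ℝ) else 0) = ∑ j, y (c (e j)) := by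
        simp_rw [mul_sum]
        rw [sum_comm]
        simp
      simp only [h3] at h2
      have h4 : θ / (θ * L) = 1 / L := by field_simp
      rw [h4] at h2
      refine absurd he.2 (not_lt.2 ?_)
      change L ≤ ∑ j, min (⌊L * y (c (e j))⌋₊ + 1) L + 1
      by_cases hex : ∃ j, L ≤ ⌊L * y (c (e j))⌋₊ + 1
      · obtain ⟨j, hj⟩ := hex
        have h5 := single_le_sum (f := fun j => min (⌊L * y (c (e j))⌋₊ + 1) L)
          (fun _ _ => Nat.zero_le _) (mem_univ j)
        simp only [min_eq_right hj] at h5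
        omega
      · push Not at hex
        have h5 : (L : ℝ) ≤ ∑ j, ((⌊L * y (c (e j))⌋₊ + 1 : ℕ) : ℝ) + 1 := by
          have h6 : ∑ j, L * y (c (e j)) ≤ ∑ j, ((⌊L * y (c (e j))⌋₊ + 1 : ℕ) : ℝ) :=
            sum_le_sum fun j _ => by push_cast; exact (Nat.lt_floor_add_one _).le
          rw [← mul_sum] at h6
          have h7 := mul_le_mul_of_nonneg_left h2 hL0.le
          have h8 : (L : ℝ) * (1 - 1 / L) = L - 1 := by field_simp
          linarith
        have h9 : L ≤ ∑ j, (⌊L * y (c (e j))⌋₊ + 1) + 1 := by exact_mod_cast h5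
        rw [sum_congr rfl fun j _ => min_eq_left (hex j).le]
        exact h9
    · have h2 : ∑ x, y (c x) < θ := by
        refine lt_of_eq_of_lt ?_ hyθ
        rw [← sum_fiberwise_of_maps_to (s := univ) (t := univ) (g := c) (fun _ _ => mem_univ _)]
        refine sum_congr rfl fun k _ => ?_
        rw [sum_congr rfl fun x hx => by rw [(mem_filter.1 hx).2], sum_const, nsmul_eq_mul,
          mul_comm]
      have h3 : ∑ x, ((min (⌊L * y (c x)⌋₊ + 1) L : ℕ) : ℝ) ≤
          L * ∑ x, y (c x) + Fintype.card X := by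
        rw [mul_sum, ← card_univ, ← nsmul_one (#univ), ← sum_const, ← sum_add_distrib]
        refine sum_le_sum fun x _ => ?_
        have h4 : ((min (⌊L * y (c x)⌋₊ + 1) L : ℕ) : ℝ) ≤ ((⌊L * y (c x)⌋₊ + 1 : ℕ) : ℝ) := by
          exact_mod_cast min_le_left _ _
        refine h4.trans ?_
        push_cast
        have := Nat.floor_le (mul_nonneg hL0.le (hy0 (c x)))
        linarith
      -- For L ≥ 2 one has L/(1 - 1/L) ≤ L + 2; the surplus 2|M| and the additive constants are
      -- absorbed in the term 4|X|.
      have h5 : L * θ ≤ (L + 2) * (M.card + 1 + (T : ℝ) ^ m) := by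
        have h6 : L * θ = (M.card + 1 + (T : ℝ) ^ m) * (L / (1 - 1 / L)) := by
          rw [hθ]; ring
        rw [h6, mul_comm]
        refine mul_le_mul_of_nonneg_right ?_ (by positivity)
        rw [div_le_iff₀ h1L]
        have : ((L : ℝ) + 2) * (1 - 1 / L) = L + 1 - 2 / L := by field_simp; ring
        rw [this]
        have : (2 : ℝ) / L ≤ 1 := by rw [div_le_one hL0]; exact hL2
        linarith
      have h7 : (M.card : ℝ) ≤ Fintype.card X := by
        exact_mod_cast (Nat.le_mul_of_pos_right _ hm).trans hM.2.mul_card_le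
      have h8 : ((L : ℝ) + 2) * (1 + (T : ℝ) ^ m) ≤ Fintype.card X := by exact_mod_cast hn
      have h9 := mul_le_mul_of_nonneg_left h2.le hL0.le
      refine h3.trans ?_
      nlinarith

end Duality

/-! ### Tilings and homogeneous blow-ups of fissile digraphs. -/

section Blowup

open Finset

namespace MDigraph

variable {V : Type*} {m : ℕ}

theorem sum_multi {W : Type*} [Fintype W] (e : Fin m → W) : ∑ v, multi v e = m := by
  classical
  have h := card_eq_sum_card_fiberwise (s := (univ : Finset (Fin m))) (f := e)
    (t := univ) (fun _ _ => mem_univ _)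
  simp only [card_univ, Fintype.card_fin] at h
  refine Eq.trans (sum_congr rfl fun v _ => ?_) h.symm
  unfold multi
  congr

theorem multi_pos_iff {W : Type*} {v : W} {e : Fin m → W} : 0 < multi v e ↔ ∃ j, e j = v := by
  classical
  unfold multi
  rw [card_pos]
  constructor
  · rintro ⟨j, hj⟩; exact ⟨j, (mem_filter.1 hj).2⟩
  · rintro ⟨j, hj⟩; exact ⟨j, mem_filter.2 ⟨mem_univ _, hj⟩⟩

/-- The pattern `I` of cells is homogeneous: every choice of one vertex from each cell of the
pattern gives an edge. -/
def Homogeneous {ι : Type*} (H : MDigraph V m) (X : ι → Finset V) (I : Fin m → ι) : Prop :=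
  ∀ e : Fin m → V, (∀ j, e j ∈ X (I j)) → (∀ j k, I j = I k → e j = e k) → e ∈ H.edges

/-- The set `W` is covered exactly by a matching of one-to-one edges of `H`. -/
def Tiles (H : MDigraph V m) (W : Finset V) : Prop :=
  ∃ M ⊆ H.edges, IsTupleMatching M ∧ ∀ v, v ∈ W ↔ ∃ e ∈ M, ∃ j, e j = v

theorem tiles_empty (H : MDigraph V m) : H.Tiles ∅ :=
  ⟨∅, empty_subset _, ⟨by simp, by simp⟩, by simp⟩

theorem Tiles.union [DecidableEq V] {H : MDigraph V m} {W W' : Finset V} (h : H.Tiles W)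
    (h' : H.Tiles W') (hd : Disjoint W W') : H.Tiles (W ∪ W') := by
  classical
  obtain ⟨M, hME, hM, hMW⟩ := h
  obtain ⟨N, hNE, hN, hNW⟩ := h'
  have hdis : ∀ e ∈ M, ∀ f ∈ N, ∀ i j, e i ≠ f j := fun e he f hf i j heq =>
    disjoint_left.1 hd ((hMW _).2 ⟨e, he, i, rfl⟩) ((hNW _).2 ⟨f, hf, j, heq.symm⟩)
  refine ⟨M ∪ N, union_subset hME hNE, ⟨fun e he => ?_, fun e he f hf hne i j => ?_⟩, fun v => ?_⟩
  · rcases mem_union.1 he with he | he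
    exacts [hM.1 e he, hN.1 e he]
  · rcases mem_union.1 he with he | he <;> rcases mem_union.1 hf with hf | hf
    exacts [hM.2 e he f hf hne i j, hdis e he f hf i j,
      (hdis f hf e he j i).symm, hN.2 e he f hf hne i j]
  · rw [mem_union, hMW, hNW]
    simp only [mem_union, or_and_right, exists_or]

theorem Tiles.biUnion [DecidableEq V] {α : Type*} {H : MDigraph V m} (s : Finset α)
    (W : α → Finset V) (h : ∀ a ∈ s, H.Tiles (W a))
    (hd : ∀ a ∈ s, ∀ b ∈ s, a ≠ b → Disjoint (W a) (W b)) : H.Tiles (s.biUnion W) := by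
  classical
  induction s using Finset.induction_on with
  | empty => rw [biUnion_empty]; exact H.tiles_empty
  | insert a s ha ih =>
    rw [biUnion_insert]
    refine (h a (mem_insert_self _ _)).union (ih (fun b hb => h b (mem_insert_of_mem hb))
      fun b hb c hc => hd b (mem_insert_of_mem hb) c (mem_insert_of_mem hc)) ?_
    rw [disjoint_biUnion_right]
    intro b hb
    exact hd a (mem_insert_self _ _) b (mem_insert_of_mem hb) fun h => ha (h ▸ hb)

theorem Tiles.hasPerfectMatching {H : MDigraph V m} (h : H.Tiles H.verts) :
    H.HasPerfectMatching := by
  obtain ⟨M, hME, hM, hMW⟩ := h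
  exact ⟨M, hME, hM.1, hM.2, fun v hv => (hMW v).1 hv⟩

theorem Tiles.card_dvd {H : MDigraph V m} {W : Finset V} (h : H.Tiles W) : m ∣ W.card := by
  classical
  obtain ⟨M, -, hM, hMW⟩ := h
  have h1 : W = M.biUnion fun e => univ.image e := by
    ext v; rw [hMW]; simp
  rw [h1, card_biUnion]
  · rw [sum_congr rfl fun e he => card_image_of_injective univ (hM.1 e he)]
    simp
  · refine fun e he f hf hef => disjoint_left.2 ?_
    simp only [mem_image, mem_univ, true_and]
    rintro _ ⟨i, rfl⟩ ⟨j, hj⟩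
    exact hM.2 e he f hf hef i j hj.symm

/-- Homogeneity makes the tuple of the sets `B (I j)` suitable. The resulting one-to-one edge covers
these sets, and it contains nothing else since both sides have `m` elements. This is how fissility
enters the proof. -/
theorem Fissile.exists_edge {ι : Type*} {H : MDigraph V m} (hH : H.Fissile)
    {X : ι → Finset V} {I : Fin m → ι} (hI : H.Homogeneous X I) (B : ι → Finset V)
    (hBX : ∀ i, B i ⊆ X i) (hB : ∀ i, (B i).card = multi i I)
    (hd : ∀ i j, i ≠ j → Disjoint (B i) (B j)) :
    ∃ e ∈ H.edges, Function.Injective e ∧ ∀ v, (∃ j, e j = v) ↔ ∃ i, v ∈ B i := by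
  classical
  have hne : ∀ j, (B (I j)).Nonempty := fun j => by
    rw [← card_pos, hB, multi_pos_iff]; exact ⟨j, rfl⟩
  have hinj : ∀ j k, B (I j) = B (I k) ↔ I j = I k := by
    refine fun j k => ⟨fun h => ?_, fun h => by rw [h]⟩
    by_contra hne'
    have := hd _ _ hne'
    rw [h, disjoint_self] at this
    exact (hne k).ne_empty this
  have hcardB : ∀ j, (B (I j)).card = multi (B (I j)) (fun k => B (I k)) := by
    intro j
    rw [hB]
    unfold multi
    congr 1
    ext k
    simp only [mem_filter, mem_univ, true_and]
    exact (hinj k j).symm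
  have hsum : ∑ C ∈ univ.image (fun k => B (I k)), C.card = m := by
    have h1 := card_eq_sum_card_image (fun k => B (I k)) (univ : Finset (Fin m))
    rw [card_univ, Fintype.card_fin] at h1
    refine Eq.trans (sum_congr rfl fun C hC => ?_) h1.symm
    obtain ⟨j, -, rfl⟩ := mem_image.1 hC
    rw [hcardB]
    unfold multi
    congr
  have hdF : ∀ C ∈ univ.image (fun k => B (I k)), ∀ D ∈ univ.image (fun k => B (I k)), C ≠ D →
      Disjoint C D := by
    intro C hC D hD hCD
    obtain ⟨j, -, rfl⟩ := mem_image.1 hC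
    obtain ⟨k, -, rfl⟩ := mem_image.1 hD
    exact hd _ _ fun h => hCD (by rw [h])
  have hsuit : H.Suitable fun k => B (I k) := by
    refine ⟨univ.image (fun k => B (I k)), ?_, hdF, hsum, fun i => mem_image_of_mem _ (mem_univ _),
      ?_, ?_⟩
    · intro C hC v hv
      obtain ⟨j, -, rfl⟩ := mem_image.1 hC
      -- Cells are not assumed to consist of vertices of `H`; every element of a used set is an
      -- entry of some edge of the pattern.
      have he : (fun k => if I k = I j then v else (hne k).choose) ∈ H.edges := by
        refine hI _ (fun k => ?_) (fun k l hkl => ?_)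
        · split_ifs with h
          · rw [h]; exact hBX _ hv
          · exact hBX _ (hne k).choose_spec
        · simp only [hkl]
      simpa using H.edge_mem _ he j
    · intro C hC
      obtain ⟨j, -, rfl⟩ := mem_image.1 hC
      exact hcardB j
    · exact fun e he he' => hI e (fun j => hBX _ (he j)) fun j k hjk => he' j k (congrArg B hjk)
  obtain ⟨e, heE, heinj, hecov⟩ := hH _ hsuit
  refine ⟨e, heE, heinj, ?_⟩
  have hsub : (univ.image fun k => B (I k)).biUnion (fun C => C) ⊆ univ.image e := by
    intro v hv
    simp only [mem_biUnion, mem_image, mem_univ, true_and] at hv ⊢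
    obtain ⟨_, ⟨i, rfl⟩, hv⟩ := hv
    exact hecov i v hv
  have heq := eq_of_subset_of_card_le hsub (by
    rw [card_biUnion hdF, card_image_of_injective _ heinj]
    simp [hsum])
  intro v
  have h1 : (∃ j, e j = v) ↔ v ∈ univ.image e := by simp
  rw [h1, ← heq]
  simp only [mem_biUnion, mem_image, mem_univ, true_and]
  constructor
  · rintro ⟨_, ⟨i, rfl⟩, hv⟩; exact ⟨_, hv⟩
  · rintro ⟨i, hv⟩
    have : 0 < multi i I := by rw [← hB]; exact card_pos.2 ⟨v, hv⟩
    obtain ⟨j, rfl⟩ := multi_pos_iff.1 this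
    exact ⟨_, ⟨j, rfl⟩, hv⟩

/-- A homogeneous blow-up whose cell sizes are the loads of a list of patterns can be tiled. -/
theorem Fissile.tiles_of_list {ι : Type*} [Fintype ι] [DecidableEq V] {H : MDigraph V m}
    (hH : H.Fissile) {X : ι → Finset V} (Ls : List (Fin m → ι))
    (hL : ∀ I ∈ Ls, H.Homogeneous X I) (B : ι → Finset V) (hBX : ∀ i, B i ⊆ X i)
    (hB : ∀ i, (B i).card = (Ls.map (multi i)).sum)
    (hd : ∀ i j, i ≠ j → Disjoint (B i) (B j)) : H.Tiles (univ.biUnion B) := by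
  classical
  induction Ls generalizing B with
  | nil =>
    have : univ.biUnion B = ∅ := by
      refine eq_empty_of_forall_notMem fun v hv => ?_
      obtain ⟨i, -, hv⟩ := mem_biUnion.1 hv
      have := hB i
      rw [List.map_nil, List.sum_nil, card_eq_zero] at this
      simp [this] at hv
    rw [this]
    exact H.tiles_empty
  | cons I Ls ih =>
    have hex : ∀ i, ∃ C ⊆ B i, C.card = multi i I := fun i =>
      exists_subset_card_eq (by rw [hB]; simp)
    choose C hCB hC using hex
    have hCd : ∀ i j, i ≠ j → Disjoint (C i) (C j) := fun i j hij =>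
      (hd i j hij).mono (hCB i) (hCB j)
    obtain ⟨e, heE, heinj, hecov⟩ := hH.exists_edge (hL I (by simp)) C
      (fun i => (hCB i).trans (hBX i)) hC hCd
    have h1 : H.Tiles (univ.biUnion C) := by
      refine ⟨{e}, by simpa using heE, ⟨by simpa using heinj, ?_⟩, fun v => ?_⟩
      · intro a ha b hb hab
        rw [mem_singleton] at ha hb
        exact absurd (ha.trans hb.symm) hab
      · simp [hecov v]
    have h2 : H.Tiles (univ.biUnion fun i => B i \ C i) := by
      refine ih (fun J hJ => hL J (by simp [hJ])) _ (fun i => sdiff_subset.trans (hBX i))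
        (fun i => ?_) (fun i j hij => (hd i j hij).mono sdiff_subset sdiff_subset)
      rw [card_sdiff_of_subset (hCB i), hB, hC]
      simp
    have h3 : univ.biUnion B = univ.biUnion C ∪ univ.biUnion fun i => B i \ C i := by
      ext v
      simp only [mem_biUnion, mem_univ, true_and, mem_union, mem_sdiff, ← exists_or]
      refine exists_congr fun i => ⟨fun h => ?_, fun h => h.elim (fun h => hCB i h) fun h => h.1⟩
      by_cases hv : v ∈ C i
      exacts [Or.inl hv, Or.inr ⟨h, hv⟩]
    rw [h3]
    refine h1.union h2 ?_
    rw [disjoint_biUnion_left]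
    intro i _
    rw [disjoint_biUnion_right]
    intro j _
    by_cases hij : i = j
    · subst hij; exact disjoint_sdiff
    · exact (hd i j hij).mono (hCB i) sdiff_subset

end MDigraph

end Blowup

/-! ### From light one-to-one edges to light edges with repetitions. -/

section BadPatterns

open Finset

open Classical in
/-- Supersaturation, with the blow-ups listed as functions on pairs. -/
theorem card_blowups_ge_uncurried {X ι : Type*} [Fintype X] [Nonempty X] [Fintype ι]
    [DecidableEq ι] (b : ℕ) (hb : b ≠ 0) (G : Finset (ι → X)) (γ : ℝ) (hγ : 0 ≤ γ)
    (hG : γ * (Fintype.card X : ℝ) ^ Fintype.card ι ≤ G.card) :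
    γ ^ (b ^ Fintype.card ι) * (Fintype.card X : ℝ) ^ Fintype.card (ι × Fin b) ≤
      ((univ.filter fun x : ι × Fin b → X =>
        ∀ σ : ι → Fin b, (fun i => x (i, σ i)) ∈ G).card : ℝ) := by
  have h := card_blowups_ge b hb G γ hγ hG
  rw [Fintype.card_prod, Fintype.card_fin]
  refine h.trans (le_of_eq ?_)
  norm_cast
  refine card_equiv (Equiv.curry ι (Fin b) X).symm fun x => ?_
  simp [Function.uncurry]

namespace MDigraph

variable {V : Type*} {m : ℕ}

theorem multi_le {W : Type*} (v : W) (e : Fin m → W) : multi v e ≤ m := by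
  classical
  unfold multi
  exact (card_filter_le _ _).trans (by simp)

theorem sum_mul_multi {W R : Type*} [CommSemiring R] (S : Finset W) (f : W → R) (e : Fin m → W)
    (he : ∀ j, e j ∈ S) : ∑ v ∈ S, f v * (multi v e : R) = ∑ j, f (e j) := by
  classical
  rw [← sum_fiberwise_of_maps_to (s := univ) (t := S) (g := e) (fun j _ => he j)]
  refine sum_congr rfl fun v _ => ?_
  rw [sum_congr rfl fun j hj => by rw [(mem_filter.1 hj).2], sum_const, nsmul_eq_mul, mul_comm]
  unfold multi
  congr

/-- The cells of an injective blow-up `x`, all transversals of which contain an edge with pattern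
`I`, are homogeneous. -/
theorem homogeneous_of_transversals {ι : Type*} {b : ℕ} [DecidableEq V]
    (H : MDigraph V m) (x : ι × Fin b → V) (I : Fin m → ι) (hb : 0 < b)
    (hx : ∀ σ : ι → Fin b, (fun j => x (I j, σ (I j))) ∈ H.edges) :
    H.Homogeneous (fun i => univ.image fun k : Fin b => x (i, k)) I := by
  classical
  intro e he hcon
  simp only [mem_image, mem_univ, true_and] at he
  choose τ hτ using he
  -- `e` is constant on equal cells, so it comes from a section; cells outside the pattern take the
  -- index 0.
  set σ : ι → Fin b := fun i => if h : ∃ j, I j = i then τ h.choose else ⟨0, hb⟩ with hσ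
  have h1 : (fun j => x (I j, σ (I j))) = e := by
    funext j
    have h : ∃ k, I k = I j := ⟨j, rfl⟩
    have h2 : σ (I j) = τ h.choose := dif_pos h
    rw [h2, ← hcon _ _ h.choose_spec, ← hτ h.choose, h.choose_spec]
  rw [← h1]
  exact hx σ

open Classical in
/-- If few one-to-one edges are light, then few tuples contain a light edge. -/
theorem card_light_patterns_le (m s L : ℕ) (hm : 0 < m) (hs : 0 < s) (γ : ℝ) (hγ : 0 < γ) :
    ∃ η : ℝ, 0 < η ∧ ∃ n₀ : ℕ, ∀ (V : Type*) (H : MDigraph V m), H.Fissile →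
      ∀ Y : Finset V, n₀ ≤ Y.card → ∀ l : V → ℕ,
      ((univ.filter fun e : Fin m → Y => (Function.Injective e ∧ (fun j => (e j : V)) ∈ H.edges) ∧
        ∑ j, l (e j) + 1 < L).card : ℝ) ≤ η * (Y.card : ℝ) ^ m →
      ∀ (I : Fin m → Fin s) (κ : Fin s → ℕ), ∑ j, κ (I j) + 1 < L →
      ((univ.filter fun z : Fin s → Y => (fun j => (z (I j) : V)) ∈ H.edges ∧
        ∀ i, l (z i) = κ i).card : ℝ) ≤ γ * (Y.card : ℝ) ^ s := by
  set g : ℝ := γ ^ (m ^ s) with hg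
  have hg0 : 0 < g := by positivity
  set K : ℕ := Fintype.card (Fin s × Fin m) with hK
  have hK0 : 0 < K := by simp [hK, hm, hs]
  have hK0' : (0 : ℝ) < K := by exact_mod_cast hK0
  obtain ⟨n₀, hn₀⟩ := exists_nat_gt (4 * (K : ℝ) ^ 2 / g)
  -- There are at most K^m placements of a light edge in a blow-up, so with this η they account for
  -- at most g/4 of all functions. The non-injective ones account for another g/4, which together is
  -- less than the guaranteed g.
  refine ⟨g / (4 * (K : ℝ) ^ m), by positivity, n₀ + 1,
    fun V H hH Y hY l hbad I κ hIκ => ?_⟩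
  by_contra hcon
  have hcon := (not_le.1 hcon).le
  set N : ℝ := (Y.card : ℝ) with hN
  have hYpos : 0 < Y.card := by omega
  have : Nonempty Y := (card_pos.1 hYpos).to_subtype
  have hN0 : 0 < N := by rw [hN]; exact_mod_cast hYpos
  have hNn : 4 * (K : ℝ) ^ 2 / g < N := hn₀.trans (by
    rw [hN]; exact_mod_cast (by omega : n₀ < Y.card))
  set G := univ.filter fun z : Fin s → Y => (fun j => (z (I j) : V)) ∈ H.edges ∧
        ∀ i, l (z i) = κ i with hG
  set Bad := univ.filter fun e : Fin m → Y =>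
    (Function.Injective e ∧ (fun j => (e j : V)) ∈ H.edges) ∧ ∑ j, l (e j) + 1 < L with hBad
  have hcardY : Fintype.card Y = Y.card := Fintype.card_coe Y
  -- Cells of size `m` suffice, since no multiplicity exceeds `m`.
  have h1 := card_blowups_ge_uncurried (X := Y) (ι := Fin s) m hm.ne' G γ hγ.le (by
    rw [hcardY, Fintype.card_fin]; exact hcon)
  rw [hcardY, Fintype.card_fin, ← hg, ← hK, ← hN] at h1
  -- every injective blow-up contains a light one-to-one edge
  have hsub : (univ.filter fun x : Fin s × Fin m → Y => ∀ σ : Fin s → Fin m,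
      (fun i => x (i, σ i)) ∈ G) ⊆
      (univ.filter fun x : Fin s × Fin m → Y => ¬ Function.Injective x) ∪
      (univ.filter fun τ : Fin m → Fin s × Fin m => Function.Injective τ).biUnion fun τ =>
        univ.filter fun x : Fin s × Fin m → Y => x ∘ τ ∈ Bad := by
    intro x hx
    simp only [mem_filter, mem_univ, true_and] at hx
    rw [mem_union]
    by_cases hinj : Function.Injective x
    swap
    · exact Or.inl (by simpa using hinj)
    right
    have hxG : ∀ σ : Fin s → Fin m, (fun j => (x (I j, σ (I j)) : V)) ∈ H.edges :=
      fun σ => (mem_filter.1 (hx σ)).2.1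
    have hxl : ∀ i k, l (x (i, k)) = κ i := fun i k => (mem_filter.1 (hx fun _ => k)).2.2 i
    have hhom := H.homogeneous_of_transversals (fun p => (x p : V)) I hm hxG
    have hxinj : Function.Injective fun p => (x p : V) := Subtype.val_injective.comp hinj
    have hex : ∀ i, ∃ C ⊆ univ.image (fun k : Fin m => (x (i, k) : V)), C.card = multi i I := by
      intro i
      refine exists_subset_card_eq ?_
      rw [card_image_of_injective _ fun a b hab => (Prod.ext_iff.1 (hxinj hab)).2, card_univ,
        Fintype.card_fin]
      exact multi_le _ _
    choose B hBX hB using hex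
    have hd : ∀ i j, i ≠ j → Disjoint (B i) (B j) := by
      intro i j hij
      refine Disjoint.mono (hBX i) (hBX j) (disjoint_left.2 ?_)
      simp only [mem_image, mem_univ, true_and]
      rintro _ ⟨a, rfl⟩ ⟨b, hb⟩
      exact hij (Prod.ext_iff.1 (hxinj hb)).1.symm
    obtain ⟨e, heE, heinj, hecov⟩ := hH.exists_edge hhom B hBX hB hd
    have hτ : ∀ j, ∃ p : Fin s × Fin m, (x p : V) = e j := by
      intro j
      obtain ⟨i, hi⟩ := (hecov (e j)).1 ⟨j, rfl⟩
      obtain ⟨k, -, hk⟩ := mem_image.1 (hBX i hi)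
      exact ⟨(i, k), hk⟩
    choose τ hτ using hτ
    have hτinj : Function.Injective τ := fun a b hab => heinj (by rw [← hτ, ← hτ, hab])
    -- All vertices of cell `i` have weight `κ i`, so replacing repetitions by distinct vertices of
    -- the same cell preserves the weight of the edge.
    have hsum : ∑ j, l (e j) = ∑ j, κ (I j) := by
      have h2 : ∑ v ∈ univ.image e, l v = ∑ j, l (e j) := sum_image fun a _ b _ hab => heinj hab
      have h3 : univ.image e = univ.biUnion B := by
        ext v; simp only [mem_image, mem_univ, true_and, mem_biUnion]; exact hecov v
      have h4 := sum_mul_multi (univ : Finset (Fin s)) κ I fun _ => mem_univ _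
      rw [← h2, h3, sum_biUnion fun i _ j _ hij => hd i j hij, ← h4]
      refine sum_congr rfl fun i _ => ?_
      rw [sum_congr rfl fun v hv => ?_, sum_const, hB, smul_eq_mul, mul_comm]
      · rfl
      obtain ⟨k, -, rfl⟩ := mem_image.1 (hBX i hv)
      exact hxl i k
    refine mem_biUnion.2 ⟨τ, by simpa using hτinj, ?_⟩
    simp only [hBad, mem_filter, mem_univ, true_and, Function.comp_apply, hτ]
    refine ⟨⟨hinj.comp hτinj, heE⟩, ?_⟩
    rw [hsum]
    exact hIκ
  have h2 : ((univ.filter fun x : Fin s × Fin m → Y => ¬ Function.Injective x).card : ℝ) ≤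
      g / 4 * N ^ K := by
    have h3 := card_not_injective_mul_le (X := Y) (ι := Fin s × Fin m)
    rw [hcardY, ← hK] at h3
    have h3' : (univ.filter fun x : Fin s × Fin m → Y => ¬ Function.Injective x).card * Y.card ≤
        K ^ 2 * Y.card ^ K := by convert h3
    have h4 : ((univ.filter fun x : Fin s × Fin m → Y => ¬ Function.Injective x).card : ℝ) * N ≤
        (K : ℝ) ^ 2 * N ^ K := by rw [hN]; exact_mod_cast h3'
    rw [div_lt_iff₀ hg0] at hNn
    have h5 : (K : ℝ) ^ 2 * N ^ K ≤ (g / 4 * N ^ K) * N := by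
      have : (0 : ℝ) < N ^ K := by positivity
      nlinarith
    exact le_of_mul_le_mul_right (h4.trans h5) hN0
  have h3 : (((univ.filter fun τ : Fin m → Fin s × Fin m => Function.Injective τ).biUnion fun τ =>
        univ.filter fun x : Fin s × Fin m → Y => x ∘ τ ∈ Bad).card : ℝ) ≤ g / 4 * N ^ K := by
    have h4 : ∀ τ ∈ univ.filter fun τ : Fin m → Fin s × Fin m => Function.Injective τ,
        ((univ.filter fun x : Fin s × Fin m → Y => x ∘ τ ∈ Bad).card : ℝ) ≤
          g / (4 * (K : ℝ) ^ m) * N ^ K := by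
      intro τ hτ
      have h5 := card_filter_comp_mem τ (mem_filter.1 hτ).2 Bad
      rw [hcardY, Fintype.card_fin, ← hK] at h5
      have h5' : (univ.filter fun x : Fin s × Fin m → Y => x ∘ τ ∈ Bad).card * Y.card ^ m =
        Bad.card * Y.card ^ K := by convert h5
      have h6 : ((univ.filter fun x : Fin s × Fin m → Y => x ∘ τ ∈ Bad).card : ℝ) * N ^ m =
        Bad.card * N ^ K := by rw [hN]; exact_mod_cast h5'
      refine le_of_mul_le_mul_right (h6.le.trans ?_) (show (0 : ℝ) < N ^ m by positivity)
      calc (Bad.card : ℝ) * N ^ K ≤ (g / (4 * (K : ℝ) ^ m) * N ^ m) * N ^ K := by gcongr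
        _ = _ := by ring
    have h5 : (((univ.filter fun τ : Fin m → Fin s × Fin m =>
        Function.Injective τ).biUnion fun τ => univ.filter fun x : Fin s × Fin m → Y =>
          x ∘ τ ∈ Bad).card : ℝ) ≤ ∑ τ ∈ univ.filter fun τ : Fin m → Fin s × Fin m =>
            Function.Injective τ, ((univ.filter fun x : Fin s × Fin m → Y =>
              x ∘ τ ∈ Bad).card : ℝ) := by exact_mod_cast card_biUnion_le
    refine h5.trans ((sum_le_sum h4).trans ?_)
    rw [sum_const, nsmul_eq_mul]
    have h6 : ((univ.filter fun τ : Fin m → Fin s × Fin m => Function.Injective τ).card : ℝ) ≤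
        (K : ℝ) ^ m := by
      have : (univ.filter fun τ : Fin m → Fin s × Fin m => Function.Injective τ).card ≤ K ^ m := by
        refine (card_filter_le _ _).trans ?_
        rw [card_univ, Fintype.card_fun, Fintype.card_fin]
      exact_mod_cast this
    calc _ ≤ (K : ℝ) ^ m * (g / (4 * (K : ℝ) ^ m) * N ^ K) := by gcongr
      _ = g / 4 * N ^ K := by field_simp
  have h4 : ((univ.filter fun x : Fin s × Fin m → Y => ∀ σ : Fin s → Fin m,
      (fun i => x (i, σ i)) ∈ G).card : ℝ) ≤ g / 4 * N ^ K + g / 4 * N ^ K := by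
    refine le_trans ?_ (add_le_add h2 h3)
    exact_mod_cast (card_le_card hsub).trans (card_union_le _ _)
  have h5 : 0 < g * N ^ K := by positivity
  have h6 : g * N ^ K ≤ g / 4 * N ^ K + g / 4 * N ^ K := by
    refine le_trans (h1.trans_eq ?_) h4
    congr!
  linarith

end MDigraph

end BadPatterns

/-! ### Almost perfect matchings from robust fractional tilings. -/

section AlmostPerfect

open Finset

namespace MDigraph

variable {V : Type*} {m : ℕ}

/-- The set `S` contains an edge whose weight is below the level `L - 1`. -/
def HasLightEdge (H : MDigraph V m) (l : V → ℕ) (L : ℕ) (S : Finset V) : Prop :=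
  ∃ e ∈ H.edges, (∀ j, e j ∈ S) ∧ ∑ j, l (e j) + 1 < L

open Classical in
-- After an enumeration of the set, a light edge is recorded by its pattern in `Fin s` and by the
-- weights of the s vertices. There are at most s^m (L+1)^s such records, and each is counted by
-- `hc`.
theorem card_hasLightEdge_le {s L : ℕ} (H : MDigraph V m) (Y : Finset V) (l : V → ℕ)
    (hl : ∀ v, l v ≤ L) (c : ℝ)
    (hc : ∀ (I : Fin m → Fin s) (κ : Fin s → ℕ), ∑ j, κ (I j) + 1 < L →
      ((univ.filter fun z : Fin s → Y => (fun j => (z (I j) : V)) ∈ H.edges ∧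
        ∀ i, l (z i) = κ i).card : ℝ) ≤ c) (hc0 : 0 ≤ c) :
    (((Y.powersetCard s).filter fun S => H.HasLightEdge l L S).card : ℝ) ≤
      (s : ℝ) ^ m * ((L : ℝ) + 1) ^ s * c := by
  set J := univ.filter fun p : (Fin m → Fin s) × (Fin s → Fin (L + 1)) =>
    ∑ j, (p.2 (p.1 j) : ℕ) + 1 < L with hJ
  set T := J.biUnion fun p => univ.filter fun z : Fin s → Y =>
    (fun j => (z (p.1 j) : V)) ∈ H.edges ∧ ∀ i, l (z i) = p.2 i with hT
  have h1 : ((Y.powersetCard s).filter fun S => H.HasLightEdge l L S).card ≤ T.card := by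
    refine card_le_card_of_surjOn (fun z : Fin s → Y => univ.image fun i => (z i : V)) ?_
    intro S hS
    rw [mem_coe, mem_filter, mem_powersetCard] at hS
    obtain ⟨⟨hSY, hSs⟩, e, he, heS, hel⟩ := hS
    set φ : S ≃ Fin s := S.equivFinOfCardEq hSs
    refine ⟨fun i => ⟨φ.symm i, hSY (φ.symm i).2⟩, ?_, ?_⟩
    · rw [mem_coe, hT, mem_biUnion]
      refine ⟨(fun j => φ ⟨e j, heS j⟩,
        fun i => ⟨l (φ.symm i), Nat.lt_succ_of_le (hl _)⟩), ?_, ?_⟩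
      · rw [hJ, mem_filter]
        refine ⟨mem_univ _, ?_⟩
        simpa using hel
      · rw [mem_filter]
        refine ⟨mem_univ _, ?_, fun i => rfl⟩
        simpa using he
    · ext v
      simp only [mem_image, mem_univ, true_and]
      exact ⟨fun ⟨i, hi⟩ => hi ▸ (φ.symm i).2, fun hv => ⟨φ ⟨v, hv⟩, by simp⟩⟩
  have h2 : (T.card : ℝ) ≤ ∑ p ∈ J, c := by
    have h3 : (T.card : ℝ) ≤ ∑ p ∈ J, ((univ.filter fun z : Fin s → Y =>
        (fun j => (z (p.1 j) : V)) ∈ H.edges ∧ ∀ i, l (z i) = p.2 i).card : ℝ) := by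
      exact_mod_cast card_biUnion_le
    refine h3.trans (sum_le_sum fun p hp => ?_)
    exact hc p.1 (fun i => p.2 i) (mem_filter.1 hp).2
  have h3 : (J.card : ℝ) ≤ (s : ℝ) ^ m * ((L : ℝ) + 1) ^ s := by
    have : J.card ≤ s ^ m * (L + 1) ^ s := (card_filter_le _ _).trans (by simp)
    exact_mod_cast this
  rw [sum_const, nsmul_eq_mul] at h2
  calc _ ≤ (T.card : ℝ) := by exact_mod_cast h1
    _ ≤ _ := h2.trans (mul_le_mul_of_nonneg_right h3 hc0)

open Classical in
/-- Few vertices lie in many sets of a small family. -/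
theorem card_filter_many_mul_le {s : ℕ} (Y : Finset V) (F : Finset (Finset V))
    (hF : ∀ S ∈ F, S.card = s) (b : ℝ) :
    ((Y.filter fun v => b < ((F.filter fun S => v ∈ S).card : ℝ)).card : ℝ) * b ≤
      s * (F.card : ℝ) := by
  set W := Y.filter fun v => b < ((F.filter fun S => v ∈ S).card : ℝ)
  have h1 : (W.card : ℝ) * b ≤ ∑ v ∈ W, ((F.filter fun S => v ∈ S).card : ℝ) := by
    rw [← nsmul_eq_mul, ← sum_const]
    exact sum_le_sum fun v hv => (mem_filter.1 hv).2.le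
  refine h1.trans ?_
  have h2 : ∑ v ∈ W, (F.filter fun S => v ∈ S).card = ∑ S ∈ F, (W.filter fun v => v ∈ S).card :=
    sum_card_bipartiteAbove_eq_sum_card_bipartiteBelow _
  have h3 : ∑ S ∈ F, (W.filter fun v => v ∈ S).card ≤ ∑ S ∈ F, s := by
    refine sum_le_sum fun S hS => ?_
    rw [← hF S hS]
    exact card_le_card fun v hv => (mem_filter.1 hv).2
  rw [sum_const, smul_eq_mul, mul_comm] at h3
  exact_mod_cast h2.le.trans h3

/-- The weight of a set that induces a digraph with a `ρ`-perfect fractional matching. -/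
theorem le_weight_of_mem_Spa {ρ : ℝ} {K : MDigraph V m} (hK : K ∈ Spa ρ)
    (l : V → ℝ) (hl : ∀ v, 0 ≤ l v) (c : ℝ) (hc : 0 ≤ c)
    (h : ∀ e ∈ K.edges, c ≤ ∑ j, l (e j)) :
    c * ((1 - ρ) * (K.verts.card : ℝ) / m) ≤ ∑ v ∈ K.verts, l v := by
  obtain ⟨w, ⟨hw, hwv⟩, hsum⟩ := hK
  calc c * ((1 - ρ) * (K.verts.card : ℝ) / m) ≤ c * ∑ e ∈ K.edges, w e := by gcongr
    _ = ∑ e ∈ K.edges, w e * c := by rw [mul_comm, sum_mul]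
    _ ≤ ∑ e ∈ K.edges, w e * ∑ j, l (e j) :=
        sum_le_sum fun e he => mul_le_mul_of_nonneg_left (h e he) (hw e he).1
    _ = ∑ e ∈ K.edges, w e * ∑ v ∈ K.verts, l v * (multi v e : ℝ) := by
        refine sum_congr rfl fun e he => ?_
        rw [sum_mul_multi K.verts l e (K.edge_mem e he)]
    _ = ∑ v ∈ K.verts, l v * ∑ e ∈ K.edges, w e * (multi v e : ℝ) := by
        simp_rw [mul_sum]
        rw [sum_comm]
        exact sum_congr rfl fun v _ => sum_congr rfl fun e _ => by ring
    _ ≤ ∑ v ∈ K.verts, l v * 1 :=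
        sum_le_sum fun v hv => mul_le_mul_of_nonneg_left (hwv v hv) (hl v)
    _ = _ := by simp

theorem deleteVerts_verts [DecidableEq V] (H : MDigraph V m) (A : Finset V) :
    (H.deleteVerts A).verts = H.verts \ A := by
  ext v
  simp [deleteVerts, induce]

theorem mem_deleteVerts_edges {H : MDigraph V m} {A : Finset V} {e : Fin m → V} :
    e ∈ (H.deleteVerts A).edges ↔ e ∈ H.edges ∧ ∀ j, e j ∉ A := by
  classical
  simp only [deleteVerts, induce, mem_filter, mem_sdiff]
  exact and_congr_right fun he => forall_congr' fun j => and_iff_right (H.edge_mem e he j)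

theorem mem_induce_edges {H : MDigraph V m} {S : Finset V} {e : Fin m → V} :
    e ∈ (H.induce S).edges ↔ e ∈ H.edges ∧ ∀ j, e j ∈ S := by
  simp only [induce, mem_filter]

theorem mem_propertyGraph_edges {H : MDigraph V m} {Q : Set (MDigraph V m)} {s : ℕ}
    {S : Finset V} :
    S ∈ (H.propertyGraph Q s).edges ↔ (S ⊆ H.verts ∧ S.card = s) ∧ H.induce S ∈ Q := by
  simp only [propertyGraph, mem_filter, mem_powersetCard]

open Classical in
/-- If few sets contain light edges, and the property graph of fractionally tileable sets is dense
and robust, then the total weight is large. -/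
theorem le_total_weight {s : ℕ} (hs : 0 < s) {μ : ℝ} (hμ : 0 < μ) :
    ∃ n₀ : ℕ, ∀ (V : Type*) (m : ℕ) (H : MDigraph V m) (ρ : ℝ) (A : Finset V) (l : V → ℕ)
      (L : ℕ) (b : ℝ), n₀ ≤ (H.verts \ A).card → s ∣ (H.verts \ A).card →
      (matchingThreshold s + μ) * (((H.verts \ A).card - 1).choose (s - 1) : ℝ) ≤
        (((H.deleteVerts A).propertyGraph (MDigraph.Spa ρ) s).minDegree 1 : ℝ) →
      (∀ v ∈ H.verts \ A, ((((H.verts \ A).powersetCard s).filter fun S =>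
        H.HasLightEdge l L S ∧ v ∈ S).card : ℝ) ≤ b) →
      b ≤ μ / 2 * (((H.verts \ A).card - 1).choose (s - 1) : ℝ) → 1 ≤ L →
      ((L : ℝ) - 1) * ((1 - ρ) * ((H.verts \ A).card : ℝ) / m) ≤
        ∑ v ∈ H.verts \ A, (l v : ℝ) := by
  -- Half of μ pays for discarding the sets with light edges.
  obtain ⟨n₀, hn₀⟩ := hasPerfectMatching_of_degree hs (half_pos hμ)
  refine ⟨n₀, fun V m H ρ A l L b hn hsn hdeg hb hbμ hL => ?_⟩
  set K := (H.deleteVerts A).propertyGraph (MDigraph.Spa ρ) s with hK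
  have hKv : K.verts = H.verts \ A := by
    change (H.deleteVerts A).verts = _
    exact H.deleteVerts_verts A
  set P : UniformHypergraph V s :=
    { verts := K.verts
      edges := K.edges.filter fun S => ¬ H.HasLightEdge l L S
      edge_subset := fun S hS => K.edge_subset S (mem_filter.1 hS).1
      edge_card := fun S hS => K.edge_card S (mem_filter.1 hS).1 } with hP
  have hPv : P.verts = H.verts \ A := hKv
  have hPM : P.HasPerfectMatching := by
    refine hn₀ V P (by rw [hPv]; exact hn) (by rw [hPv]; exact hsn) fun v hv => ?_
    rw [hPv] at hv ⊢
    have h1 : K.degree {v} ≤ P.degree {v} + (((H.verts \ A).powersetCard s).filter fun S =>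
        H.HasLightEdge l L S ∧ v ∈ S).card := by
      rw [UniformHypergraph.degree_singleton, UniformHypergraph.degree_singleton]
      refine le_trans (card_le_card fun S hS => ?_) (card_union_le _ _)
      rw [mem_filter] at hS
      rw [mem_union, mem_filter, mem_filter, mem_filter, mem_powersetCard]
      by_cases h : H.HasLightEdge l L S
      · exact Or.inr ⟨⟨hKv ▸ K.edge_subset S hS.1, K.edge_card S hS.1⟩, h, hS.2⟩
      · exact Or.inl ⟨⟨hS.1, h⟩, hS.2⟩
    have h2 : (K.degree {v} : ℝ) ≤ P.degree {v} + ((((H.verts \ A).powersetCard s).filter fun S =>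
        H.HasLightEdge l L S ∧ v ∈ S).card : ℝ) := by exact_mod_cast h1
    have h3 : (K.minDegree 1 : ℝ) ≤ K.degree {v} := by
      exact_mod_cast K.minDegree_le (hKv ▸ hv)
    have h4 := hb v hv
    linarith
  obtain ⟨M, hME, hMd, hMc⟩ := hPM
  have hMS : ∀ S ∈ M, ((L : ℝ) - 1) * ((1 - ρ) * s / m) ≤ ∑ v ∈ S, (l v : ℝ) := by
    intro S hS
    obtain ⟨hSK, hSl⟩ := mem_filter.1 (hME hS)
    obtain ⟨⟨hSv, hSs⟩, hSQ⟩ := mem_propertyGraph_edges.1 hSK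
    have hv : ((H.deleteVerts A).induce S).verts = S := by
      change (H.deleteVerts A).verts ∩ S = S
      exact inter_eq_right.2 hSv
    have h1 := le_weight_of_mem_Spa hSQ (fun v => (l v : ℝ)) (fun v => Nat.cast_nonneg _)
      ((L : ℝ) - 1) (by
        have : (1 : ℝ) ≤ L := by exact_mod_cast hL
        linarith) (by
        intro e he
        obtain ⟨he1, he2⟩ := mem_induce_edges.1 he
        have h2 : ¬ ∑ j, l (e j) + 1 < L := fun h =>
          hSl ⟨e, (mem_deleteVerts_edges.1 he1).1, he2, h⟩
        have h3 : (L : ℝ) ≤ ∑ j, (l (e j) : ℝ) + 1 := by exact_mod_cast not_lt.1 h2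
        linarith)
    rw [hv, hSs] at h1
    exact h1
  have hMv : H.verts \ A = M.biUnion fun S => S := by
    ext v
    rw [mem_biUnion]
    constructor
    · intro hv
      exact hMc v (hPv ▸ hv)
    · rintro ⟨S, hS, hv⟩
      exact hPv ▸ P.edge_subset S (hME hS) hv
  have hcard : (H.verts \ A).card = M.card * s := by
    rw [hMv, card_biUnion fun S hS T hT hST => hMd S hS T hT hST, sum_const_nat]
    exact fun S hS => P.edge_card S (hME hS)
  rw [hcard]
  rw [hMv, sum_biUnion fun S hS T hT hST => hMd S hS T hT hST]
  refine le_trans (le_of_eq ?_) (sum_le_sum hMS)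
  rw [sum_const, nsmul_eq_mul]
  push_cast
  ring

/-- A crude lower bound for the binomial coefficient in k ≥ x/2, so that degree losses of order
x^(s-1) can be compared with it. -/
theorem pow_le_factorial_mul_choose {x : ℝ} (hx : 0 ≤ x) {s k : ℕ} (hs : 0 < s)
    (hk : 1 / 2 * x ≤ k) (hsx : (s : ℝ) ≤ 1 / 8 * x) :
    (1 / 8 * x) ^ (s - 1) ≤ ((s - 1).factorial : ℝ) * ((k - 1).choose (s - 1) : ℝ) := by
  have h1 := Nat.pow_sub_le_descFactorial (k - 1) (s - 1)
  rw [Nat.descFactorial_eq_factorial_mul_choose] at h1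
  have h2 : 1 / 8 * x ≤ ((k - 1 + 1 - (s - 1) : ℕ) : ℝ) := by
    have h4 : (k : ℝ) + 1 ≤ ((k - 1 + 1 - (s - 1) : ℕ) : ℝ) + s + 1 := by
      exact_mod_cast (by omega : k + 1 ≤ (k - 1 + 1 - (s - 1)) + s + 1)
    linarith
  refine (pow_le_pow_left₀ (by positivity) h2 _).trans ?_
  exact_mod_cast h1

set_option maxHeartbeats 800000 in
open Classical in
/-- Robust fractional tilings give almost perfect matchings. -/
theorem exists_almost_perfect (m s : ℕ) (hm : 0 < m) (hs : 0 < s) (μ α ε : ℝ) (hμ : 0 < μ)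
    (hα : 0 < α) (hα2 : α ≤ 1 / 2) (hε : 0 < ε) :
    ∃ n₀ : ℕ, ∀ (V : Type*) (H : MDigraph V m) (ρ : ℝ), 0 ≤ ρ → ρ ≤ 1 → H.Fissile →
      n₀ ≤ H.verts.card →
      (∀ A : Finset V, A ⊆ H.verts → (A.card : ℝ) ≤ α * (H.verts.card : ℝ) →
        (matchingThreshold s + μ) * ((H.verts.card - A.card - 1).choose (s - 1) : ℝ) ≤
          (((H.deleteVerts A).propertyGraph (MDigraph.Spa ρ) s).minDegree 1 : ℝ)) →
      ∀ A : Finset V, A ⊆ H.verts → (A.card : ℝ) ≤ α / 2 * (H.verts.card : ℝ) →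
      ∃ M ⊆ H.edges, IsTupleMatching M ∧ (∀ e ∈ M, ∀ j, e j ∉ A) ∧
        (H.verts.card : ℝ) - A.card - m * M.card ≤ (ρ + ε) * H.verts.card := by
  set ε' : ℝ := min (ε / 4) (α / 4) with hε'
  have hε'0 : 0 < ε' := lt_min (by linarith) (by linarith)
  have hε'1 : ε' ≤ ε / 4 := min_le_left _ _
  have hε'2 : ε' ≤ α / 4 := min_le_right _ _
  -- Dividing the weight inequality by L turns the rounding error into (4m+1)n/L ≤ εn/4.
  obtain ⟨L, hL⟩ := exists_nat_gt (max 2 (4 * (4 * m + 1) / ε))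
  have hL2R : (2 : ℝ) < L := (le_max_left _ _).trans_lt hL
  have hL2 : 2 ≤ L := by exact_mod_cast hL2R.le
  have hLε : (4 * (m : ℝ) + 1) / L ≤ ε / 4 := by
    have h1 := ((le_max_right _ _).trans_lt hL).le
    rw [div_le_iff₀ hε] at h1
    rw [div_le_iff₀ (by linarith)]
    linarith
  -- This β makes `bd`, the permitted number of light sets at a vertex, at most μ/2 times the
  -- binomial coefficient.
  set β : ℝ := μ / 2 / (8 ^ (s - 1) * ((s - 1).factorial : ℝ)) with hβ
  have hfac : (0 : ℝ) < ((s - 1).factorial : ℝ) := by exact_mod_cast Nat.factorial_pos _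
  have hβ0 : 0 < β := by positivity
  have hs0 : (0 : ℝ) < s := by exact_mod_cast hs
  set D : ℝ := s * ((s : ℝ) ^ m * ((L : ℝ) + 1) ^ s) with hD
  have hD0 : 0 < D := by positivity
  -- Double counting bounds the vertices in too many light sets by Dγ/β times the number of
  -- vertices, which this choice makes an ε'-fraction.
  set γ : ℝ := β * ε' / D with hγ
  have hγ0 : 0 < γ := by positivity
  obtain ⟨η, hη, n₁, hn₁⟩ := card_light_patterns_le m s L hm hs γ hγ0
  obtain ⟨n₂, hn₂⟩ := exists_weighting_and_matching m hm L hL2 η hη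
  obtain ⟨n₃, hn₃⟩ := le_total_weight hs hμ
  obtain ⟨n₄, hn₄⟩ := exists_nat_gt ((s : ℝ) / ε')
  refine ⟨2 * (n₁ + n₂ + n₃ + n₄ + 1), fun V H ρ hρ0 hρ1 hH hn hspace A hA hAcard => ?_⟩
  set n := H.verts.card with hnV
  set Y := H.verts \ A with hY
  have hYc : Y.card = n - A.card := card_sdiff_of_subset hA
  have hAn : A.card ≤ n := card_le_card hA
  have hYR : (Y.card : ℝ) = n - A.card := by rw [hYc, Nat.cast_sub hAn]
  have hnR : (2 : ℝ) * (n₁ + n₂ + n₃ + n₄ + 1) ≤ n := by exact_mod_cast hn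
  have hn0 : (0 : ℝ) < n := by
    have : (0 : ℝ) ≤ (n₁ : ℝ) + n₂ + n₃ + n₄ := by positivity
    linarith
  have hαn : α / 2 * (n : ℝ) ≤ 1 / 4 * n :=
    mul_le_mul_of_nonneg_right (by linarith) hn0.le
  have hYge : n₁ + n₂ + n₃ + n₄ + 1 ≤ Y.card := by
    have h1 : ((n₁ + n₂ + n₃ + n₄ + 1 : ℕ) : ℝ) ≤ (Y.card : ℝ) := by
      push_cast; linarith
    exact_mod_cast h1
  have hsn : (s : ℝ) ≤ ε' * n := by
    rw [div_lt_iff₀ hε'0] at hn₄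
    have h1 : (n₄ : ℝ) ≤ n := by
      have : (0 : ℝ) ≤ (n₁ : ℝ) + n₂ + n₃ + n₄ := by positivity
      have : (0 : ℝ) ≤ (n₁ : ℝ) + n₂ + n₃ := by positivity
      linarith
    exact hn₄.le.trans ((mul_le_mul_of_nonneg_right h1 hε'0.le).trans_eq (mul_comm _ _))
  have hYne : Nonempty Y := (card_pos.1 (by omega : 0 < Y.card)).to_subtype
  -- the weighting and the matching
  set E := univ.filter fun e : Fin m → Y => Function.Injective e ∧ (fun j => (e j : V)) ∈ H.edges
    with hE
  obtain ⟨l₀, hl₀, hlight, M₀, hM₀E, hM₀, hM₀l⟩ := hn₂ Y E (fun e he => (mem_filter.1 he).2.1)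
    (by rw [Fintype.card_coe]; omega)
  rw [Fintype.card_coe] at hlight hM₀l
  set l : V → ℕ := fun v => if h : v ∈ Y then l₀ ⟨v, h⟩ else 0 with hl
  have hll : ∀ v : Y, l v = l₀ v := fun v => by simp [hl]
  have hlL : ∀ v, l v ≤ L := fun v => by
    simp only [hl]; split_ifs; exacts [hl₀ _, Nat.zero_le _]
  have hpat := hn₁ V H hH Y (by omega) l (by
    refine le_trans (le_of_eq ?_) hlight
    rw [hE, filter_filter]
    simp only [hll])
  have hcount := card_hasLightEdge_le (s := s) H Y l hlL _ hpat (by positivity)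
  set F := (Y.powersetCard s).filter fun S => H.HasLightEdge l L S with hF
  set bd : ℝ := β * (Y.card : ℝ) ^ (s - 1) with hbd
  have hY0 : (0 : ℝ) < Y.card := by exact_mod_cast (by omega : 0 < Y.card)
  have hbd0 : 0 < bd := by positivity
  set W := Y.filter fun v => bd < ((F.filter fun S => v ∈ S).card : ℝ) with hW
  have hWcard : (W.card : ℝ) ≤ ε' * n := by
    have h1 := card_filter_many_mul_le Y F
      (fun S hS => (mem_powersetCard.1 (mem_filter.1 hS).1).2) bd
    have h2 : (s : ℝ) * F.card ≤ ε' * Y.card * bd := by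
      calc (s : ℝ) * F.card ≤ s * ((s : ℝ) ^ m * ((L : ℝ) + 1) ^ s * (γ * (Y.card : ℝ) ^ s)) := by
            gcongr
        _ = D * γ * (Y.card : ℝ) ^ s := by rw [hD]; ring
        _ = β * ε' * (Y.card : ℝ) ^ s := by rw [hγ]; field_simp
        _ = ε' * Y.card * bd := by
            obtain ⟨k, rfl⟩ := Nat.exists_eq_succ_of_ne_zero hs.ne'
            rw [hbd, Nat.succ_sub_one, Nat.succ_eq_add_one, pow_succ]; ring
    have h3 := le_of_mul_le_mul_right (h1.trans h2) hbd0
    refine h3.trans (mul_le_mul_of_nonneg_left ?_ hε'0.le)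
    rw [hYR]
    have : (0 : ℝ) ≤ A.card := Nat.cast_nonneg _
    linarith
  -- the deleted set, of the right residue
  obtain ⟨R, hRY, hRc⟩ := exists_subset_card_eq (show (Y \ W).card % s ≤ (Y \ W).card from
    Nat.mod_le _ _)
  have hRs : R.card < s := hRc ▸ Nat.mod_lt _ hs
  -- Besides `A`, the vertices in many light sets are removed, and then fewer than s more to make
  -- the remaining number divisible by s. In total this is still at most αn.
  set A' := A ∪ W ∪ R with hA'
  have hWY : W ⊆ Y := filter_subset _ _
  have hA'V : A' ⊆ H.verts := union_subset (union_subset hA (hWY.trans sdiff_subset))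
    (hRY.trans (sdiff_subset.trans sdiff_subset))
  have hrest : H.verts \ A' = (Y \ W) \ R := by
    ext v
    simp only [hA', hY, mem_sdiff, mem_union]
    tauto
  have hdvd : s ∣ (H.verts \ A').card := by
    rw [hrest, card_sdiff_of_subset hRY, hRc]
    exact Nat.dvd_sub_mod _
  have hA'c : (A'.card : ℝ) ≤ A.card + ε' * n + ε' * n := by
    have h1 : A'.card ≤ A.card + W.card + R.card :=
      (card_union_le _ _).trans (Nat.add_le_add_right (card_union_le _ _) _)
    have h2 : (A'.card : ℝ) ≤ A.card + W.card + R.card := by exact_mod_cast h1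
    have h3 : (R.card : ℝ) ≤ s := by exact_mod_cast hRs.le
    linarith
  have hε'n : ε' * n ≤ α / 4 * n := by gcongr
  have hA'α : (A'.card : ℝ) ≤ α * n := by linarith
  have hA'n : A'.card ≤ n := card_le_card hA'V
  have hrc : (H.verts \ A').card = n - A'.card := card_sdiff_of_subset hA'V
  have hrR : ((H.verts \ A').card : ℝ) = n - A'.card := by rw [hrc, Nat.cast_sub hA'n]
  have hα2n : α * (n : ℝ) ≤ 1 / 2 * n := by gcongr
  have hrge : (1 / 2 : ℝ) * n ≤ ((H.verts \ A').card : ℝ) := by rw [hrR]; linarith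
  have hbdμ : bd ≤ μ / 2 * (((H.verts \ A').card - 1).choose (s - 1) : ℝ) := by
    have h5 := pow_le_factorial_mul_choose hn0.le hs hrge (by
      have : α / 4 * (n : ℝ) ≤ 1 / 8 * n := mul_le_mul_of_nonneg_right (by linarith) hn0.le
      linarith)
    have h6 : (Y.card : ℝ) ≤ n := by
      rw [hYR]
      have : (0 : ℝ) ≤ A.card := Nat.cast_nonneg _
      linarith
    calc bd ≤ β * (n : ℝ) ^ (s - 1) := by rw [hbd]; gcongr
      _ = μ / 2 / ((s - 1).factorial : ℝ) * (1 / 8 * (n : ℝ)) ^ (s - 1) := by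
          rw [hβ, mul_pow, div_pow, one_pow]; field_simp
      _ ≤ μ / 2 / ((s - 1).factorial : ℝ) * (((s - 1).factorial : ℝ) *
            (((H.verts \ A').card - 1).choose (s - 1) : ℝ)) := by gcongr
      _ = _ := by field_simp
  have hweight := hn₃ V m H ρ A' l L bd (by
      have h1 : ((n₃ : ℕ) : ℝ) ≤ ((H.verts \ A').card : ℝ) := by
        have : (0 : ℝ) ≤ (n₁ : ℝ) + n₂ + n₄ := by positivity
        linarith
      exact_mod_cast h1) hdvd (by
      rw [hrc]; exact hspace A' hA'V hA'α) (by
      intro v hv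
      rw [hrest, mem_sdiff, mem_sdiff] at hv
      have h1 : ¬ bd < ((F.filter fun S => v ∈ S).card : ℝ) := fun h =>
        hv.1.2 (mem_filter.2 ⟨hv.1.1, h⟩)
      refine le_trans ?_ (not_lt.1 h1)
      norm_cast
      refine card_le_card fun S hS => ?_
      simp only [hF, mem_filter, mem_powersetCard] at hS ⊢
      refine ⟨⟨⟨hS.1.1.trans ?_, hS.1.2⟩, hS.2.1⟩, hS.2.2⟩
      rw [hrest]
      exact sdiff_subset.trans sdiff_subset) hbdμ (by omega)
  have hsum : ∑ v ∈ H.verts \ A', (l v : ℝ) ≤ ∑ x : Y, (l₀ x : ℝ) := by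
    have h1 : ∑ x : Y, (l₀ x : ℝ) = ∑ v ∈ Y, (l v : ℝ) := by
      rw [← sum_coe_sort Y fun v => (l v : ℝ)]
      exact sum_congr rfl fun x _ => by rw [hll x]
    rw [h1]
    refine sum_le_sum_of_subset_of_nonneg ?_ fun _ _ _ => Nat.cast_nonneg _
    rw [hrest]
    exact sdiff_subset.trans sdiff_subset
  have hinj : Function.Injective fun (e : Fin m → Y) (j : Fin m) => (e j : V) := by
    intro e f h
    funext j
    exact Subtype.ext (congrFun h j)
  refine ⟨M₀.image fun e j => (e j : V), ?_, ⟨?_, ?_⟩, ?_, ?_⟩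
  · intro e he
    obtain ⟨f, hf, rfl⟩ := mem_image.1 he
    exact (mem_filter.1 (hM₀E hf)).2.2
  · intro e he
    obtain ⟨f, hf, rfl⟩ := mem_image.1 he
    exact Subtype.val_injective.comp (hM₀.1 f hf)
  · intro e he e' he' hne i j
    obtain ⟨f, hf, rfl⟩ := mem_image.1 he
    obtain ⟨f', hf', rfl⟩ := mem_image.1 he'
    exact fun h => hM₀.2 f hf f' hf' (fun h' => hne (by rw [h'])) i j (Subtype.ext h)
  · intro e he j
    obtain ⟨f, hf, rfl⟩ := mem_image.1 he
    exact (mem_sdiff.1 (f j).2).2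
  · rw [card_image_of_injective _ hinj]
    have hm0 : (0 : ℝ) < m := by exact_mod_cast hm
    have hL0 : (0 : ℝ) < L := by linarith
    have h1 := hweight.trans (hsum.trans hM₀l)
    set N'' : ℝ := ((H.verts \ A').card : ℝ) with hN''
    have h2 : ((L : ℝ) - 1) * ((1 - ρ) * N'') ≤ m * (L * M₀.card + 4 * Y.card) := by
      have h3 := mul_le_mul_of_nonneg_left h1 hm0.le
      refine le_trans (le_of_eq ?_) h3
      field_simp
    have h3 : (Y.card : ℝ) ≤ n := by
      rw [hYR]
      have : (0 : ℝ) ≤ A.card := Nat.cast_nonneg _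
      linarith
    have hN''n : N'' ≤ n := by
      rw [hrR]
      have : (0 : ℝ) ≤ A'.card := Nat.cast_nonneg _
      linarith
    have hN''0 : 0 ≤ N'' := Nat.cast_nonneg _
    -- Both weight bounds meet here: heavy tiles from below, `L |M| + 4 |Y|` from above; the 1 in 4m
    -- + 1 pays for replacing L - 1 by L.
    have h4 : L * ((1 - ρ) * N'' - m * M₀.card) ≤ (4 * m + 1) * n := by
      have h5 : (1 - ρ) * N'' ≤ n :=
        (mul_le_of_le_one_left hN''0 (by linarith)).trans hN''n
      have h6 : m * (4 * (Y.card : ℝ)) ≤ m * (4 * n) := by gcongr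
      have h8 : L * ((1 - ρ) * N'' - m * M₀.card) = ((L : ℝ) - 1) * ((1 - ρ) * N'') +
        (1 - ρ) * N'' - m * (L * M₀.card) := by ring
      linarith only [h2, h5, h6, h8]
    have h7 : (1 - ρ) * N'' - m * M₀.card ≤ ε / 4 * n := by
      have h8 : (1 - ρ) * N'' - m * M₀.card ≤ (4 * m + 1) / L * n := by
        rw [div_mul_eq_mul_div, le_div_iff₀ hL0]
        linarith
      exact h8.trans (mul_le_mul_of_nonneg_right hLε hn0.le)
    have h9 : ρ * N'' ≤ ρ * n := by gcongr
    have h10 : ε' * n ≤ ε / 4 * n := by gcongr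
    have h11 : 0 < ε * n := by positivity
    linarith

end MDigraph

end AlmostPerfect

/-! ### Greedy choice of a disjoint family by an exponential potential. -/

section GreedyFamily

open Finset

open Classical in
/-- A disjoint family that is absorbing for many members simultaneously, chosen greedily with respect
to an exponential potential. -/
theorem exists_disjoint_family {Ω J V : Type*} [Fintype Ω] [Nonempty Ω] [Fintype J]
    (W : Ω → Finset V) (Abs : Ω → J → Prop) (n β : ℝ) (w : ℕ) (hn : 0 < n) (hβ : β ≤ 1)
    (hW : ∀ ω, (W ω).card ≤ w) (hne : ∀ ω j, Abs ω j → (W ω).Nonempty)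
    (hv : ∀ v, ((univ.filter fun ω => v ∈ W ω).card : ℝ) * n ≤ w * Fintype.card Ω)
    (hA : ∀ j, β * Fintype.card Ω ≤ ((univ.filter fun ω => Abs ω j).card : ℝ))
    (N : ℕ) (hN : (w : ℝ) * w * N ≤ β / 2 * n) :
    ∃ F : Finset Ω, F.card ≤ N ∧ (∀ ω ∈ F, ∃ j, Abs ω j) ∧
      (∀ ω ∈ F, ∀ ω' ∈ F, ω ≠ ω' → Disjoint (W ω) (W ω')) ∧
      ∑ j, (1 / 2 : ℝ) ^ (F.filter fun ω => Abs ω j).card ≤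
        Fintype.card J * (1 - β / 4) ^ N := by
  have hΩ : (0 : ℝ) < Fintype.card Ω := by exact_mod_cast Fintype.card_pos
  suffices h : ∀ k ≤ N, ∃ F : Finset Ω, F.card ≤ k ∧ (∀ ω ∈ F, ∃ j, Abs ω j) ∧
      (∀ ω ∈ F, ∀ ω' ∈ F, ω ≠ ω' → Disjoint (W ω) (W ω')) ∧
      ∑ j, (1 / 2 : ℝ) ^ (F.filter fun ω => Abs ω j).card ≤
        Fintype.card J * (1 - β / 4) ^ k from h N le_rfl
  intro k
  induction k with
  | zero =>
    intro _
    exact ⟨∅, by simp, by simp, by simp, by simp⟩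
  | succ k ih =>
    intro hk
    obtain ⟨F, hFk, hFA, hFd, hFp⟩ := ih (by omega)
    set Used := F.biUnion W with hUsed
    have hUc : (Used.card : ℝ) ≤ w * N := by
      have h1 : Used.card ≤ F.card * w := card_biUnion_le_card_mul _ _ _ fun ω _ => hW ω
      have h2 : F.card * w ≤ N * w := Nat.mul_le_mul_right _ (by omega)
      have h3 : ((Used.card : ℕ) : ℝ) ≤ ((N * w : ℕ) : ℝ) := by exact_mod_cast h1.trans h2
      push_cast at h3
      linarith
    -- The used vertices spoil at most a β/2-fraction of all ω, so each `j` keeps at least a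
    -- β/2-fraction of good ones.
    set Good := univ.filter fun ω => Disjoint (W ω) Used ∧ ∃ j, Abs ω j with hGood
    have hmeet : ((univ.filter fun ω => ¬ Disjoint (W ω) Used).card : ℝ) ≤
        β / 2 * Fintype.card Ω := by
      have h1 : (univ.filter fun ω => ¬ Disjoint (W ω) Used) ⊆
          Used.biUnion fun v => univ.filter fun ω => v ∈ W ω := by
        intro ω hω
        obtain ⟨v, hv1, hv2⟩ := not_disjoint_iff.1 (mem_filter.1 hω).2
        exact mem_biUnion.2 ⟨v, hv2, mem_filter.2 ⟨mem_univ _, hv1⟩⟩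
      have h2 : ((univ.filter fun ω => ¬ Disjoint (W ω) Used).card : ℝ) ≤
          ∑ v ∈ Used, ((univ.filter fun ω => v ∈ W ω).card : ℝ) := by
        exact_mod_cast (card_le_card h1).trans card_biUnion_le
      have h3 : (∑ v ∈ Used, ((univ.filter fun ω => v ∈ W ω).card : ℝ)) * n ≤
          Used.card * (w * Fintype.card Ω) := by
        rw [sum_mul, ← nsmul_eq_mul, ← sum_const]
        exact sum_le_sum fun v _ => hv v
      have h4 : (Used.card : ℝ) * (w * Fintype.card Ω) ≤ (β / 2 * Fintype.card Ω) * n := by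
        calc (Used.card : ℝ) * (w * Fintype.card Ω) ≤ (w * N) * (w * Fintype.card Ω) := by gcongr
          _ = (w * w * N) * Fintype.card Ω := by ring
          _ ≤ (β / 2 * n) * Fintype.card Ω := by gcongr
          _ = _ := by ring
      exact h2.trans (le_of_mul_le_mul_right (h3.trans h4) hn)
    have hgood : ∀ j, β / 2 * Fintype.card Ω ≤ ((Good.filter fun ω => Abs ω j).card : ℝ) := by
      intro j
      have h1 : (univ.filter fun ω => Abs ω j) ⊆ (Good.filter fun ω => Abs ω j) ∪
          univ.filter fun ω => ¬ Disjoint (W ω) Used := by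
        intro ω hω
        have hω := (mem_filter.1 hω).2
        rw [mem_union]
        by_cases h : Disjoint (W ω) Used
        · exact Or.inl (mem_filter.2 ⟨mem_filter.2 ⟨mem_univ _, h, j, hω⟩, hω⟩)
        · exact Or.inr (mem_filter.2 ⟨mem_univ _, h⟩)
      have h2 : ((univ.filter fun ω => Abs ω j).card : ℝ) ≤
          (Good.filter fun ω => Abs ω j).card +
            (univ.filter fun ω => ¬ Disjoint (W ω) Used).card := by
        exact_mod_cast (card_le_card h1).trans (card_union_le _ _)
      have h3 := hA j
      linarith
    have hnotF : ∀ ω ∈ Good, ω ∉ F := by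
      intro ω hω hF
      obtain ⟨-, h1, j, hj⟩ := mem_filter.1 hω
      obtain ⟨v, hv⟩ := hne ω j hj
      exact disjoint_left.1 h1 hv (mem_biUnion.2 ⟨ω, hF, hv⟩)
    -- An unsuitable ω leaves the family unchanged, which allows averaging over all of Ω. A good ω
    -- that absorbs `j` halves the `j`-th term, so the mean potential shrinks by the factor 1 - β/4.
    set F' : Ω → Finset Ω := fun ω => if ω ∈ Good then insert ω F else F with hF'
    have hpot : ∀ ω j, (1 / 2 : ℝ) ^ ((F' ω).filter fun ω => Abs ω j).card =
        (1 / 2 : ℝ) ^ (F.filter fun ω => Abs ω j).card *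
          (1 - if ω ∈ Good.filter (fun ω => Abs ω j) then 1 / 2 else 0) := by
      intro ω j
      by_cases h : ω ∈ Good
      · by_cases h' : Abs ω j
        · have h1 : ω ∉ F.filter fun ω => Abs ω j := fun h2 => hnotF ω h (mem_filter.1 h2).1
          simp only [hF', h, if_true, filter_insert, h', card_insert_of_notMem h1, mem_filter,
            and_self, pow_succ]
          ring
        · simp only [hF', h, if_true, filter_insert, h', mem_filter, and_false, if_false,
            sub_zero, mul_one]
      · simp only [hF', h, mem_filter, false_and, if_false, sub_zero, mul_one]
    have hsum : ∑ ω, ∑ j, (1 / 2 : ℝ) ^ ((F' ω).filter fun ω => Abs ω j).card ≤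
        ∑ _ω : Ω, (1 - β / 4) * ∑ j, (1 / 2 : ℝ) ^ (F.filter fun ω => Abs ω j).card := by
      rw [sum_comm, sum_const, card_univ, nsmul_eq_mul, mul_sum, mul_sum]
      refine sum_le_sum fun j _ => ?_
      simp_rw [hpot]
      rw [← mul_sum, sum_sub_distrib, ← sum_filter, sum_const, sum_const, card_univ, nsmul_one,
        filter_mem_eq_inter, univ_inter, nsmul_eq_mul]
      have h1 := hgood j
      have h2 : (0 : ℝ) < (1 / 2 : ℝ) ^ (F.filter fun ω => Abs ω j).card := by positivity
      calc _ ≤ (1 / 2 : ℝ) ^ (F.filter fun ω => Abs ω j).card *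
            (Fintype.card Ω * (1 - β / 4)) := by
            refine mul_le_mul_of_nonneg_left ?_ h2.le
            linarith
        _ = _ := by ring
    obtain ⟨ω, -, hω⟩ := exists_le_of_sum_le univ_nonempty hsum
    refine ⟨F' ω, ?_, ?_, ?_, ?_⟩
    · simp only [hF']
      split_ifs
      · exact (card_insert_le _ _).trans (by omega)
      · omega
    · intro ω' hω'
      simp only [hF'] at hω'
      split_ifs at hω' with h
      · rcases mem_insert.1 hω' with rfl | h'
        exacts [(mem_filter.1 h).2.2, hFA _ h']
      · exact hFA _ hω'
    · simp only [hF']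
      split_ifs with h
      · have h1 : ∀ ω' ∈ F, Disjoint (W ω) (W ω') := fun ω' hω' =>
          (mem_filter.1 h).2.1.mono_right (subset_biUnion_of_mem W hω')
        intro a ha b hb hab
        rcases mem_insert.1 ha with ha | ha <;> rcases mem_insert.1 hb with hb | hb
        · exact absurd (ha.trans hb.symm) hab
        · rw [ha]; exact h1 b hb
        · rw [hb]; exact (h1 a ha).symm
        · exact hFd a ha b hb hab
      · exact hFd
    · refine hω.trans ?_
      rw [pow_succ]
      calc (1 - β / 4) * ∑ j, (1 / 2 : ℝ) ^ (F.filter fun ω => Abs ω j).card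
          ≤ (1 - β / 4) * (Fintype.card J * (1 - β / 4) ^ k) :=
            mul_le_mul_of_nonneg_left hFp (by linarith)
        _ = _ := by ring

end GreedyFamily

/-! ### Integer combinations of edge patterns. -/

section PatternLattice

open Finset

namespace MDigraph

variable {m : ℕ}

/-- The number of times that the vertex `i` is covered by a list of tuples. -/
noncomputable def load {ι : Type*} (Ls : List (Fin m → ι)) (i : ι) : ℕ := (Ls.map (multi i)).sum

theorem load_append {ι : Type*} (Ls Ls' : List (Fin m → ι)) (i : ι) :
    load (Ls ++ Ls') i = load Ls i + load Ls' i := by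
  simp [load]

theorem multi_comp_of_injective {ι κ : Type*} {f : ι → κ} (hf : Function.Injective f) (i : ι)
    (e : Fin m → ι) : multi (f i) (f ∘ e) = multi i e := by
  classical
  unfold multi
  congr 1
  ext j
  simp [hf.eq_iff]

theorem multi_eq_zero {ι : Type*} {i : ι} {e : Fin m → ι} (h : ∀ j, e j ≠ i) : multi i e = 0 := by
  by_contra h'
  obtain ⟨j, hj⟩ := multi_pos_iff.1 (Nat.pos_of_ne_zero h')
  exact h j hj

theorem load_map_comp {ι κ : Type*} {f : ι → κ} (hf : Function.Injective f)
    (Ls : List (Fin m → ι)) (i : ι) : load (Ls.map fun e => f ∘ e) (f i) = load Ls i := by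
  simp only [load, List.map_map]
  congr 1
  exact List.map_congr_left fun e _ => multi_comp_of_injective hf i e

theorem load_eq_zero {ι : Type*} {i : ι} {Ls : List (Fin m → ι)} (h : ∀ e ∈ Ls, ∀ j, e j ≠ i) :
    load Ls i = 0 := by
  simp only [load, List.sum_eq_zero_iff, List.mem_map]
  rintro _ ⟨e, he, rfl⟩
  exact multi_eq_zero (h e he)

/-- The lattice generated by a set of tuples. -/
def patternLattice {ι : Type*} (D : Set (Fin m → ι)) : AddSubgroup (ι → ℤ) :=
  AddSubgroup.closure ((fun e i => (multi i e : ℤ)) '' D)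

theorem exists_lists_of_mem_patternLattice {ι : Type*} {D : Set (Fin m → ι)} {x : ι → ℤ}
    (hx : x ∈ patternLattice D) :
    ∃ P N : List (Fin m → ι), (∀ e ∈ P, e ∈ D) ∧ (∀ e ∈ N, e ∈ D) ∧
      ∀ i, x i = load P i - load N i := by
  induction hx using AddSubgroup.closure_induction with
  | mem x hx =>
    obtain ⟨e, he, rfl⟩ := hx
    exact ⟨[e], [], by simpa using he, by simp, fun i => by simp [load]⟩
  | zero => exact ⟨[], [], by simp, by simp, fun i => by simp [load]⟩
  | add x y _ _ hx hy =>
    obtain ⟨P, N, hP, hN, h⟩ := hx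
    obtain ⟨P', N', hP', hN', h'⟩ := hy
    refine ⟨P ++ P', N ++ N', fun e he => ?_, fun e he => ?_, fun i => ?_⟩
    · exact (List.mem_append.1 he).elim (hP e) (hP' e)
    · exact (List.mem_append.1 he).elim (hN e) (hN' e)
    · rw [Pi.add_apply, h, h', load_append, load_append]; push_cast; ring
  | neg x _ hx =>
    obtain ⟨P, N, hP, hN, h⟩ := hx
    exact ⟨N, P, hN, hP, fun i => by rw [Pi.neg_apply, h]; ring⟩

open Classical in
-- Subtracting a multiple of one edge vector leaves coordinate sum 0, and a vector of sum 0 is an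
-- integer combination of transferrals to a fixed index.
theorem mem_patternLattice_of_dvd_sum {ι : Type*} [Fintype ι] {D : Set (Fin m → ι)}
    (hD : ∀ a b : ι, (Pi.single a 1 - Pi.single b 1 : ι → ℤ) ∈ patternLattice D)
    {e : Fin m → ι} (he : e ∈ D) (x : ι → ℤ) (hx : (m : ℤ) ∣ ∑ i, x i) :
    x ∈ patternLattice D := by
  obtain ⟨k, hk⟩ := hx
  rcases isEmpty_or_nonempty ι with h | ⟨⟨a⟩⟩
  · rw [show x = 0 from funext fun i => isEmptyElim i]
    exact zero_mem _
  have he' : (fun i => (multi i e : ℤ)) ∈ patternLattice D :=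
    AddSubgroup.subset_closure ⟨e, he, rfl⟩
  set y : ι → ℤ := fun i => x i - k * multi i e with hy
  have hy0 : ∑ i, y i = 0 := by
    have h1 : ∑ i, (multi i e : ℤ) = m := by exact_mod_cast sum_multi e
    rw [hy, sum_sub_distrib, ← mul_sum, h1, hk]
    ring
  have hxy : x = (∑ i, y i • (Pi.single i 1 - Pi.single a 1 : ι → ℤ)) +
      k • fun i => (multi i e : ℤ) := by
    funext j
    have h1 : (∑ i, y i • (Pi.single i 1 - Pi.single a 1 : ι → ℤ)) j = y j := by
      rw [Finset.sum_apply]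
      have h2 : ∀ i, (y i • (Pi.single i 1 - Pi.single a 1 : ι → ℤ)) j =
          (if j = i then y i else 0) - y i * (Pi.single a 1 : ι → ℤ) j := by
        intro i
        rw [Pi.smul_apply, Pi.sub_apply, smul_eq_mul, mul_sub, Pi.single_apply, mul_ite, mul_one,
          mul_zero]
      rw [sum_congr rfl fun i _ => h2 i, sum_sub_distrib, ← sum_mul, hy0]
      simp
    rw [Pi.add_apply, h1, Pi.smul_apply, smul_eq_mul, hy]
    ring
  rw [hxy]
  exact add_mem (sum_mem fun i _ => zsmul_mem (hD i a) _) (zsmul_mem he' k)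

open Classical in
/-- The conditions on a set of patterns on `ι` and `m` further vertices under which the latter can
be absorbed. -/
def Absorbable {ι : Type*} (D : Set (Fin m → ι ⊕ Fin m)) : Prop :=
  (∀ a b : ι, (Pi.single a 1 - Pi.single b 1 : ι → ℤ) ∈
    patternLattice {e : Fin m → ι | Sum.inl ∘ e ∈ D}) ∧
  (∃ e : Fin m → ι, Sum.inl ∘ e ∈ D) ∧
  ∀ i : Fin m, ∃ e ∈ D, ∀ k : Fin m, multi (Sum.inr k) e = if k = i then 1 else 0

/-- Take for each of the `m` outer vertices an edge through it alone, once. Their total load on `ι`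
is m(m-1), a multiple of m, hence a difference of the loads of two lists `P` and `N` on `ι`. Then
`P` balances the covering edges together with `N`. -/
theorem Absorbable.exists_lists {ι : Type*} [Fintype ι] (hm : 2 ≤ m)
    {D : Set (Fin m → ι ⊕ Fin m)} (hD : Absorbable D) :
    ∃ P Q : List (Fin m → ι ⊕ Fin m), (∀ e ∈ P, e ∈ D) ∧ (∀ e ∈ Q, e ∈ D) ∧
      (∀ k : ι, load P (Sum.inl k) = load Q (Sum.inl k)) ∧
      (∀ i : Fin m, load P (Sum.inr i) = 0) ∧ (∀ i : Fin m, load Q (Sum.inr i) = 1) ∧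
      ∃ k : ι, 0 < load P (Sum.inl k) := by
  classical
  obtain ⟨hlat, ⟨e₀, he₀⟩, hcov⟩ := hD
  choose J hJD hJ using hcov
  set x : ι → ℤ := fun k => ∑ i, (multi (Sum.inl k) (J i) : ℤ) with hx
  have hJsum : ∀ i, ∑ k : ι, multi (Sum.inl k) (J i) + 1 = m := by
    intro i
    have h1 := sum_multi (J i)
    rw [Fintype.sum_sum_type] at h1
    simp only [hJ] at h1
    simpa using h1
  have hxsum : ∑ k, x k = m * (m - 1) := by
    rw [hx, sum_comm]
    have h1 : ∀ i, ∑ k : ι, (multi (Sum.inl k) (J i) : ℤ) = m - 1 := by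
      intro i
      have := hJsum i
      have h2 : ((∑ k : ι, multi (Sum.inl k) (J i) + 1 : ℕ) : ℤ) = m := by rw [this]
      push_cast at h2
      linarith
    simp [h1]
    ring
  obtain ⟨P, N, hP, hN, hPN⟩ := exists_lists_of_mem_patternLattice
    (mem_patternLattice_of_dvd_sum (D := {e : Fin m → ι | Sum.inl ∘ e ∈ D})
      (fun a b => by convert hlat a b) he₀ x ⟨_, hxsum⟩)
  have hinl : Function.Injective (Sum.inl : ι → ι ⊕ Fin m) := Sum.inl_injective
  have hload : ∀ k : ι, load P k = ∑ i, multi (Sum.inl k) (J i) + load N k := by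
    intro k
    have h1 := hPN k
    simp only [hx] at h1
    have h2 : (load P k : ℤ) = ((∑ i, multi (Sum.inl k) (J i) + load N k : ℕ) : ℤ) := by
      push_cast; linarith
    exact_mod_cast h2
  refine ⟨P.map fun e => Sum.inl ∘ e, List.ofFn J ++ N.map fun e => Sum.inl ∘ e, ?_, ?_, ?_, ?_,
    ?_, ?_⟩
  · intro e he
    obtain ⟨f, hf, rfl⟩ := List.mem_map.1 he
    exact hP f hf
  · intro e he
    rcases List.mem_append.1 he with he | he
    · obtain ⟨i, rfl⟩ := (List.mem_ofFn' J e).1 he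
      exact hJD i
    · obtain ⟨f, hf, rfl⟩ := List.mem_map.1 he
      exact hN f hf
  · intro k
    rw [load_map_comp hinl, load_append, load_map_comp hinl, hload]
    congr 1
    simp [load, List.map_ofFn, List.sum_ofFn]
  · intro i
    refine load_eq_zero fun e he j => ?_
    obtain ⟨f, hf, rfl⟩ := List.mem_map.1 he
    exact Sum.inl_ne_inr
  · intro i
    rw [load_append, load_eq_zero (Ls := N.map fun e => Sum.inl ∘ e)]
    · simp [load, List.map_ofFn, List.sum_ofFn, hJ]
    · intro e he j
      obtain ⟨f, hf, rfl⟩ := List.mem_map.1 he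
      exact Sum.inl_ne_inr
  · have h1 : 0 < ∑ k : ι, multi (Sum.inl k) (J ⟨0, by omega⟩) := by
      have := hJsum ⟨0, by omega⟩
      omega
    obtain ⟨k, -, hk⟩ := exists_ne_zero_of_sum_ne_zero h1.ne'
    refine ⟨k, ?_⟩
    rw [load_map_comp hinl, hload]
    have h2 := single_le_sum (f := fun i => multi (Sum.inl k) (J i))
      (fun _ _ => Nat.zero_le _) (mem_univ ⟨0, by omega⟩)
    omega

/-- A uniform bound for the lists of all absorbable sets of patterns. -/
theorem exists_absorber_bound {ι : Type*} [Fintype ι] (hm : 2 ≤ m) :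
    ∃ b : ℕ, 0 < b ∧ ∀ D : Set (Fin m → ι ⊕ Fin m), Absorbable D →
      ∃ P Q : List (Fin m → ι ⊕ Fin m), (∀ e ∈ P, e ∈ D) ∧ (∀ e ∈ Q, e ∈ D) ∧
      (∀ k : ι, load P (Sum.inl k) = load Q (Sum.inl k)) ∧
      (∀ i : Fin m, load P (Sum.inr i) = 0) ∧ (∀ i : Fin m, load Q (Sum.inr i) = 1) ∧
      (∃ k : ι, 0 < load P (Sum.inl k)) ∧ ∀ k : ι, load P (Sum.inl k) ≤ b := by
  classical
  have h : ∀ D : Set (Fin m → ι ⊕ Fin m), ∃ b : ℕ, Absorbable D →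
      ∃ P Q : List (Fin m → ι ⊕ Fin m), (∀ e ∈ P, e ∈ D) ∧ (∀ e ∈ Q, e ∈ D) ∧
      (∀ k : ι, load P (Sum.inl k) = load Q (Sum.inl k)) ∧
      (∀ i : Fin m, load P (Sum.inr i) = 0) ∧ (∀ i : Fin m, load Q (Sum.inr i) = 1) ∧
      (∃ k : ι, 0 < load P (Sum.inl k)) ∧ ∀ k : ι, load P (Sum.inl k) ≤ b := by
    intro D
    by_cases hD : Absorbable D
    · obtain ⟨P, Q, h1, h2, h3, h4, h5, h6⟩ := hD.exists_lists hm
      exact ⟨∑ k : ι, load P (Sum.inl k), fun _ => ⟨P, Q, h1, h2, h3, h4, h5, h6, fun k =>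
        single_le_sum (f := fun k : ι => load P (Sum.inl k)) (fun _ _ => Nat.zero_le _)
          (mem_univ k)⟩⟩
    · exact ⟨0, fun h => absurd h hD⟩
  choose b hb using h
  -- There are only finitely many sets of patterns, so one bound serves all of them.
  refine ⟨∑ D, b D + 1, Nat.succ_pos _, fun D hD => ?_⟩
  obtain ⟨P, Q, h1, h2, h3, h4, h5, h6, h7⟩ := hb D hD
  refine ⟨P, Q, h1, h2, h3, h4, h5, h6, fun k => (h7 k).trans (Nat.le_succ_of_le ?_)⟩
  exact single_le_sum (f := b) (fun _ _ => Nat.zero_le _) (mem_univ D)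

end MDigraph

end PatternLattice

/-! ### Absorbers from systems of links. -/

section Absorbers

open Finset

namespace MDigraph

variable {V : Type*} {m : ℕ}

open Classical in
/-- The transferral from `b` to `a` is in the lattice generated by `D`. -/
def IsTransferral {ι : Type*} (D : Set (Fin m → ι)) (a b : ι) : Prop :=
  (Pi.single a 1 - Pi.single b 1 : ι → ℤ) ∈ patternLattice D

theorem IsTransferral.trans {ι : Type*} {D : Set (Fin m → ι)} {a b c : ι}
    (h : IsTransferral D a b) (h' : IsTransferral D b c) : IsTransferral D a c := by
  unfold IsTransferral at *
  simpa using add_mem h h'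

theorem IsTransferral.symm {ι : Type*} {D : Set (Fin m → ι)} {a b : ι}
    (h : IsTransferral D a b) : IsTransferral D b a := by
  unfold IsTransferral at *
  simpa using neg_mem h

open Classical in
-- Restriction of vectors along `T` is a homomorphism. It maps the lattice of `H[S]` into the
-- pattern lattice, because every edge inside `S` lifts to indices.
theorem isTransferral_of_mem_Div {ι : Type*} {H : MDigraph V m} {T : ι → V}
    (hT : Function.Injective T) (hTH : ∀ i, T i ∈ H.verts) {S : Finset V}
    (hS : ∀ v ∈ S, ∃ i, T i = v) (hD : H.induce S ∈ Div) {a b : ι} (ha : T a ∈ S) (hb : T b ∈ S) :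
    IsTransferral {e : Fin m → ι | T ∘ e ∈ H.edges} a b := by
  unfold IsTransferral
  let φ : (V → ℤ) →+ (ι → ℤ) :=
    { toFun := fun x => x ∘ T, map_zero' := rfl, map_add' := fun _ _ => rfl }
  have hφ : ∀ x ∈ (H.induce S).lattice,
      φ x ∈ patternLattice {e : Fin m → ι | T ∘ e ∈ H.edges} := by
    intro x hx
    have h1 : (H.induce S).lattice ≤
        (patternLattice {e : Fin m → ι | T ∘ e ∈ H.edges}).comap φ := by
      unfold lattice
      rw [AddSubgroup.closure_le]
      rintro _ ⟨e, he, rfl⟩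
      obtain ⟨he, heS⟩ := mem_induce_edges.1 he
      choose f hf using fun j => hS _ (heS j)
      obtain rfl : T ∘ f = e := funext hf
      refine AddSubgroup.subset_closure ⟨f, he, ?_⟩
      funext i
      change (multi i f : ℤ) = (multi (T i) (T ∘ f) : ℤ)
      rw [multi_comp_of_injective hT]
    exact h1 hx
  have h2 := hφ _ (hD (T b) (mem_inter.2 ⟨hTH b, hb⟩) (T a) (mem_inter.2 ⟨hTH a, ha⟩))
  convert h2 using 1
  funext i
  change (Pi.single a 1 - Pi.single b 1 : ι → ℤ) i = (Pi.single (T a) 1 - Pi.single (T b) 1 : V → ℤ) (T i)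
  simp [Pi.single_apply, hT.eq_iff]

/-- The cells of an absorber: a link for each of the `m` vertices to be absorbed, and a common link
for any two vertices of these links. -/
def LinkIndex (m q : ℕ) : Type :=
  (Fin m × Fin q) ⊕ (((Fin m × Fin q) × (Fin m × Fin q)) × Fin q)

instance (m q : ℕ) : Fintype (LinkIndex m q) :=
  inferInstanceAs (Fintype ((Fin m × Fin q) ⊕ (((Fin m × Fin q) × (Fin m × Fin q)) × Fin q)))

instance (m q : ℕ) : DecidableEq (LinkIndex m q) :=
  inferInstanceAs (DecidableEq ((Fin m × Fin q) ⊕ (((Fin m × Fin q) × (Fin m × Fin q)) × Fin q)))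

theorem card_linkIndex (m q : ℕ) :
    Fintype.card (LinkIndex m q) = q * m + q * ((m * q) * (m * q)) := by
  have h : Fintype.card (LinkIndex m q) = Fintype.card
    ((Fin m × Fin q) ⊕ (((Fin m × Fin q) × (Fin m × Fin q)) × Fin q)) := rfl
  rw [h]
  simp only [Fintype.card_sum, Fintype.card_prod, Fintype.card_fin]
  ring

open Classical in
/-- The vertices `z` together with `v` induce a digraph with complete lattice in which every vertex
has multiplicity one in some edge. -/
def IsLink {q : ℕ} (H : MDigraph V m) (z : Fin q → V) (v : V) : Prop :=
  H.induce (insert v (univ.image z)) ∈ (Div ∩ Cov : Set (MDigraph V m))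

/-- A common link of `a` and `b` yields transferrals from its vertices to both, so all indices are
joined. The edge through `U i` provided by Cov has its other entries in the link of `U i`, so it
avoids the other outer vertices. -/
theorem absorbable_of_isLink {q : ℕ} (hm : 0 < m) (hq : 0 < q) {H : MDigraph V m}
    {T : LinkIndex m q → V} {U : Fin m → V} (hTU : Function.Injective (Sum.elim T U))
    (hT : ∀ i, T i ∈ H.verts) (hU : ∀ i, U i ∈ H.verts)
    (hlink : ∀ i, H.IsLink (fun t => T (Sum.inl (i, t))) (U i))
    (hcon : ∀ a b, H.IsLink (fun t => T (Sum.inr ((a, b), t))) (T (Sum.inl a)) ∧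
      H.IsLink (fun t => T (Sum.inr ((a, b), t))) (T (Sum.inl b))) :
    Absorbable {I : Fin m → LinkIndex m q ⊕ Fin m | Sum.elim T U ∘ I ∈ H.edges} := by
  classical
  have hTi : Function.Injective T := by
    have := hTU.comp Sum.inl_injective
    rwa [Sum.elim_comp_inl] at this
  have hset : {e : Fin m → LinkIndex m q | Sum.inl ∘ e ∈
      {I : Fin m → LinkIndex m q ⊕ Fin m | Sum.elim T U ∘ I ∈ H.edges}} =
      {e : Fin m → LinkIndex m q | T ∘ e ∈ H.edges} := by
    ext e
    simp only [Set.mem_ofPred_eq, ← Function.comp_assoc, Sum.elim_comp_inl]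
  refine ⟨?_, ?_, ?_⟩
  · rw [hset]
    have hran : ∀ (z : Fin q → LinkIndex m q) (c : LinkIndex m q),
        ∀ v ∈ insert (T c) (univ.image fun t => T (z t)), ∃ i, T i = v := by
      intro z c v hv
      rcases mem_insert.1 hv with h | h
      · exact ⟨c, h.symm⟩
      · obtain ⟨t, -, ht⟩ := mem_image.1 h
        exact ⟨_, ht⟩
    have h1 : ∀ a b t, IsTransferral {e : Fin m → LinkIndex m q | T ∘ e ∈ H.edges}
        (Sum.inr ((a, b), t)) (Sum.inl a) := fun a b t =>
      isTransferral_of_mem_Div hTi hT (hran _ _) (hcon a b).1.1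
        (mem_insert_of_mem (mem_image_of_mem _ (mem_univ t))) (mem_insert_self _ _)
    have h2 : ∀ a b t, IsTransferral {e : Fin m → LinkIndex m q | T ∘ e ∈ H.edges}
        (Sum.inr ((a, b), t)) (Sum.inl b) := fun a b t =>
      isTransferral_of_mem_Div hTi hT (hran _ _) (hcon a b).2.1
        (mem_insert_of_mem (mem_image_of_mem _ (mem_univ t))) (mem_insert_self _ _)
    have h3 : ∀ a b, IsTransferral {e : Fin m → LinkIndex m q | T ∘ e ∈ H.edges}
        (Sum.inl a) (Sum.inl b) := fun a b =>
      (h1 a b ⟨0, hq⟩).symm.trans (h2 a b ⟨0, hq⟩)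
    rintro (a | ⟨⟨a, a'⟩, t⟩) (b | ⟨⟨b, b'⟩, t'⟩)
    · exact h3 a b
    · exact (h3 a b).trans (h1 _ _ _).symm
    · exact (h1 _ _ _).trans (h3 a b)
    · exact ((h1 _ _ _).trans (h3 a b)).trans (h1 _ _ _).symm
  · let p : Fin m × Fin q := (⟨0, hm⟩, ⟨0, hq⟩)
    obtain ⟨e, he, -⟩ := (hcon p p).1.2 (T (Sum.inl p))
      (mem_inter.2 ⟨hT _, mem_insert_self _ _⟩)
    obtain ⟨he, heS⟩ := mem_induce_edges.1 he
    have h : ∀ j, ∃ i, T i = e j := by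
      intro j
      rcases mem_insert.1 (heS j) with h | h
      · exact ⟨_, h.symm⟩
      · obtain ⟨t, -, ht⟩ := mem_image.1 h
        exact ⟨_, ht⟩
    choose f hf using h
    refine ⟨f, ?_⟩
    obtain rfl : T ∘ f = e := funext hf
    exact he
  · intro i
    obtain ⟨e, he, hei⟩ := (hlink i).2 (U i) (mem_inter.2 ⟨hU _, mem_insert_self _ _⟩)
    obtain ⟨he, heS⟩ := mem_induce_edges.1 he
    have h : ∀ j, ∃ c : LinkIndex m q ⊕ Fin m, (∀ k, c = Sum.inr k → k = i) ∧
        Sum.elim T U c = e j := by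
      intro j
      rcases mem_insert.1 (heS j) with h | h
      · exact ⟨Sum.inr i, fun k hk => (Sum.inr_injective hk).symm, h.symm⟩
      · obtain ⟨t, -, ht⟩ := mem_image.1 h
        exact ⟨Sum.inl (Sum.inl (i, t)), fun k hk => absurd hk Sum.inl_ne_inr, ht⟩
    choose f hfi hf using h
    obtain rfl : Sum.elim T U ∘ f = e := funext hf
    refine ⟨f, he, fun k => ?_⟩
    split_ifs with hk
    · rw [hk, ← multi_comp_of_injective hTU]
      exact hei
    · exact multi_eq_zero fun j hj => hk (hfi j k hj)

/-- The absorber takes from each cell as many vertices as the common load of the two lists. `P` then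
tiles it alone, and `Q` tiles it together with `U`, since the loads on the outer vertices are 0 and
1. -/
theorem tiles_of_blowup {ι : Type*} [Fintype ι] [DecidableEq V] {H : MDigraph V m}
    (hH : H.Fissile) {b : ℕ} (hb : 0 < b) {x : ι × Fin b → V} {U : Fin m → V}
    (hxU : Function.Injective (Sum.elim x U)) {D : Set (Fin m → ι ⊕ Fin m)}
    (hsec : ∀ σ : ι → Fin b, ∀ I ∈ D, Sum.elim (fun i => x (i, σ i)) U ∘ I ∈ H.edges)
    {P Q : List (Fin m → ι ⊕ Fin m)} (hP : ∀ e ∈ P, e ∈ D) (hQ : ∀ e ∈ Q, e ∈ D)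
    (hPQ : ∀ k : ι, load P (Sum.inl k) = load Q (Sum.inl k))
    (hP0 : ∀ i : Fin m, load P (Sum.inr i) = 0) (hQ1 : ∀ i : Fin m, load Q (Sum.inr i) = 1)
    (hPb : ∀ k : ι, load P (Sum.inl k) ≤ b) :
    H.Tiles ((univ.filter fun p : ι × Fin b => (p.2 : ℕ) < load P (Sum.inl p.1)).image x) ∧
    H.Tiles ((univ.filter fun p : ι × Fin b => (p.2 : ℕ) < load P (Sum.inl p.1)).image x ∪
      univ.image U) := by
  classical
  have hxi : Function.Injective x := by
    have := hxU.comp Sum.inl_injective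
    rwa [Sum.elim_comp_inl] at this
  have hUi : Function.Injective U := by
    have := hxU.comp Sum.inr_injective
    rwa [Sum.elim_comp_inr] at this
  have hne : ∀ p i, x p ≠ U i := fun p i h =>
    Sum.inl_ne_inr (hxU (a₁ := Sum.inl p) (a₂ := Sum.inr i) h)
  -- Outer vertices are not blown up: their cells are the singletons `{U i}`.
  let y : (ι ⊕ Fin m) × Fin b → V := fun c => Sum.elim (fun i => x (i, c.2)) U c.1
  let X : ι ⊕ Fin m → Finset V := fun c => univ.image fun k : Fin b => y (c, k)
  have hhom : ∀ I ∈ D, H.Homogeneous X I := by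
    intro I hI
    refine homogeneous_of_transversals H y I hb fun σ => ?_
    have := hsec (fun i => σ (Sum.inl i)) I hI
    convert this using 1
    funext j
    simp only [y, Function.comp_apply]
    rcases I j with i | i <;> rfl
  let C : ι → Finset V := fun k =>
    (univ.filter fun j : Fin b => (j : ℕ) < load P (Sum.inl k)).image fun j => x (k, j)
  have hCcard : ∀ k, (C k).card = load P (Sum.inl k) := by
    intro k
    rw [card_image_of_injective _ fun j j' h => by simpa using hxi h]
    have h1 : (univ.filter fun j : Fin b => (j : ℕ) < load P (Sum.inl k)).card =
        (range (load P (Sum.inl k))).card := by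
      refine card_bij (fun j _ => (j : ℕ)) (fun j hj => by simpa using hj)
        (fun j _ j' _ h => Fin.ext h) fun j hj => ?_
      have hj' := mem_range.1 hj
      exact ⟨⟨j, hj'.trans_le (hPb k)⟩, by simpa using hj', rfl⟩
    rw [h1, card_range]
  have hCX : ∀ k, C k ⊆ X (Sum.inl k) := fun k => image_subset_image (filter_subset _ _)
  have hCC : ∀ k l, k ≠ l → Disjoint (C k) (C l) := by
    intro k l hkl
    rw [disjoint_left]
    intro v hv hv'
    obtain ⟨j, -, rfl⟩ := mem_image.1 hv
    obtain ⟨j', -, hj⟩ := mem_image.1 hv'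
    exact hkl (congrArg Prod.fst (hxi hj)).symm
  have hCU : ∀ k i, Disjoint (C k) {U i} := by
    intro k i
    rw [disjoint_singleton_right]
    intro hv
    obtain ⟨j, -, hj⟩ := mem_image.1 hv
    exact hne _ _ hj
  have hCun : univ.biUnion C =
      (univ.filter fun p : ι × Fin b => (p.2 : ℕ) < load P (Sum.inl p.1)).image x := by
    ext v
    simp only [C, mem_biUnion, mem_univ, true_and, mem_image, mem_filter, Prod.exists]
  constructor
  · have h := hH.tiles_of_list (X := X) P (fun I hI => hhom I (hP I hI))
      (Sum.elim C fun _ => ∅) ?_ ?_ ?_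
    · convert h using 1
      rw [← hCun]
      ext v
      simp
    · rintro (k | i)
      · exact hCX k
      · simp
    · rintro (k | i)
      · exact hCcard k
      · exact card_empty.trans (hP0 i).symm
    · rintro (k | i) (l | i') h <;> simp
      exact hCC k l (by simpa using h)
  · have h := hH.tiles_of_list (X := X) Q (fun I hI => hhom I (hQ I hI))
      (Sum.elim C fun i => {U i}) ?_ ?_ ?_
    · convert h using 1
      rw [← hCun]
      ext v
      simp [eq_comm]
    · rintro (k | i)
      · exact hCX k
      · simp only [Sum.elim_inr, singleton_subset_iff]
        exact mem_image.2 ⟨⟨0, hb⟩, mem_univ _, rfl⟩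
    · rintro (k | i)
      · exact (hCcard k).trans (hPQ k)
      · exact (card_singleton _).trans (hQ1 i).symm
    · rintro (k | i) (l | i') h
      · exact hCC k l (by simpa using h)
      · exact hCU _ _
      · exact (hCU _ _).symm
      · simp only [Sum.elim_inr, disjoint_singleton]
        exact fun h' => h (congrArg Sum.inr (hUi h'))

end MDigraph

end Absorbers

/-! ### The density of links, link systems and absorbers. -/

section LinkCounting

open Finset

/-- The passage from sets to ordered tuples: `q!` times the binomial coefficient is n^q up to a
factor tending to 1, and half of μ absorbs this factor. -/
theorem exists_half_add_mul_pow_le (q : ℕ) (μ : ℝ) (hμ : 0 < μ) :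
    ∃ n₀ : ℕ, ∀ n : ℕ, n₀ ≤ n → (1 / 2 + μ / 2) * (n : ℝ) ^ q ≤
      (1 / 2 + μ) * ((n - 1).choose q : ℝ) * (q.factorial : ℝ) := by
  obtain ⟨n₀, hn₀⟩ := exists_nat_gt ((1 / 2 + μ) * ((q : ℝ) * q) * 2 / μ)
  refine ⟨max n₀ (q + 1), fun n hn => ?_⟩
  have hnq : q + 1 ≤ n := (le_max_right _ _).trans hn
  have hn0 : (0 : ℝ) < n := by exact_mod_cast (by omega : 0 < n)
  have hn1 : (1 / 2 + μ) * ((q : ℝ) * q) * 2 / μ ≤ n :=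
    hn₀.le.trans (by exact_mod_cast (le_max_left _ _).trans hn)
  rw [div_le_iff₀ hμ] at hn1
  have h1 : ((n - q : ℕ) : ℝ) ^ q ≤ ((n - 1).choose q : ℝ) * (q.factorial : ℝ) := by
    have h2 := Nat.pow_sub_le_descFactorial (n - 1) q
    rw [Nat.descFactorial_eq_factorial_mul_choose, Nat.sub_add_cancel (by omega), mul_comm] at h2
    exact_mod_cast h2
  have h2 : (n : ℝ) ^ q * (1 - q * q / n) ≤ ((n - q : ℕ) : ℝ) ^ q := by
    have h3 := one_add_mul_le_pow (a := -((q : ℝ) / n)) (by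
      have : (q : ℝ) / n ≤ 1 := (div_le_one hn0).2 (by exact_mod_cast (by omega : q ≤ n))
      linarith) q
    calc (n : ℝ) ^ q * (1 - q * q / n) = (n : ℝ) ^ q * (1 + q * -((q : ℝ) / n)) := by ring
      _ ≤ (n : ℝ) ^ q * (1 + -((q : ℝ) / n)) ^ q := by gcongr
      _ = ((n - q : ℕ) : ℝ) ^ q := by
        rw [← mul_pow, Nat.cast_sub (by omega)]
        congr 1
        field_simp
        ring
  have h3 : (1 / 2 + μ / 2) ≤ (1 / 2 + μ) * (1 - q * q / n) := by
    have h4 : (1 / 2 + μ) * ((q : ℝ) * q / n) ≤ μ / 2 := by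
      rw [← mul_div_assoc, div_le_iff₀ hn0]
      linarith
    linarith
  calc (1 / 2 + μ / 2) * (n : ℝ) ^ q ≤ (1 / 2 + μ) * (1 - q * q / n) * (n : ℝ) ^ q := by gcongr
    _ = (1 / 2 + μ) * ((n : ℝ) ^ q * (1 - q * q / n)) := by ring
    _ ≤ (1 / 2 + μ) * (((n - 1).choose q : ℝ) * (q.factorial : ℝ)) := by
      exact mul_le_mul_of_nonneg_left (h2.trans h1) (by positivity)
    _ = _ := by ring

/-- Two families that each exceed half of all tuples by μ/2 overlap in a μ-fraction. This is the
only use of the degree 1/2. -/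
theorem mul_pow_le_card_inter {X : Type*} [Fintype X] [DecidableEq X] {q : ℕ} {μ : ℝ}
    {A B : Finset (Fin q → X)} (hA : (1 / 2 + μ / 2) * (Fintype.card X : ℝ) ^ q ≤ A.card)
    (hB : (1 / 2 + μ / 2) * (Fintype.card X : ℝ) ^ q ≤ B.card) :
    μ * (Fintype.card X : ℝ) ^ q ≤ ((A ∩ B).card : ℝ) := by
  have h1 := card_union_add_card_inter A B
  have h2 : (A ∪ B).card ≤ Fintype.card X ^ q := by
    refine (card_le_univ _).trans (le_of_eq ?_)
    rw [Fintype.card_fun, Fintype.card_fin]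
  have h3 : ((A ∪ B).card : ℝ) + (A ∩ B).card = A.card + B.card := by exact_mod_cast h1
  have h4 : ((A ∪ B).card : ℝ) ≤ (Fintype.card X : ℝ) ^ q := by exact_mod_cast h2
  linarith

namespace MDigraph

variable {V : Type*} {m : ℕ}

open Classical in
/-- Every edge of the property graph gives rise to all enumerations of its other vertices. -/
theorem degree_mul_factorial_le_card_isLink (H : MDigraph V m) (q : ℕ) (v : H.verts) :
    (H.propertyGraph (Div ∩ Cov) (q + 1)).degree {(v : V)} * q.factorial ≤
      (univ.filter fun z : Fin q → H.verts => H.IsLink (fun t => (z t : V)) v).card := by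
  rw [UniformHypergraph.degree_singleton]
  set E := (H.propertyGraph (Div ∩ Cov) (q + 1)).edges.filter fun S => (v : V) ∈ S with hE
  set L := univ.filter fun z : Fin q → H.verts => H.IsLink (fun t => (z t : V)) v with hL
  let f : (Fin q → H.verts) → Finset V := fun z => insert (v : V) (univ.image fun t => (z t : V))
  have h1 : ∑ S ∈ E, (L.filter fun z => f z = S).card ≤ L.card := by
    rw [← card_biUnion]
    · exact card_le_card (biUnion_subset.2 fun S _ => filter_subset _ _)
    · intro S _ S' _ hne
      exact disjoint_filter.2 fun z _ h h' => hne (h.symm.trans h')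
  refine le_trans ?_ h1
  rw [← smul_eq_mul]
  refine card_nsmul_le_sum _ _ _ fun S hS => ?_
  obtain ⟨hSE, hvS⟩ := mem_filter.1 hS
  obtain ⟨⟨hSV, hSc⟩, hSQ⟩ := mem_propertyGraph_edges.1 hSE
  have hc : (S.erase v).card = q := by rw [card_erase_of_mem hvS, hSc]; rfl
  have h2 : Fintype.card (Fin q ↪ (S.erase (v : V))) = q.factorial := by
    rw [Fintype.card_embedding_eq, Fintype.card_fin, Fintype.card_coe, hc, Nat.descFactorial_self]
  rw [← h2, ← card_univ]
  refine card_le_card_of_injOn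
    (fun g t => ⟨(g t : V), hSV (mem_of_mem_erase (g t).2)⟩) (fun g _ => ?_) ?_
  · have h3 : (univ.image fun t => (g t : V)) = S.erase v := by
      refine eq_of_subset_of_card_le (fun w hw => ?_) ?_
      · obtain ⟨t, -, rfl⟩ := mem_image.1 hw
        exact (g t).2
      · rw [hc, card_image_of_injective univ (f := fun t => (g t : V))
          (Subtype.val_injective.comp g.injective), card_univ, Fintype.card_fin]
    have h4 : insert (v : V) (univ.image fun t => (g t : V)) = S := by
      rw [h3, insert_erase hvS]
    refine mem_coe.2 (mem_filter.2 ⟨mem_filter.2 ⟨mem_univ _, ?_⟩, h4⟩)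
    unfold IsLink
    convert hSQ
  · intro g _ g' _ h
    refine DFunLike.ext _ _ fun t => Subtype.ext ?_
    exact congrArg (fun w : H.verts => (w : V)) (congrFun h t)

end MDigraph

/-- The number of choices of a link for each of `m` points together with common links for all pairs
of chosen points. -/
theorem card_linkSystems_ge {X : Type*} [Fintype X] [DecidableEq X] {m q : ℕ} (c μ : ℝ)
    (hc : 0 ≤ c) (hμ : 0 ≤ μ)
    (L : X → Finset (Fin q → X)) (hL : ∀ v, c * (Fintype.card X : ℝ) ^ q ≤ (L v).card)
    (hLL : ∀ v w, μ * (Fintype.card X : ℝ) ^ q ≤ ((L v ∩ L w).card : ℝ)) (U : Fin m → X) :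
    c ^ m * μ ^ ((m * q) * (m * q)) * (Fintype.card X : ℝ) ^ Fintype.card (MDigraph.LinkIndex m q) ≤
      ((univ.filter fun T : MDigraph.LinkIndex m q → X =>
        (∀ i, (fun t => T (Sum.inl (i, t))) ∈ L (U i)) ∧
        ∀ a b, (fun t => T (Sum.inr ((a, b), t))) ∈ L (T (Sum.inl a)) ∩ L (T (Sum.inl b))).card
          : ℝ) := by
  classical
  set n : ℝ := (Fintype.card X : ℝ) with hn
  have hn0 : 0 ≤ n := Nat.cast_nonneg _
  let A : Finset (Fin m → Fin q → X) := Fintype.piFinset fun i => L (U i)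
  let B : (Fin m → Fin q → X) → Finset ((Fin m × Fin q) × (Fin m × Fin q) → Fin q → X) := fun z =>
    Fintype.piFinset fun p => L (z p.1.1 p.1.2) ∩ L (z p.2.1 p.2.2)
  have hA : (c * n ^ q) ^ m ≤ (A.card : ℝ) := by
    rw [Fintype.card_piFinset]
    push_cast
    calc (c * n ^ q) ^ m = ∏ _i : Fin m, c * n ^ q := by simp
      _ ≤ _ := prod_le_prod (fun _ _ => by positivity) fun i _ => hL _
  have hB : ∀ z, (μ * n ^ q) ^ ((m * q) * (m * q)) ≤ ((B z).card : ℝ) := by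
    intro z
    rw [Fintype.card_piFinset]
    push_cast
    calc (μ * n ^ q) ^ ((m * q) * (m * q)) =
        ∏ _p : (Fin m × Fin q) × (Fin m × Fin q), μ * n ^ q := by simp
      _ ≤ _ := prod_le_prod (fun _ _ => by positivity) fun p _ => hLL _ _
  have h1 : ((A.sigma B).card : ℝ) ≤ ((univ.filter fun T : MDigraph.LinkIndex m q → X =>
        (∀ i, (fun t => T (Sum.inl (i, t))) ∈ L (U i)) ∧
        ∀ a b, (fun t => T (Sum.inr ((a, b), t))) ∈ L (T (Sum.inl a)) ∩ L (T (Sum.inl b))).card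
          : ℝ) := by
    norm_cast
    refine card_le_card_of_injOn (fun p : Σ _ : (Fin m → Fin q → X),
      ((Fin m × Fin q) × (Fin m × Fin q) → Fin q → X) =>
      Sum.elim (fun c => p.1 c.1 c.2) (fun c => p.2 c.1 c.2)) ?_ ?_
    · intro p hp
      obtain ⟨hp1, hp2⟩ := mem_sigma.1 (mem_coe.1 hp)
      refine mem_coe.2 (mem_filter.2 ⟨mem_univ _, fun i => ?_, fun a b => ?_⟩)
      · exact Fintype.mem_piFinset.1 hp1 i
      · exact Fintype.mem_piFinset.1 hp2 (a, b)
    · rintro ⟨z, y⟩ _ ⟨z', y'⟩ _ h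
      have hz : z = z' := by
        funext i t
        exact congrFun h (Sum.inl (i, t))
      have hy : y = y' := by
        funext p t
        exact congrFun h (Sum.inr (p, t))
      rw [hz, hy]
  refine le_trans ?_ h1
  rw [card_sigma]
  push_cast
  calc c ^ m * μ ^ ((m * q) * (m * q)) * n ^ Fintype.card (MDigraph.LinkIndex m q) =
      (c * n ^ q) ^ m * (μ * n ^ q) ^ ((m * q) * (m * q)) := by
        rw [MDigraph.card_linkIndex, mul_pow, mul_pow, ← pow_mul, ← pow_mul, pow_add]
        ring
    _ ≤ A.card * (μ * n ^ q) ^ ((m * q) * (m * q)) := by gcongr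
    _ = ∑ _z ∈ A, (μ * n ^ q) ^ ((m * q) * (m * q)) := by rw [sum_const, nsmul_eq_mul]
    _ ≤ _ := sum_le_sum fun z _ => hB z



open Classical in
/-- Most functions are injective and avoid a given small set. -/
theorem exists_injective_avoiding_subset {X ι : Type*} [Fintype X] [Nonempty X] [Fintype ι]
    [DecidableEq ι] (G : Finset (ι → X)) (U : Finset X) {γ : ℝ}
    (hG : γ * (Fintype.card X : ℝ) ^ Fintype.card ι ≤ G.card)
    (hX : ((Fintype.card ι : ℝ) ^ 2 + Fintype.card ι * U.card) * 2 ≤ Fintype.card X * γ) :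
    ∃ G' ⊆ G, (∀ T ∈ G', Function.Injective T ∧ ∀ k, T k ∉ U) ∧
      γ / 2 * (Fintype.card X : ℝ) ^ Fintype.card ι ≤ (G'.card : ℝ) := by
  refine ⟨G.filter fun T => Function.Injective T ∧ ∀ k, T k ∉ U, filter_subset _ _,
    fun T hT => (mem_filter.1 hT).2, ?_⟩
  have hn0 : (0 : ℝ) < Fintype.card X := by exact_mod_cast Fintype.card_pos
  have h1 : G ⊆ (G.filter fun T => Function.Injective T ∧ ∀ k, T k ∉ U) ∪
      ((univ.filter fun x : ι → X => ¬ Function.Injective x) ∪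
        univ.filter fun x : ι → X => ∃ i, x i ∈ U) := by
    intro T hT
    simp only [mem_union, mem_filter, mem_univ, true_and]
    by_cases h1 : Function.Injective T <;> by_cases h2 : ∃ k, T k ∈ U
    · exact Or.inr (Or.inr h2)
    · exact Or.inl ⟨hT, h1, fun k hk => h2 ⟨k, hk⟩⟩
    · exact Or.inr (Or.inl h1)
    · exact Or.inr (Or.inl h1)
  have h2 : (G.card : ℝ) ≤ ((G.filter fun T => Function.Injective T ∧ ∀ k, T k ∉ U).card : ℝ) +
      (((univ.filter fun x : ι → X => ¬ Function.Injective x).card : ℝ) +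
        ((univ.filter fun x : ι → X => ∃ i, x i ∈ U).card : ℝ)) := by
    exact_mod_cast (card_le_card h1).trans ((card_union_le _ _).trans
      (Nat.add_le_add_left (card_union_le _ _) _))
  have h3 : ((univ.filter fun x : ι → X => ¬ Function.Injective x).card : ℝ) * Fintype.card X ≤
      (Fintype.card ι : ℝ) ^ 2 * (Fintype.card X : ℝ) ^ Fintype.card ι := by
    have := card_not_injective_mul_le (X := X) (ι := ι)
    have h : ((univ.filter fun x : ι → X => ¬ Function.Injective x).card) * Fintype.card X ≤
      (Fintype.card ι) ^ 2 * (Fintype.card X) ^ Fintype.card ι := by convert this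
    exact_mod_cast h
  have h4 : ((univ.filter fun x : ι → X => ∃ i, x i ∈ U).card : ℝ) * Fintype.card X ≤
      Fintype.card ι * U.card * (Fintype.card X : ℝ) ^ Fintype.card ι := by
    have := card_meet_mul_le (X := X) (ι := ι) U
    have h : ((univ.filter fun x : ι → X => ∃ i, x i ∈ U).card) * Fintype.card X ≤
      Fintype.card ι * U.card * Fintype.card X ^ Fintype.card ι := by convert this
    exact_mod_cast h
  have h5 : ((univ.filter fun x : ι → X => ¬ Function.Injective x).card : ℝ) +
      ((univ.filter fun x : ι → X => ∃ i, x i ∈ U).card : ℝ) ≤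
      γ / 2 * (Fintype.card X : ℝ) ^ Fintype.card ι := by
    refine le_of_mul_le_mul_right ?_ hn0
    calc _ ≤ ((Fintype.card ι : ℝ) ^ 2 + Fintype.card ι * U.card) *
          (Fintype.card X : ℝ) ^ Fintype.card ι := by linarith
      _ ≤ (Fintype.card X * γ / 2) * (Fintype.card X : ℝ) ^ Fintype.card ι :=
          mul_le_mul_of_nonneg_right (by linarith) (by positivity)
      _ = _ := by ring
  linarith

theorem exists_constant_subset {A B : Type*} [Fintype B] [Nonempty B] (s : Finset A)
    (f : A → B) {c : ℝ} (h : c ≤ s.card) :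
    ∃ y, ∃ t ⊆ s, (∀ x ∈ t, f x = y) ∧ c / Fintype.card B ≤ (t.card : ℝ) := by
  classical
  suffices h : ∃ y, c / Fintype.card B ≤ ((s.filter fun x => f x = y).card : ℝ) by
    obtain ⟨y, hy⟩ := h
    exact ⟨y, _, filter_subset _ _, fun x hx => (mem_filter.1 hx).2, hy⟩
  by_contra! h'
  have h1 : (s.card : ℝ) = ∑ y, ((s.filter fun x => f x = y).card : ℝ) := by
    exact_mod_cast card_eq_sum_card_fiberwise fun x _ => mem_coe.2 (mem_univ (f x))
  have h2 : ∑ y, ((s.filter fun x => f x = y).card : ℝ) < ∑ _y : B, c / Fintype.card B :=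
    sum_lt_sum_of_nonempty univ_nonempty fun y _ => h' y
  have h3 : (0 : ℝ) < Fintype.card B := by exact_mod_cast Fintype.card_pos
  rw [sum_const, card_univ, nsmul_eq_mul, mul_div_cancel₀ _ h3.ne'] at h2
  linarith

/-- A dense family of functions contains a dense family of injective blow-ups that avoid a small
set and on whose sections a given colouring is constant. -/
theorem exists_blowups {ι C : Type*} [Fintype ι] [Fintype C] [Nonempty C] (b u : ℕ) (hb : 0 < b)
    (γ : ℝ) (hγ : 0 < γ) :
    ∃ β : ℝ, 0 < β ∧ ∃ n₀ : ℕ, ∀ (X : Type*) [Fintype X] [Nonempty X], n₀ ≤ Fintype.card X →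
      ∀ (U : Finset X), U.card ≤ u → ∀ (c : (ι → X) → C) (G : Finset (ι → X)),
      γ * (Fintype.card X : ℝ) ^ Fintype.card ι ≤ G.card →
      ∃ (D : C) (E : Finset (ι × Fin b → X)),
        β * (Fintype.card X : ℝ) ^ Fintype.card (ι × Fin b) ≤ E.card ∧ E.Nonempty ∧
        ∀ x ∈ E, Function.Injective x ∧ ∀ σ : ι → Fin b, (fun i => x (i, σ i)) ∈ G ∧
          (∀ i, x (i, σ i) ∉ U) ∧ c (fun i => x (i, σ i)) = D := by
  classical
  set Θ : ℝ := (Fintype.card C : ℝ) with hΘ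
  have hΘ0 : 0 < Θ := by
    rw [hΘ]
    exact_mod_cast Fintype.card_pos
  have hγ₁0 : 0 < γ / 2 / Θ := by positivity
  set γ₂ : ℝ := (γ / 2 / Θ) ^ (b ^ Fintype.card ι) with hγ₂
  have hγ₂0 : 0 < γ₂ := by positivity
  obtain ⟨n₁, hn₁⟩ := exists_nat_gt (((Fintype.card ι : ℝ) ^ 2 + Fintype.card ι * u) * 2 / γ)
  obtain ⟨n₂, hn₂⟩ := exists_nat_gt ((Fintype.card (ι × Fin b) : ℝ) ^ 2 * 2 / γ₂)
  -- Non-injective tuples and those meeting `U` cost half of the density, the most frequent colour a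
  -- factor |C|, supersaturation a power, and injectivity of the blow-ups another half.
  refine ⟨γ₂ / 2, by positivity, max n₁ n₂, fun X _ _ hn U hU c G hG => ?_⟩
  have hn0 : (0 : ℝ) < Fintype.card X := by exact_mod_cast Fintype.card_pos
  have hn₁' : ((Fintype.card ι : ℝ) ^ 2 + Fintype.card ι * u) * 2 / γ ≤ Fintype.card X :=
    hn₁.le.trans (by exact_mod_cast (le_max_left _ _).trans hn)
  have hn₂' : (Fintype.card (ι × Fin b) : ℝ) ^ 2 * 2 / γ₂ ≤ Fintype.card X :=
    hn₂.le.trans (by exact_mod_cast (le_max_right _ _).trans hn)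
  rw [div_le_iff₀ hγ] at hn₁'
  rw [div_le_iff₀ hγ₂0] at hn₂'
  obtain ⟨G', hG'G, hG'i, hG'⟩ := exists_injective_avoiding_subset G U hG (by
    refine le_trans ?_ hn₁'
    have : (U.card : ℝ) ≤ u := by exact_mod_cast hU
    gcongr)
  obtain ⟨D, G₁, hG₁G', hG₁D, hG₁⟩ := exists_constant_subset G' c hG'
  rw [← hΘ, mul_div_right_comm] at hG₁
  have hblow := card_blowups_ge_uncurried b hb.ne' G₁ _ hγ₁0.le hG₁
  obtain ⟨E, hE, hEi, hEc⟩ := exists_injective_avoiding_subset _ ∅ hblow (by simpa using hn₂')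
  refine ⟨D, E, hEc, ?_, fun x hx => ⟨(hEi x hx).1, fun σ => ?_⟩⟩
  · rw [← card_pos]
    have : (0 : ℝ) < E.card := lt_of_lt_of_le (by positivity) hEc
    exact_mod_cast this
  · have h := (mem_filter.1 (hE hx)).2 σ
    exact ⟨hG'G (hG₁G' h), (hG'i _ (hG₁G' h)).2, hG₁D _ h⟩

namespace MDigraph

variable {V : Type*} {m : ℕ}

open Classical in
/-- The set `W` can be tiled both on its own and together with the image of `U`. -/
def Absorbs (H : MDigraph V m) (W : Finset V) (U : Fin m → V) : Prop :=
  W.Nonempty ∧ Disjoint W (univ.image U) ∧ H.Tiles W ∧ H.Tiles (W ∪ univ.image U)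

open Classical in
/-- Absorbable systems of positive density yield absorbers of positive density. -/
theorem exists_card_absorbs_ge {ι : Type} [Fintype ι] [Nonempty ι] [DecidableEq ι] (hm : 2 ≤ m)
    (γ : ℝ) (hγ : 0 < γ) :
    ∃ (b : ℕ) (β : ℝ), 0 < β ∧ β ≤ 1 ∧ ∃ n₀ : ℕ, ∀ (V : Type*) (H : MDigraph V m), H.Fissile →
      n₀ ≤ H.verts.card → ∀ U : Fin m → H.verts, Function.Injective U →
      ∀ G : Finset (ι → H.verts), (∀ T ∈ G,
        Function.Injective (Sum.elim (fun k => (T k : V)) fun i => (U i : V)) →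
        Absorbable {I | Sum.elim (fun k => (T k : V)) (fun i => (U i : V)) ∘ I ∈ H.edges}) →
      γ * (H.verts.card : ℝ) ^ Fintype.card ι ≤ G.card →
      β * Fintype.card ((ι × Fin b → H.verts) × Finset (ι × Fin b)) ≤
        ((univ.filter fun ω : (ι × Fin b → H.verts) × Finset (ι × Fin b) =>
          H.Absorbs (ω.2.image fun p => (ω.1 p : V)) fun i => U i).card : ℝ) := by
  obtain ⟨b, hb, hbD⟩ := exists_absorber_bound (ι := ι) hm
  obtain ⟨γ₂, hγ₂0, n₀, hn₀⟩ := exists_blowups (ι := ι) (C := Set (Fin m → ι ⊕ Fin m)) b m hb γ hγ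
  -- An absorber is encoded as a blow-up with a choice of the part that is used; only one of the Φ
  -- parts is counted, which costs this factor.
  set Φ : ℝ := (Fintype.card (Finset (ι × Fin b)) : ℝ) with hΦ
  have hΦ0 : 0 < Φ := by
    rw [hΦ]
    exact_mod_cast Fintype.card_pos
  refine ⟨b, min 1 (γ₂ / Φ), lt_min one_pos (by positivity), min_le_left _ _,
    n₀, fun V H hH hn U hU G hGA hG => ?_⟩
  have : Nonempty H.verts := ⟨U ⟨0, by omega⟩⟩
  -- The colour of a system is the set of all its edge patterns. Since it is constant on the
  -- sections of a blow-up, the lists found for `D` work in every section.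
  obtain ⟨D, E, hEc, ⟨x₀, hx₀⟩, hE⟩ := hn₀ H.verts (by rwa [Fintype.card_coe]) (univ.image U)
    (card_image_le.trans (by simp))
    (fun T => {I | Sum.elim (fun k => (T k : V)) (fun i => (U i : V)) ∘ I ∈ H.edges}) G
    (by rwa [Fintype.card_coe])
  have hxU : ∀ x ∈ E, ∀ p i, x p ≠ U i := fun x hx p i h =>
    ((hE x hx).2 fun _ => p.2).2.1 p.1 (mem_image.2 ⟨i, mem_univ _, h.symm⟩)
  have hinj : ∀ x ∈ E, Function.Injective (Sum.elim (fun p => (x p : V)) fun i => (U i : V)) :=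
    fun x hx => (Subtype.val_injective.comp (hE x hx).1).sumElim (Subtype.val_injective.comp hU)
      fun p i h => hxU x hx p i (Subtype.ext h)
  have hDA : Absorbable D := by
    have h := (hE x₀ hx₀).2 fun _ => ⟨0, hb⟩
    rw [← h.2.2]
    refine hGA _ h.1 ?_
    refine Function.Injective.sumElim ?_ (Subtype.val_injective.comp hU)
      fun k i h => hxU x₀ hx₀ _ i (Subtype.ext h)
    intro k l hkl
    exact congrArg Prod.fst ((hE x₀ hx₀).1 (Subtype.ext hkl))
  obtain ⟨P, Q, hP, hQ, hPQ, hP0, hQ1, ⟨k₀, hk₀⟩, hPb⟩ := hbD D hDA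
  set R : Finset (ι × Fin b) := univ.filter fun p => (p.2 : ℕ) < load P (Sum.inl p.1) with hR
  have habs : ∀ x ∈ E, H.Absorbs (R.image fun p => (x p : V)) fun i => U i := by
    intro x hx
    obtain ⟨ht1, ht2⟩ := tiles_of_blowup hH hb (hinj x hx) (D := D) (fun σ I hI => by
      have h1 := ((hE x hx).2 σ).2.2
      rw [← h1] at hI
      exact hI) hP hQ hPQ hP0 hQ1 hPb
    refine ⟨?_, ?_, ht1, ht2⟩
    · exact Nonempty.image ⟨(k₀, ⟨0, hb⟩), mem_filter.2 ⟨mem_univ _, hk₀⟩⟩ _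
    · rw [disjoint_left]
      intro v hv hv'
      obtain ⟨p, -, rfl⟩ := mem_image.1 hv
      obtain ⟨i, -, hi⟩ := mem_image.1 hv'
      exact hxU x hx p i (Subtype.ext hi.symm)
  have hfin : (E.card : ℝ) ≤ ((univ.filter fun ω : (ι × Fin b → H.verts) × Finset (ι × Fin b) =>
          H.Absorbs (ω.2.image fun p => (ω.1 p : V)) fun i => U i).card : ℝ) := by
    norm_cast
    refine card_le_card_of_injOn (fun x => (x, R)) (fun x hx => ?_) fun x _ y _ h =>
      congrArg Prod.fst h
    exact mem_coe.2 (mem_filter.2 ⟨mem_univ _, habs x hx⟩)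
  refine le_trans ?_ (hEc.trans hfin)
  rw [Fintype.card_prod, Fintype.card_fun, Nat.cast_mul, Nat.cast_pow]
  calc min 1 (γ₂ / Φ) * ((Fintype.card H.verts : ℝ) ^ Fintype.card (ι × Fin b) * Φ) ≤
        γ₂ / Φ * ((Fintype.card H.verts : ℝ) ^ Fintype.card (ι × Fin b) * Φ) :=
        mul_le_mul_of_nonneg_right (min_le_right _ _) (by positivity)
    _ = _ := by field_simp

end MDigraph

end LinkCounting

/-! ### The absorbing set. -/

section AbsorbingSet

open Finset Filter Topology

/-- The left power decays like exp(-βcn/4). Half of this exponent beats n^m, and the other half is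
below the power of 1/2 on the right because e ≥ 2. -/
theorem exists_nat_pow_mul_lt (m : ℕ) (β c : ℝ) (hβ : 0 < β) (hβ1 : β ≤ 1) (hc : 0 < c) :
    ∃ n₀ : ℕ, ∀ n : ℕ, n₀ ≤ n → (n : ℝ) ^ m * (1 - β / 4) ^ ⌊c * n⌋₊ <
      (1 / 2) ^ ⌊β * c / 8 * n⌋₊ := by
  set d : ℝ := β * c / 8 with hd
  have hd0 : 0 < d := by positivity
  have h1 := (Real.tendsto_pow_mul_exp_neg_atTop_nhds_zero m).eventually_lt_const
    (show (0 : ℝ) < d ^ m * Real.exp (-(β / 4)) by positivity)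
  have h2 : Tendsto (fun n : ℕ => d * (n : ℝ)) atTop atTop :=
    tendsto_natCast_atTop_atTop.const_mul_atTop hd0
  obtain ⟨n₀, hn₀⟩ := eventually_atTop.1 (h2.eventually h1)
  refine ⟨n₀, fun n hn => ?_⟩
  have h3 : (n : ℝ) ^ m * Real.exp (-(d * n)) < Real.exp (-(β / 4)) := by
    have := hn₀ n hn
    rw [mul_pow, mul_assoc] at this
    exact lt_of_mul_lt_mul_left this (by positivity)
  have h4 : (1 - β / 4) ^ ⌊c * n⌋₊ ≤ Real.exp (-(2 * d * n)) * Real.exp (β / 4) := by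
    have h5 : c * n ≤ ⌊c * n⌋₊ + 1 := (Nat.lt_floor_add_one _).le
    calc (1 - β / 4) ^ ⌊c * n⌋₊ ≤ (Real.exp (-(β / 4))) ^ ⌊c * n⌋₊ := by
          refine pow_le_pow_left₀ (by linarith) ?_ _
          have := Real.add_one_le_exp (-(β / 4))
          linarith
      _ = Real.exp (⌊c * n⌋₊ * -(β / 4)) := (Real.exp_nat_mul _ _).symm
      _ ≤ Real.exp (-(2 * d * n) + β / 4) := by
          refine Real.exp_le_exp.2 ?_
          have h6 : β / 4 * (c * n) ≤ β / 4 * (⌊c * n⌋₊ + 1) := by gcongr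
          rw [hd]
          linarith
      _ = _ := Real.exp_add _ _
  have h7 : Real.exp (-(d * n)) ≤ (1 / 2) ^ ⌊d * n⌋₊ := by
    have h8 : Real.exp (-1) ≤ 1 / 2 := by
      rw [Real.exp_neg, ← one_div]
      refine one_div_le_one_div_of_le two_pos ?_
      have := Real.add_one_le_exp (1 : ℝ)
      linarith
    calc Real.exp (-(d * n)) ≤ Real.exp (⌊d * n⌋₊ * -1) := by
          refine Real.exp_le_exp.2 ?_
          have := Nat.floor_le (show 0 ≤ d * n by positivity)
          linarith
      _ = Real.exp (-1) ^ ⌊d * n⌋₊ := Real.exp_nat_mul _ _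
      _ ≤ _ := pow_le_pow_left₀ (Real.exp_pos _).le h8 _
  calc (n : ℝ) ^ m * (1 - β / 4) ^ ⌊c * n⌋₊ ≤
        (n : ℝ) ^ m * (Real.exp (-(2 * d * n)) * Real.exp (β / 4)) := by gcongr
    _ = ((n : ℝ) ^ m * Real.exp (-(d * n))) * Real.exp (β / 4) * Real.exp (-(d * n)) := by
        rw [show -(2 * d * (n : ℝ)) = -(d * n) + -(d * n) by ring, Real.exp_add]
        ring
    _ < Real.exp (-(β / 4)) * Real.exp (β / 4) * Real.exp (-(d * n)) := by gcongr
    _ = Real.exp (-(d * n)) := by rw [← Real.exp_add]; simp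
    _ ≤ _ := h7

namespace MDigraph

variable {V : Type*} {m : ℕ}

/-- Under the degree condition, absorbers have positive density. -/
theorem exists_card_absorbs_ge_of_degree (q : ℕ) (hm : 2 ≤ m) (hq : 0 < q) (μ : ℝ) (hμ : 0 < μ) :
    ∃ (b : ℕ) (β : ℝ), 0 < β ∧ β ≤ 1 ∧ ∃ n₀ : ℕ, ∀ (V : Type*) (H : MDigraph V m), H.Fissile →
      n₀ ≤ H.verts.card →
      (1 / 2 + μ) * ((H.verts.card - 1).choose q : ℝ) ≤
        ((H.propertyGraph (Div ∩ Cov) (q + 1)).minDegree 1 : ℝ) →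
      ∀ U : Fin m → H.verts, Function.Injective U →
      ∃ 𝒜 : Finset ((LinkIndex m q × Fin b → H.verts) × Finset (LinkIndex m q × Fin b)),
        β * Fintype.card ((LinkIndex m q × Fin b → H.verts) × Finset (LinkIndex m q × Fin b)) ≤
          𝒜.card ∧
        ∀ ω ∈ 𝒜, ∀ W : Finset V, (∀ v, v ∈ W ↔ ∃ p ∈ ω.2, (ω.1 p : V) = v) →
          H.Absorbs W fun i => U i := by
  classical
  have : Nonempty (LinkIndex m q) := ⟨Sum.inl (⟨0, by omega⟩, ⟨0, hq⟩)⟩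
  obtain ⟨b, β, hβ, hβ1, n₁, hn₁⟩ := exists_card_absorbs_ge (ι := LinkIndex m q) hm
    ((1 / 2) ^ m * μ ^ ((m * q) * (m * q))) (by positivity)
  obtain ⟨n₂, hn₂⟩ := exists_half_add_mul_pow_le q μ hμ
  refine ⟨b, β, hβ, hβ1, max n₁ n₂, fun V H hH hn hdeg U hU => ?_⟩
  let L : H.verts → Finset (Fin q → H.verts) := fun v =>
    univ.filter fun z => H.IsLink (fun t => (z t : V)) v
  have hL : ∀ v, (1 / 2 + μ / 2) * (Fintype.card H.verts : ℝ) ^ q ≤ (L v).card := by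
    intro v
    rw [Fintype.card_coe]
    have h1 := degree_mul_factorial_le_card_isLink H q v
    have h2 := (H.propertyGraph (Div ∩ Cov) (q + 1)).minDegree_le (v := (v : V)) v.2
    calc _ ≤ _ := hn₂ _ ((le_max_right _ _).trans hn)
      _ ≤ ((H.propertyGraph (Div ∩ Cov) (q + 1)).degree {(v : V)} : ℝ) * q.factorial := by
        refine mul_le_mul_of_nonneg_right (hdeg.trans ?_) (by positivity)
        exact_mod_cast h2
      _ ≤ _ := by exact_mod_cast h1
  set G : Finset (LinkIndex m q → H.verts) := univ.filter fun T =>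
    (∀ i, (fun t => T (Sum.inl (i, t))) ∈ L (U i)) ∧
        ∀ a b, (fun t => T (Sum.inr ((a, b), t))) ∈ L (T (Sum.inl a)) ∩ L (T (Sum.inl b)) with hGdef
  have hG : (1 / 2) ^ m * μ ^ ((m * q) * (m * q)) *
      (H.verts.card : ℝ) ^ Fintype.card (LinkIndex m q) ≤ G.card := by
    have h := card_linkSystems_ge (1 / 2) μ (by norm_num) hμ.le L (fun v => le_trans ?_ (hL v))
      (fun v w => mul_pow_le_card_inter (hL v) (hL w)) U
    · rw [Fintype.card_coe] at h
      exact h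
    · have : (0 : ℝ) ≤ (Fintype.card H.verts : ℝ) ^ q := by positivity
      exact mul_le_mul_of_nonneg_right (by linarith) this
  have h := hn₁ V H hH ((le_max_left _ _).trans hn) U hU G (fun T hT hinj => ?_) hG
  · refine ⟨_, h, fun ω hω W hW => ?_⟩
    have h1 := (mem_filter.1 hω).2
    convert h1
    ext v
    rw [hW]
    simp
  · obtain ⟨-, hlink, hcon⟩ := mem_filter.1 hT
    refine absorbable_of_isLink (by omega) hq hinj (fun k => (T k).2) (fun i => (U i).2)
      (fun i => (mem_filter.1 (hlink i)).2) fun a b => ?_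
    obtain ⟨h1, h2⟩ := mem_inter.1 (hcon a b)
    exact ⟨(mem_filter.1 h1).2, (mem_filter.1 h2).2⟩

/-- Disjoint absorbers, of which every `m`-tuple has at least `k`, absorb any set of `m * k`
vertices. -/
theorem tiles_biUnion_union_of_absorbs [DecidableEq V] {H : MDigraph V m} {Ω : Type*}
    (W : Ω → Finset V) (k : ℕ) (F : Finset Ω) (hF : ∀ ω ∈ F, H.Tiles (W ω))
    (hd : ∀ ω ∈ F, ∀ ω' ∈ F, ω ≠ ω' → Disjoint (W ω) (W ω'))
    (habs : ∀ U : Fin m → V, Function.Injective U → (∀ i, U i ∈ H.verts) →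
      ∃ F' ⊆ F, k ≤ F'.card ∧ ∀ ω ∈ F', H.Absorbs (W ω) U)
    (R : Finset V) (hRH : R ⊆ H.verts) (hR : R.card = m * k) (hRF : Disjoint (F.biUnion W) R) :
    H.Tiles (F.biUnion W ∪ R) := by
  classical
  induction k generalizing F R with
  | zero =>
    rw [mul_zero, card_eq_zero] at hR
    rw [hR, union_empty]
    exact Tiles.biUnion F W hF hd
  | succ k ih =>
    obtain ⟨S, hSR, hS⟩ := exists_subset_card_eq (s := R) (n := m) (by rw [hR]; nlinarith)
    let e : Fin m ≃ S := (S.equivFinOfCardEq hS).symm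
    let U : Fin m → V := fun i => e i
    have hU : Function.Injective U := Subtype.val_injective.comp e.injective
    have hUS : univ.image U = S := by
      ext v
      simp only [mem_image, mem_univ, true_and]
      constructor
      · rintro ⟨i, rfl⟩
        exact (e i).2
      · intro hv
        exact ⟨e.symm ⟨v, hv⟩, by simp [U]⟩
    obtain ⟨F', hF'F, hF'k, hF'⟩ := habs U hU fun i => hRH (hSR (e i).2)
    obtain ⟨ω, hω⟩ : F'.Nonempty := card_pos.1 (by omega)
    have h1 : H.Tiles (W ω ∪ S) := by
      have := (hF' ω hω).2.2.2
      rw [← hUS]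
      convert this
    have hωF := hF'F hω
    have hdF : Disjoint (W ω) ((F.erase ω).biUnion W) := by
      rw [disjoint_biUnion_right]
      intro ω' hω'
      exact hd _ hωF _ (mem_of_mem_erase hω') (ne_of_mem_erase hω').symm
    have h2 := ih (F.erase ω) (fun ω' h => hF ω' (mem_of_mem_erase h))
      (fun ω' h ω'' h' => hd ω' (mem_of_mem_erase h) ω'' (mem_of_mem_erase h')) (fun U hU hUH => by
        obtain ⟨F'', hF'', hk, h⟩ := habs U hU hUH
        refine ⟨F''.erase ω, erase_subset_erase _ hF'', ?_, fun ω' h' => h ω' (mem_of_mem_erase h')⟩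
        -- Using up one absorber costs every `m`-tuple at most one of its absorbers.
        have := pred_card_le_card_erase (s := F'') (a := ω)
        omega) (R \ S) (sdiff_subset.trans hRH)
      (by rw [card_sdiff_of_subset hSR, hR, hS, Nat.mul_succ, Nat.add_sub_cancel])
      (disjoint_of_subset_left (biUnion_subset_biUnion_of_subset_left _ (erase_subset _ _))
        (disjoint_of_subset_right sdiff_subset hRF))
    have hWR : Disjoint (W ω) R :=
      disjoint_of_subset_left (subset_biUnion_of_mem W hωF) hRF
    have hER : Disjoint ((F.erase ω).biUnion W) R := disjoint_of_subset_left
      (biUnion_subset_biUnion_of_subset_left _ (erase_subset _ _)) hRF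
    have h3 := h1.union h2 (by
      rw [disjoint_union_left, disjoint_union_right, disjoint_union_right]
      exact ⟨⟨hdF, disjoint_of_subset_right sdiff_subset hWR⟩,
        (disjoint_of_subset_right hSR hER).symm, disjoint_sdiff⟩)
    convert h3 using 1
    rw [← insert_erase hωF, biUnion_insert, erase_insert (notMem_erase _ _),
      union_union_union_comm, union_sdiff_of_subset hSR]

open Classical in
/-- There is a small set of vertices that absorbs all much smaller sets of vertices. -/
theorem exists_absorbing_set (q : ℕ) (hm : 2 ≤ m) (hq : 0 < q) (μ α : ℝ) (hμ : 0 < μ)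
    (hα : 0 < α) :
    ∃ ξ : ℝ, 0 < ξ ∧ ∃ n₀ : ℕ, ∀ (V : Type*) (H : MDigraph V m), H.Fissile →
      n₀ ≤ H.verts.card →
      (1 / 2 + μ) * ((H.verts.card - 1).choose q : ℝ) ≤
        ((H.propertyGraph (Div ∩ Cov) (q + 1)).minDegree 1 : ℝ) →
      ∃ A ⊆ H.verts, (A.card : ℝ) ≤ α * H.verts.card ∧ H.Tiles A ∧
        ∀ R ⊆ H.verts, Disjoint A R → (R.card : ℝ) ≤ ξ * H.verts.card → m ∣ R.card →
          H.Tiles (A ∪ R) := by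
  obtain ⟨b, β, hβ, hβ1, n₁, hn₁⟩ := exists_card_absorbs_ge_of_degree (m := m) q hm hq μ hμ
  set w : ℕ := Fintype.card (LinkIndex m q × Fin b) + 1 with hw
  have hw0 : (0 : ℝ) < w := by
    rw [hw]
    exact_mod_cast Nat.succ_pos _
  -- The first term leaves the greedy choice enough room, the second keeps the union of cn absorbers
  -- of size at most w below αn.
  set c : ℝ := min (β / (2 * (w * w))) (α / w) with hc
  have hc0 : 0 < c := lt_min (by positivity) (by positivity)
  obtain ⟨n₂, hn₂⟩ := exists_nat_pow_mul_lt m β c hβ hβ1 hc0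
  refine ⟨β * c / 8, by positivity, max (max n₁ n₂) m, fun V H hH hn hdeg => ?_⟩
  have hnm : m ≤ H.verts.card := (le_max_right _ _).trans hn
  have hn0 : (0 : ℝ) < H.verts.card := by exact_mod_cast (by omega : 0 < H.verts.card)
  have : Nonempty H.verts := (card_pos.1 (by omega : 0 < H.verts.card)).to_subtype
  let Ω := (LinkIndex m q × Fin b → H.verts) × Finset (LinkIndex m q × Fin b)
  let W : Ω → Finset V := fun ω => ω.2.image fun p => (ω.1 p : V)
  have hWmem : ∀ (ω : Ω) (v : V), v ∈ W ω ↔ ∃ p ∈ ω.2, (ω.1 p : V) = v := fun ω v => mem_image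
  have hWH : ∀ ω, W ω ⊆ H.verts := by
    intro ω v hv
    obtain ⟨p, -, rfl⟩ := (hWmem ω v).1 hv
    exact (ω.1 p).2
  have hWc : ∀ ω, (W ω).card ≤ w := fun ω =>
    card_image_le.trans ((card_le_univ _).trans (Nat.le_succ _))
  let J := {U : Fin m → H.verts // Function.Injective U}
  let Abs : Ω → J → Prop := fun ω U => H.Absorbs (W ω) fun i => U.1 i
  have hv : ∀ v, ((univ.filter fun ω => v ∈ W ω).card : ℝ) * H.verts.card ≤
      w * Fintype.card Ω := by
    intro v
    by_cases hvH : v ∈ H.verts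
    · have h1 : (univ.filter fun ω => v ∈ W ω) ⊆
          (univ.filter fun x : LinkIndex m q × Fin b → H.verts =>
            ∃ p, x p ∈ ({⟨v, hvH⟩} : Finset H.verts)) ×ˢ univ := by
        intro ω hω
        obtain ⟨p, -, hp⟩ := (hWmem ω v).1 (mem_filter.1 hω).2
        exact mem_product.2 ⟨mem_filter.2 ⟨mem_univ _, p, mem_singleton.2 (Subtype.ext hp)⟩,
          mem_univ _⟩
      have h2 := card_meet_mul_le (X := H.verts) (ι := LinkIndex m q × Fin b) {⟨v, hvH⟩}
      rw [card_singleton, mul_one, Fintype.card_coe] at h2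
      have h3 : (univ.filter fun ω => v ∈ W ω).card * H.verts.card ≤ w * Fintype.card Ω := by
        calc (univ.filter fun ω => v ∈ W ω).card * H.verts.card ≤ _ :=
              Nat.mul_le_mul_right _ (card_le_card h1)
          _ = ((univ.filter fun x : LinkIndex m q × Fin b → H.verts =>
                ∃ p, x p ∈ ({⟨v, hvH⟩} : Finset H.verts)).card * H.verts.card) *
                Fintype.card (Finset (LinkIndex m q × Fin b)) := by
              rw [card_product, card_univ]
              ring
          _ ≤ (Fintype.card (LinkIndex m q × Fin b) *
                H.verts.card ^ Fintype.card (LinkIndex m q × Fin b)) *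
                Fintype.card (Finset (LinkIndex m q × Fin b)) := by
              refine Nat.mul_le_mul_right _ (le_trans (le_of_eq ?_) h2)
              congr!
          _ ≤ (w * H.verts.card ^ Fintype.card (LinkIndex m q × Fin b)) *
                Fintype.card (Finset (LinkIndex m q × Fin b)) := by
              gcongr
              exact Nat.le_succ _
          _ = w * Fintype.card Ω := by
              have hΩ : Fintype.card Ω = Fintype.card (LinkIndex m q × Fin b → H.verts) *
                Fintype.card (Finset (LinkIndex m q × Fin b)) := Fintype.card_prod _ _
              rw [hΩ, Fintype.card_fun, Fintype.card_coe, mul_assoc]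
      exact_mod_cast h3
    · have h1 : (univ.filter fun ω => v ∈ W ω) = ∅ :=
        filter_eq_empty_iff.2 fun ω _ h => hvH (hWH ω h)
      rw [h1, card_empty, Nat.cast_zero, zero_mul]
      positivity
  have hA : ∀ j, β * Fintype.card Ω ≤ ((univ.filter fun ω => Abs ω j).card : ℝ) := by
    rintro ⟨U, hU⟩
    obtain ⟨𝒜, h𝒜c, h𝒜⟩ := hn₁ V H hH (((le_max_left _ _).trans (le_max_left _ _)).trans hn)
      hdeg U hU
    refine h𝒜c.trans ?_
    norm_cast
    exact card_le_card fun ω hω => mem_filter.2 ⟨mem_univ _, h𝒜 ω hω _ (hWmem ω)⟩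
  set N := ⌊c * H.verts.card⌋₊ with hN
  have hNle : (N : ℝ) ≤ c * H.verts.card := Nat.floor_le (by positivity)
  have hNw : (w : ℝ) * w * N ≤ β / 2 * H.verts.card := by
    calc (w : ℝ) * w * N ≤ w * w * (c * H.verts.card) := by gcongr
      _ ≤ w * w * (β / (2 * (w * w)) * H.verts.card) := by
          gcongr
          exact min_le_left _ _
      _ = _ := by field_simp
  obtain ⟨F, hFN, hFA, hFd, hFp⟩ := exists_disjoint_family W Abs H.verts.card β w hn0 hβ1 hWc
    (fun ω j h => h.1) hv hA N hNw
  have hFT : ∀ ω ∈ F, H.Tiles (W ω) := by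
    intro ω hω
    obtain ⟨j, hj⟩ := hFA ω hω
    exact hj.2.2.1
  have hJ : (Fintype.card J : ℝ) ≤ (H.verts.card : ℝ) ^ m := by
    have h1 := Fintype.card_subtype_le fun U : Fin m → H.verts => Function.Injective U
    rw [Fintype.card_fun, Fintype.card_fin, Fintype.card_coe] at h1
    exact_mod_cast h1
  have hmany : ∀ j : J, ⌊β * c / 8 * H.verts.card⌋₊ ≤ (F.filter fun ω => Abs ω j).card := by
    intro j
    -- One term of the potential is at most the whole, and the whole is already smaller than
    -- (1/2)^⌊ξn⌋ with ξ = βc/8; so every tuple has the required number of absorbers.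
    have h1 : (1 / 2 : ℝ) ^ (F.filter fun ω => Abs ω j).card <
        (1 / 2) ^ ⌊β * c / 8 * H.verts.card⌋₊ := by
      calc (1 / 2 : ℝ) ^ (F.filter fun ω => Abs ω j).card ≤
            ∑ j, (1 / 2 : ℝ) ^ (F.filter fun ω => Abs ω j).card :=
            single_le_sum (f := fun j => (1 / 2 : ℝ) ^ (F.filter fun ω => Abs ω j).card)
              (fun _ _ => by positivity) (mem_univ j)
        _ ≤ Fintype.card J * (1 - β / 4) ^ N := hFp
        _ ≤ (H.verts.card : ℝ) ^ m * (1 - β / 4) ^ N :=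
            mul_le_mul_of_nonneg_right hJ (pow_nonneg (by linarith) _)
        _ < _ := hn₂ _ (((le_max_right _ _).trans (le_max_left _ _)).trans hn)
    exact ((pow_lt_pow_iff_right_of_lt_one₀ (by norm_num) (by norm_num)).1 h1).le
  refine ⟨F.biUnion W, biUnion_subset.2 fun ω _ => hWH ω, ?_, Tiles.biUnion F W hFT hFd,
    fun R hRH hRd hRc hRm => ?_⟩
  · have h1 : (F.biUnion W).card ≤ F.card * w := card_biUnion_le_card_mul _ _ _ fun ω _ => hWc ω
    have h2 : F.card * w ≤ N * w := Nat.mul_le_mul_right _ hFN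
    calc ((F.biUnion W).card : ℝ) ≤ N * w := by exact_mod_cast h1.trans h2
      _ ≤ (c * H.verts.card) * w := by gcongr
      _ ≤ (α / w * H.verts.card) * w := by
          gcongr
          exact min_le_right _ _
      _ = _ := by field_simp
  · obtain ⟨k, hk⟩ := hRm
    refine tiles_biUnion_union_of_absorbs W k F hFT hFd (fun U hU hUH => ?_) R hRH hk hRd
    refine ⟨F.filter fun ω => Abs ω ⟨fun i => ⟨U i, hUH i⟩, fun i j h =>
      hU (congrArg Subtype.val h)⟩, filter_subset _ _, le_trans ?_ (hmany _),
      fun ω hω => (mem_filter.1 hω).2⟩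
    refine Nat.le_floor (le_trans ?_ hRc)
    rw [hk]
    exact_mod_cast Nat.le_mul_of_pos_left k (by omega)

end MDigraph

end AbsorbingSet

/-! ### Combination of both halves, and uniformity in s. -/

section Main

open Finset

namespace MDigraph

variable {V : Type*} {m : ℕ}

/-- The degree conditions force a perfect matching, if the degrees in `H - A` are measured against
the number of remaining vertices. -/
theorem exists_rho_forall_hasPerfectMatching (m r : ℕ) (hm : 2 ≤ m) (hmr : m ≤ r) (μ α : ℝ)
    (hμ : 0 < μ) (hα : 0 < α) (hα2 : α ≤ 1 / 2) :
    ∃ ρ : ℝ, 0 < ρ ∧ ρ ≤ 1 ∧ ∀ s : ℕ, m ≤ s → ∃ n₀ : ℕ, ∀ (V : Type*) (H : MDigraph V m),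
      n₀ ≤ H.verts.card → m ∣ H.verts.card → H.Fissile →
      (∀ A : Finset V, A ⊆ H.verts → (A.card : ℝ) ≤ α * (H.verts.card : ℝ) →
        (matchingThreshold s + μ) * ((H.verts.card - A.card - 1).choose (s - 1) : ℝ) ≤
          (((H.deleteVerts A).propertyGraph (MDigraph.Spa ρ) s).minDegree 1 : ℝ)) →
      (matchingThreshold r + μ) * ((H.verts.card - 1).choose (r - 1) : ℝ) ≤
        ((H.propertyGraph (MDigraph.Div ∩ MDigraph.Cov) r).minDegree 1 : ℝ) →
      H.HasPerfectMatching := by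
  classical
  obtain ⟨q, rfl⟩ : ∃ q, r = q + 1 := ⟨r - 1, by omega⟩
  obtain ⟨ξ, hξ, n₁, hn₁⟩ := exists_absorbing_set (m := m) q hm (by omega) μ (α / 2) hμ
    (by positivity)
  -- The absorbing capacity ξn is shared: ρ ≤ ξ/2 for the defect of the fractional tilings, and ξ/2
  -- for the error of the almost perfect matching. Since ξ is fixed before s, so is ρ.
  refine ⟨min 1 (ξ / 2), lt_min one_pos (by positivity), min_le_left _ _, fun s hs => ?_⟩
  obtain ⟨n₂, hn₂⟩ := exists_almost_perfect m s (by omega) (by omega) μ α (ξ / 2) hμ hα hα2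
    (by positivity)
  refine ⟨max n₁ n₂, fun V H hn hmn hH hspace hdiv => ?_⟩
  rw [Nat.add_sub_cancel] at hdiv
  obtain ⟨A, hAH, hAc, hAT, hA⟩ := hn₁ V H hH ((le_max_left _ _).trans hn) (le_trans (by
    gcongr
    exact half_le_matchingThreshold (hm.trans hmr)) hdiv)
  obtain ⟨M, hMH, hM, hMA, hMc⟩ := hn₂ V H (min 1 (ξ / 2)) (le_min zero_le_one (by positivity))
    (min_le_left _ _) hH ((le_max_right _ _).trans hn) hspace A hAH hAc
  set T : Finset V := M.biUnion fun e => univ.image e with hT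
  have hTmem : ∀ v, v ∈ T ↔ ∃ e ∈ M, ∃ j, e j = v := by simp [hT]
  have hTT : H.Tiles T := ⟨M, hMH, hM, hTmem⟩
  have hTc : T.card = m * M.card := by
    rw [hT, card_biUnion]
    · rw [sum_const_nat fun e he => by
        rw [card_image_of_injective _ (hM.1 e he), card_univ, Fintype.card_fin], mul_comm]
    · intro e he f hf hef
      refine disjoint_left.2 fun v hv hv' => ?_
      obtain ⟨i, -, rfl⟩ := mem_image.1 hv
      obtain ⟨j, -, hj⟩ := mem_image.1 hv'
      exact hM.2 e he f hf hef i j hj.symm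
  have hTH : T ⊆ H.verts := by
    intro v hv
    obtain ⟨e, he, j, rfl⟩ := (hTmem v).1 hv
    exact H.edge_mem e (hMH he) j
  have hTA : Disjoint T A := by
    refine disjoint_left.2 fun v hv => ?_
    obtain ⟨e, he, j, rfl⟩ := (hTmem v).1 hv
    exact hMA e he j
  have hTAH : T ∪ A ⊆ H.verts := union_subset hTH hAH
  set R := H.verts \ (T ∪ A) with hR
  have hRc : R.card + (m * M.card + A.card) = H.verts.card := by
    rw [← hTc, ← card_union_of_disjoint hTA, hR, card_sdiff_add_card_eq_card hTAH]
  have hRA : Disjoint A R := disjoint_of_subset_left subset_union_right disjoint_sdiff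
  have hRT : Disjoint T R := disjoint_of_subset_left subset_union_left disjoint_sdiff
  have hAR : H.Tiles (A ∪ R) := by
    refine hA R sdiff_subset hRA ?_ ?_
    · have h1 : (R.card : ℝ) + (m * M.card + A.card) = H.verts.card := by exact_mod_cast hRc
      have h2 : (min 1 (ξ / 2) + ξ / 2) * (H.verts.card : ℝ) ≤ ξ * H.verts.card := by
        refine mul_le_mul_of_nonneg_right ?_ (Nat.cast_nonneg _)
        linarith [min_le_right 1 (ξ / 2)]
      linarith
    · rw [← hRc] at hmn
      exact (Nat.dvd_add_left (dvd_add (dvd_mul_right _ _) hAT.card_dvd)).1 hmn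
  refine Tiles.hasPerfectMatching ?_
  have h := hTT.union hAR (disjoint_union_right.2 ⟨hTA, hRT⟩)
  rwa [← union_assoc, hR, union_sdiff_of_subset hTAH] at h

/-- If the degrees in `H - A` are large compared with the order of `H` for all small sets `A`, then
the uniformity of the property graph is bounded. -/
theorem exists_uniformity_bound (α : ℝ) (hα : 0 < α) (hα2 : α ≤ 1 / 2) :
    ∃ S n₀ : ℕ, ∀ (V : Type*) (m : ℕ) (H : MDigraph V m) (Q : Set (MDigraph V m)) (s : ℕ),
      2 ≤ s → s ≤ H.verts.card → n₀ ≤ H.verts.card →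
      (∀ A : Finset V, A ⊆ H.verts → (A.card : ℝ) ≤ α * (H.verts.card : ℝ) →
        1 / 2 * ((H.verts.card - 1).choose (s - 1) : ℝ) ≤
          (((H.deleteVerts A).propertyGraph Q s).minDegree 1 : ℝ)) → s ≤ S := by
  classical
  -- Deleting about αn vertices shrinks the largest possible degree by a factor of at most (1 -
  -- α/2)^(s-1). This factor cannot be below 1/2, so s ≤ k.
  obtain ⟨k, hk⟩ := exists_pow_lt_of_lt_one (show (0 : ℝ) < 1 / 2 by norm_num)
    (show 1 - α / 2 < 1 by linarith)
  obtain ⟨n₁, hn₁⟩ := exists_nat_gt (2 / α)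
  refine ⟨k, max n₁ 2, fun V m H Q s hs hsn hn hdeg => ?_⟩
  set n := H.verts.card with hnn
  have hn2 : 2 ≤ n := (le_max_right _ _).trans hn
  have hn1 : 2 / α ≤ n := hn₁.le.trans (by exact_mod_cast (le_max_left _ _).trans hn)
  rw [div_le_iff₀ hα] at hn1
  have hfl : (⌊α * n⌋₊ : ℝ) ≤ α * n := Nat.floor_le (by positivity)
  have hn2' : (2 : ℝ) ≤ n := by exact_mod_cast hn2
  have haln : α * n ≤ 1 / 2 * n := by gcongr
  have hflr : (⌊α * n⌋₊ : ℝ) ≤ n - 1 := by linarith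
  have hfln : ⌊α * n⌋₊ + 1 ≤ n := by
    have : ((⌊α * n⌋₊ + 1 : ℕ) : ℝ) ≤ n := by push_cast; linarith
    exact_mod_cast this
  obtain ⟨A, hAH, hAc⟩ := exists_subset_card_eq (s := H.verts) (n := ⌊α * n⌋₊) (by omega)
  have h1 := hdeg A hAH (by rw [hAc]; exact hfl)
  have hverts : (H.deleteVerts A).verts.card = n - ⌊α * n⌋₊ := by
    rw [deleteVerts_verts, card_sdiff_of_subset hAH, hAc]
  obtain ⟨v, hv⟩ : (H.deleteVerts A).verts.Nonempty := by
    rw [← card_pos, hverts]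
    omega
  have h2 : ((H.deleteVerts A).propertyGraph Q s).minDegree 1 ≤
      (n - ⌊α * n⌋₊ - 1).choose (s - 1) := by
    rw [← hverts]
    exact (UniformHypergraph.minDegree_le _ hv).trans
      (UniformHypergraph.degree_le _ hv (by omega))
  have h3 := Nat.choose_mul_pow_le (show n - ⌊α * n⌋₊ - 1 ≤ n - 1 by omega) (s - 1)
  have hC : (0 : ℝ) < ((n - 1).choose (s - 1) : ℝ) := by
    exact_mod_cast Nat.choose_pos (by omega)
  have h4 : 1 / 2 * ((n - 1 : ℕ) : ℝ) ^ (s - 1) ≤ ((n - ⌊α * n⌋₊ - 1 : ℕ) : ℝ) ^ (s - 1) := by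
    refine le_of_mul_le_mul_left ?_ hC
    have h5 : (((n - ⌊α * n⌋₊ - 1).choose (s - 1) : ℕ) : ℝ) * ((n - 1 : ℕ) : ℝ) ^ (s - 1) ≤
        ((n - 1).choose (s - 1) : ℝ) * ((n - ⌊α * n⌋₊ - 1 : ℕ) : ℝ) ^ (s - 1) := by
      exact_mod_cast h3
    refine le_trans ?_ h5
    calc ((n - 1).choose (s - 1) : ℝ) * (1 / 2 * ((n - 1 : ℕ) : ℝ) ^ (s - 1)) =
        (1 / 2 * ((n - 1).choose (s - 1) : ℝ)) * ((n - 1 : ℕ) : ℝ) ^ (s - 1) := by ring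
      _ ≤ _ := by
        refine mul_le_mul_of_nonneg_right (h1.trans ?_) (by positivity)
        exact_mod_cast h2
  -- Passing from α to α/2 absorbs the floor and the subtracted 1, as αn ≥ 2.
  have h5 : ((n - ⌊α * n⌋₊ - 1 : ℕ) : ℝ) ≤ (1 - α / 2) * ((n - 1 : ℕ) : ℝ) := by
    rw [Nat.cast_sub (by omega), Nat.cast_sub (by omega), Nat.cast_sub (by omega)]
    have h6 := Nat.lt_floor_add_one (α * (n : ℝ))
    push_cast
    linarith
  have h6 : (1 : ℝ) / 2 ≤ (1 - α / 2) ^ (s - 1) := by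
    have hn0 : (0 : ℝ) < ((n - 1 : ℕ) : ℝ) ^ (s - 1) := by
      have : (0 : ℝ) < ((n - 1 : ℕ) : ℝ) := by exact_mod_cast (by omega : 0 < n - 1)
      positivity
    refine le_of_mul_le_mul_right (h4.trans ?_) hn0
    rw [← mul_pow]
    exact pow_le_pow_left₀ (Nat.cast_nonneg _) h5 _
  by_contra hsk
  have h7 : (1 - α / 2) ^ (s - 1) ≤ (1 - α / 2) ^ k :=
    pow_le_pow_of_le_one (by linarith) (by linarith) (by omega)
  linarith

end MDigraph

end Main

theorem mainTheorem2 (m r : ℕ) (hm : 2 ≤ m) (hmr : m ≤ r) (μ α : ℝ) (hμ : 0 < μ)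
    (hα : 0 < α) :
    ∃ ρ : ℝ, 0 < ρ ∧ ρ ≤ 1 ∧
      -- degrees in `H - A` measured against `n`, with `n₀` independent of `s`
      (∃ n₀ : ℕ, 0 < n₀ ∧ ∀ s : ℕ, m ≤ s →
        ∀ (V : Type u) (H : MDigraph V m) (n : ℕ), H.verts.card = n → s ≤ n → n₀ ≤ n → m ∣ n →
          H.Fissile →
          (∀ A : Finset V, A ⊆ H.verts → (A.card : ℝ) ≤ α * (n : ℝ) →
            (matchingThreshold s + μ) * ((n - 1).choose (s - 1) : ℝ) ≤
              (((H.deleteVerts A).propertyGraph (MDigraph.Spa ρ) s).minDegree 1 : ℝ)) →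
          (matchingThreshold r + μ) * ((n - 1).choose (r - 1) : ℝ) ≤
            ((H.propertyGraph (MDigraph.Div ∩ MDigraph.Cov) r).minDegree 1 : ℝ) →
          H.HasPerfectMatching) ∧
      -- degrees in `H - A` measured against `n - |A|`
      (∀ s : ℕ, m ≤ s → ∃ n₀ : ℕ, 0 < n₀ ∧
        ∀ (V : Type u) (H : MDigraph V m) (n : ℕ), H.verts.card = n → n₀ ≤ n → m ∣ n →
          H.Fissile →
          (∀ A : Finset V, A ⊆ H.verts → (A.card : ℝ) ≤ α * (n : ℝ) →
            (matchingThreshold s + μ) * ((n - A.card - 1).choose (s - 1) : ℝ) ≤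
              (((H.deleteVerts A).propertyGraph (MDigraph.Spa ρ) s).minDegree 1 : ℝ)) →
          (matchingThreshold r + μ) * ((n - 1).choose (r - 1) : ℝ) ≤
            ((H.propertyGraph (MDigraph.Div ∩ MDigraph.Cov) r).minDegree 1 : ℝ) →
          H.HasPerfectMatching) := by
  -- Smaller sets `A` only weaken the hypothesis, so α may be capped at 1/2.
  have hα' : 0 < min α (1 / 2) := lt_min hα (by norm_num)
  have hmono : ∀ (a n : ℕ), (a : ℝ) ≤ min α (1 / 2) * (n : ℝ) → (a : ℝ) ≤ α * (n : ℝ) :=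
    fun a n h => h.trans (mul_le_mul_of_nonneg_right (min_le_left _ _) (Nat.cast_nonneg _))
  obtain ⟨ρ, hρ, hρ1, h⟩ := MDigraph.exists_rho_forall_hasPerfectMatching.{u} m r hm hmr μ
    (min α (1 / 2)) hμ hα' (min_le_right _ _)
  choose f hf using h
  obtain ⟨S, n₁, hS⟩ := MDigraph.exists_uniformity_bound.{u} (min α (1 / 2)) hα' (min_le_right _ _)
  -- The sum dominates the bounds of all s ≤ S, the only uniformities that can occur in (i).
  refine ⟨ρ, hρ, hρ1, ⟨n₁ + 1 + ∑ s ∈ Finset.range (S + 1), if h : m ≤ s then f s h else 0,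
    by omega, ?_⟩, fun s hs => ⟨f s hs + 1, by omega, ?_⟩⟩
  · rintro s hs V H n rfl hsn hn hmn hH hspace hdiv
    have hth : 1 / 2 ≤ matchingThreshold s + μ := by
      linarith [half_le_matchingThreshold (hm.trans hs)]
    have hsS : s ≤ S := hS V m H (MDigraph.Spa ρ) s (hm.trans hs) hsn (by omega) fun A hA hAc =>
      (mul_le_mul_of_nonneg_right hth (Nat.cast_nonneg _)).trans (hspace A hA (hmono _ _ hAc))
    have hfs : f s hs ≤ ∑ s ∈ Finset.range (S + 1), if h : m ≤ s then f s h else 0 := by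
      have h1 := Finset.single_le_sum (f := fun s => if h : m ≤ s then f s h else 0)
        (fun _ _ => Nat.zero_le _) (Finset.mem_range.2 (Nat.lt_succ_of_le hsS))
      rwa [dif_pos hs] at h1
    refine hf s hs V H (by omega) hmn hH (fun A hA hAc => ?_) hdiv
    refine le_trans (mul_le_mul_of_nonneg_left ?_ (by linarith)) (hspace A hA (hmono _ _ hAc))
    exact_mod_cast Nat.choose_le_choose _ (by omega)
  · rintro V H n rfl hn hmn hH hspace hdiv
    exact hf s hs V H (by omega) hmn hH (fun A hA hAc => hspace A hA (hmono _ _ hAc)) hdiv
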